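/- **Setting.** Let $n\ge 1$, let $\Theta\subset\mathbb R^n$ be compact, and let $H$, $\mathcal H$ be separable complex Hilbert spaces with $H$ compactly and densely embedded in $\mathcal H$. For $\theta\in\Theta$ let $a_\theta,b_\theta$ be non-negative sesquilinear forms on $H$ such that $(\cdot,\cdot)_\theta:=a_\theta+b_\theta$ are inner products on $H$ equivalent to the given one, with norms satisfying $\|u\|_{\theta_1}\le K\|u\|_{\theta_2}$ for all $\theta_1,\theta_2\in\Theta$, and let $|a_{\theta_1}(u,\tilde u)-a_{\theta_2}(u,\tilde u)|\le L_a|\theta_1-\theta_2|\,\|u\|_{\theta_1}\|\tilde u\|_{\theta_1}$. Let $d_\theta$, $\theta\in\Theta$, be inner products on $\mathcal H$ equivalent to the given one, with $d_{\theta_1}[u]\le K_d\,d_{\theta_2}[u]$, and let $d_\theta[u]\le b_\theta[u]$ for $u\in H$. Here $s[u]:=s(u,u)$. For $0<\varepsilon<1$ let $\mathcal L_{\varepsilon,\theta}$ be the self-adjoint operator in $(\mathcal H,d_\theta)$ generated by the form $\varepsilon^{-2}a_\theta+b_\theta$ with form domain $H$. Put $V_\theta:=\{v\in H: a_\theta[v]=0\}$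 and $W_\theta:=\{w\in H:(w,v)_\theta=0\ \forall v\in V_\theta\}$. **Assumptions.** * (H1) For each $\theta\in\Theta$ there is $\nu_\theta>0$ with $a_\theta[w]\ge\nu_\theta\|w\|_\theta^2$ for all $w\in W_\theta$. * (H2) There are a closed subspace $V_\star\subset H$ and $L_\star\ge0$ such that, with $V^\star_\theta:=V_\theta$ for $\theta\ne0$ and $V^\star_0:=V_\star$, one has $\inf_{v_2\in V^\star_{\theta_2}}\|v_1-v_2\|_{\theta_2}\le L_\star|\theta_1-\theta_2|\,\|v_1\|_{\theta_1}$ for all $\theta_1,\theta_2\in\Theta$, $v_1\in V^\star_{\theta_1}$. Moreover $Z$ is a closed subspace of $V_0$ with $V_0=V_\star\dotplus Z$ (direct sum) and $|(v,z)_0|\le K_Z\|v\|_0\|z\|_0$ for $v\in V_\star$, $z\in Z$, for some $0\le K_Z<1$. * (H3) For some $\gamma>0$, $a_\theta[w]\ge\gamma|\theta|^2\|w\|_\theta^2$ for all $\theta\in\Theta$, $w\in W_\theta$. * (H4) $0$ is an interior point of $\Theta$, and there are sesquilinear maps $a_0':V_0\times H\to\mathbb C^n$, $a_0'':V_0\times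 V_0\to\mathbb C^{n\times n}$ and constants $K',K''\ge0$ with $|a_\theta(v,u)-a_0'(v,u)\cdot\theta|\le K'|\theta|^2\|v\|_0\|u\|_0$ and $|a_\theta(v,\tilde v)-a_0''(v,\tilde v)\theta\cdot\theta|\le K''|\theta|^3\|v\|_0\|\tilde v\|_0$ for all $v,\tilde v\in V_0$, $u\in H$, $\theta\in\Theta$. * (H5) $\Theta$ is connected and, for some $L_b\ge0$, $|b_\theta(v,\tilde v)-b_0(v,\tilde v)|\le L_b|\theta|\,\|v\|_0\|\tilde v\|_\theta$ for all $v,\tilde v\in V_0$, $\theta\in\Theta$. * (H6) For $\theta\in\Theta$ there are linear bijections $\mathcal E_\theta$ of $\mathcal H$ that map $V_\star$ bijectively onto $V^\star_\theta$ and satisfy, with constants $K_b,K_e\ge0$: $b_\theta(\mathcal E_\theta v,\mathcal E_\theta\tilde v)=b_0(v,\tilde v)$ and $|b_\theta(\mathcal E_\theta v,z)-b_0(v,z)|\le K_b|\theta|\,\|v\|_0\|z\|_0$ for $v,\tilde v\in V_\star$, $z\in Z$; $d_\theta(\mathcal E_\theta u,\mathcal E_\theta\tilde u)=d_0(u,\tilde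 u)$ for $u,\tilde u\in\mathcal H$; $\mathcal E_0=I$; and $d_{\theta_1}^{1/2}[\mathcal E_{\theta_1}u-\mathcal E_{\theta_2}u]\le K_e|\theta_1-\theta_2|\,d_0^{1/2}[u]$ for $\theta_1,\theta_2\in\Theta$, $u\in\mathcal H$. **The approximating operator.** For $\xi\in\mathbb R^n$ let $N_\xi:V_0\to W_0$ be the linear map with $a_0(N_\xi v,w)=-a_0'(v,w)\cdot\xi$ for all $w\in W_0$, and set $a^{\rm h}_\xi(v,\tilde v):=a_0''(v,\tilde v)\xi\cdot\xi-a_0(N_\xi v,N_\xi\tilde v)$ on $V_0$. Let $\mathcal H_0$ be the closure of $V_\star\dotplus Z$ in $\mathcal H$, let $P$ be the $d_0$-orthogonal projection of $\mathcal H$ onto $\mathcal H_0$, and let $\mathbb L_\xi$ be the self-adjoint operator in $(\mathcal H_0,d_0)$ generated by the form $\mathbb S_\xi(v+z,\tilde v+\tilde z):=a^{\rm h}_\xi(z,\tilde z)+b_0(v+z,\tilde v+\tilde z)$ with form domain $V_\star\dotplus Z$. Let $\lambda^{(1)}_{\varepsilon,\theta}\le\lambda^{(2)}_{\varepsilon,\theta}\le\dots$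 and $\lambda^{(1)}_\xi\le\lambda^{(2)}_\xi\le\dots$ be the eigenvalues of $\mathcal L_{\varepsilon,\theta}$ and $\mathbb L_\xi$, repeated according to multiplicity. **Theorem.** Assume (H1)–(H6). There is a constant $C>0$, independent of $\varepsilon$, $\theta$ and of the index of the eigenvalues, such that for all $0<\varepsilon<1$ and all $\theta\in\Theta$ the following holds. 1. $\mathcal L_{\varepsilon,\theta}$ and $\mathbb L_{\theta/\varepsilon}$ have everywhere defined inverses, and $$\big\|\mathcal L_{\varepsilon,\theta}^{-1}-\mathcal E_\theta\,\mathbb L_{\theta/\varepsilon}^{-1}\,P\,\mathcal E_\theta^{-1}\big\|_{(\mathcal H,d_\theta)\to(\mathcal H,d_\theta)}\le C\varepsilon .$$ 2. If $\dim(V_\star\dotplus Z)=\infty$, then $\big|1/\lambda^{(k)}_{\varepsilon,\theta}-1/\lambda^{(k)}_{\theta/\varepsilon}\big|\le C\varepsilon$ for all $k\ge1$. 3. If $\dim(V_\star\dotplus Z)=N<\infty$, then $\big|1/\lambda^{(k)}_{\varepsilon,\theta}-1/\lambda^{(k)}_{\theta/\varepsilon}\big|\le C\varepsilon$ for $1\le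 k\le N$, and $\big|1/\lambda^{(p)}_{\varepsilon,\theta}\big|\le C\varepsilon$ for all $p\ge N+1$ (with $p\le\dim\mathcal H$, so that $\lambda^{(p)}_{\varepsilon,\theta}$ exists). -/

import Mathlib

open scoped Matrix

namespace AbstractHom

noncomputable section

/-- The parameter space `ℝⁿ` with its Euclidean norm. -/
abbrev Param (n : ℕ) := EuclideanSpace ℝ (Fin n)

/-- Sesquilinear forms: linear in the first and conjugate-linear in the second argument. -/
abbrev SesqForm (X : Type*) [AddCommGroup X] [Module ℂ X] := X →ₗ[ℂ] X →ₗ⋆[ℂ] ℂ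

/-- The form `(x, x') ↦ s (f x, f x')`. -/
def SesqForm.pullback {X Y : Type*} [AddCommGroup X] [Module ℂ X] [AddCommGroup Y] [Module ℂ Y]
    (s : SesqForm Y) (f : X →ₗ[ℂ] Y) : SesqForm X :=
  LinearMap.mk₂'ₛₗ (RingHom.id ℂ) (starRingEnd ℂ) (fun x x' => s (f x) (f x'))
    (by intros; simp) (by intros; simp) (by intros; simp) (by intros; simp)

/-- Non-negative sesquilinear forms: `s[u] = s(u, u)` is real and non-negative for every `u`. -/
structure NonnegForm (X : Type*) [AddCommGroup X] [Module ℂ X] where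
  toForm : SesqForm X
  re_nonneg : ∀ u, 0 ≤ (toForm u u).re
  im_eq_zero : ∀ u, (toForm u u).im = 0

namespace NonnegForm

variable {X : Type*} [AddCommGroup X] [Module ℂ X]

/-- `s[u] = s(u, u)`, as a real number. -/
def quad (s : NonnegForm X) (u : X) : ℝ := (s.toForm u u).re

/-- `s[u]^{1/2}`. -/
def nrm (s : NonnegForm X) (u : X) : ℝ := √(s.quad u)

instance : Add (NonnegForm X) where
  add s t :=
    { toForm := s.toForm + t.toForm
      re_nonneg := fun u => by
        simpa using add_nonneg (s.re_nonneg u) (t.re_nonneg u)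
      im_eq_zero := fun u => by
        simp [s.im_eq_zero u, t.im_eq_zero u] }

/-- For a non-negative form, `s[u] = 0` forces `s(u, v) = 0` for all `v`. -/
theorem apply_eq_zero (s : NonnegForm X) {u : X} (hu : s.toForm u u = 0) (v : X) :
    s.toForm u v = 0 ∧ s.toForm v u = 0 := by
  have key : ∀ c : ℂ, 0 ≤ (c * s.toForm u v + (starRingEnd ℂ) c * s.toForm v u
      + s.toForm v v).re ∧ (c * s.toForm u v + (starRingEnd ℂ) c * s.toForm v u
      + s.toForm v v).im = 0 := by
    intro c
    have e : s.toForm (c • u + v) (c • u + v) = c * s.toForm u v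
        + (starRingEnd ℂ) c * s.toForm v u + s.toForm v v := by
      simp [hu]; ring
    exact ⟨e ▸ s.re_nonneg _, e ▸ s.im_eq_zero _⟩
  have h0 := s.im_eq_zero v
  set p := s.toForm u v
  set q := s.toForm v u
  set r := s.toForm v v
  have k1 := (key 1).2
  have k2 := (key Complex.I).2
  simp [h0] at k1 k2
  have hre : q.re = p.re := by linarith
  have him : q.im = -p.im := by linarith
  have hr : 0 ≤ r.re := s.re_nonneg v
  have m (t : ℝ) : 0 ≤ -(2 * t * (p.re ^ 2 + p.im ^ 2)) + r.re := by
    have h := (key ((t : ℂ) * -(starRingEnd ℂ) p)).1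
    simp [hre, him] at h
    linarith
  have hsq : p.re ^ 2 + p.im ^ 2 = 0 := by
    by_contra hne
    have h := m ((r.re + 1) / (p.re ^ 2 + p.im ^ 2))
    rw [mul_assoc, div_mul_cancel₀ _ hne] at h
    linarith
  have hpre : p.re = 0 := by nlinarith [sq_nonneg p.re, sq_nonneg p.im]
  have hpim : p.im = 0 := by nlinarith [sq_nonneg p.re, sq_nonneg p.im]
  exact ⟨Complex.ext hpre hpim, Complex.ext (by simp [hre, hpre]) (by simp [him, hpim])⟩

/-- The degeneracy subspace `{v | s[v] = 0}` of a non-negative form. -/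
def nullSpace (s : NonnegForm X) : Submodule ℂ X where
  carrier := {v | s.toForm v v = 0}
  add_mem' := by
    intro u v hu hv
    have hu' := s.apply_eq_zero hu v
    simp only [Set.mem_ofPred_eq] at hu hv ⊢
    simp [hu, hv, hu'.1, hu'.2]
  zero_mem' := by simp
  smul_mem' := by
    intro c u hu
    simp only [Set.mem_ofPred_eq] at hu ⊢
    simp [hu]

/-- `s[·]^{1/2}` is a norm equivalent to the given norm. -/
def IsEquivNorm {X : Type*} [NormedAddCommGroup X] [Module ℂ X] (s : NonnegForm X) : Prop :=
  ∃ c > 0, ∃ C > 0, ∀ u, c * ‖u‖ ≤ s.nrm u ∧ s.nrm u ≤ C * ‖u‖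

end NonnegForm

section Operators

variable {X Y : Type*} [AddCommGroup X] [Module ℂ X] [AddCommGroup Y] [Module ℂ Y]

/-- The graph of the operator generated in `(Y, d)` by the form `s`, whose form domain `X` sits in
`Y` by `j`: the pairs `(j x, g)` with `s(x, x') = d(g, j x')` for all `x'`. -/
def formGraph (s : SesqForm X) (j : X →ₗ[ℂ] Y) (d : SesqForm Y) : Submodule ℂ (Y × Y) where
  carrier := {p | ∃ x, j x = p.1 ∧ ∀ x', s x x' = d p.2 (j x')}
  add_mem' := by
    rintro p q ⟨x, hx, hx'⟩ ⟨y, hy, hy'⟩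
    exact ⟨x + y, by simp [hx, hy], fun x' => by simp [hx', hy']⟩
  zero_mem' := ⟨0, by simp, by simp⟩
  smul_mem' := by
    rintro c p ⟨x, hx, hx'⟩
    exact ⟨c • x, by simp [hx], fun x' => by simp [hx']⟩

/-- The (unbounded) operator generated in `(Y, d)` by the form `s` with form domain `X`. -/
def formOperator (s : SesqForm X) (j : X →ₗ[ℂ] Y) (d : SesqForm Y) : Y →ₗ.[ℂ] Y :=
  (formGraph s j d).toLinearPMap

/-- `R` is the everywhere defined inverse of the operator `T`. -/
def IsInverse (T : Y →ₗ.[ℂ] Y) (R : Y →ₗ[ℂ] Y) : Prop :=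
  ∀ g u : Y, R g = u ↔ ∃ h : u ∈ T.domain, T ⟨u, h⟩ = g

/-- `P` is the projection onto the subspace `U` that is orthogonal with respect to `d`. -/
def IsOrthProj (d : SesqForm Y) (U : Submodule ℂ Y) (P : Y →ₗ[ℂ] U) : Prop :=
  ∀ g : Y, ∀ q ∈ U, d (g - P g) q = 0

/-- The eigenspace `{y ∈ dom T | T y = μ y}`. -/
def eigenspace (T : Y →ₗ.[ℂ] Y) (μ : ℂ) : Submodule ℂ Y :=
  (LinearMap.ker (T.toFun - μ • T.domain.subtype)).map T.domain.subtype

/-- The `k`-th (`k = 1, 2, …`) of the real eigenvalues of `T`, in ascending order and repeated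
according to multiplicity: the smallest `t` such that the eigenspaces for eigenvalues `≤ t` have
total dimension at least `k`. -/
def eigenvalue (T : Y →ₗ.[ℂ] Y) (k : ℕ) : ℝ :=
  sInf {t : ℝ | (k : Cardinal) ≤
    Module.rank ℂ ↥(⨆ μ : Set.Iic t, eigenspace T (((μ : ℝ) : ℂ)))}

end Operators

/-- The vector of `ℂⁿ` with the same (real) entries as `θ`. -/
def cvec {n : ℕ} (θ : Param n) : Fin n → ℂ := fun i => ((θ i : ℝ) : ℂ)

/-- The standing setting: the parameter set `Θ`, the forms `a_θ`, `b_θ` on `H`, the inner products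
`d_θ` on `𝓗`, and the compact dense embedding `ι` of `H` in `𝓗`. The values of the forms at
parameters outside `Θ` play no role. -/
structure Setting (n : ℕ) (H 𝓗 : Type*)
    [NormedAddCommGroup H] [InnerProductSpace ℂ H]
    [NormedAddCommGroup 𝓗] [InnerProductSpace ℂ 𝓗] where
  Θ : Set (Param n)
  isCompact_Θ : IsCompact Θ
  a : Param n → NonnegForm H
  b : Param n → NonnegForm H
  /-- Each `(·,·)_θ = a_θ + b_θ` is an equivalent inner product of `H`, … -/
  isEquivNorm_add : ∀ θ ∈ Θ, (a θ + b θ).IsEquivNorm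
  /-- … uniformly in `θ`: `‖u‖_{θ₁} ≤ K ‖u‖_{θ₂}`. -/
  uniform_equiv : ∃ K > 0, ∀ θ₁ ∈ Θ, ∀ θ₂ ∈ Θ, ∀ u,
    (a θ₁ + b θ₁).nrm u ≤ K * (a θ₂ + b θ₂).nrm u
  /-- Lipschitz continuity of `a_θ` in `θ`. -/
  lipschitz_a : ∃ L > 0, ∀ θ₁ ∈ Θ, ∀ θ₂ ∈ Θ, ∀ u v,
    ‖(a θ₁).toForm u v - (a θ₂).toForm u v‖ ≤
      L * ‖θ₁ - θ₂‖ * (a θ₁ + b θ₁).nrm u * (a θ₁ + b θ₁).nrm v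
  ι : H →L[ℂ] 𝓗
  injective_ι : Function.Injective ι
  isCompactOperator_ι : IsCompactOperator ι
  denseRange_ι : DenseRange ι
  d : Param n → NonnegForm 𝓗
  isEquivNorm_d : ∀ θ ∈ Θ, (d θ).IsEquivNorm
  uniform_equiv_d : ∃ K > 0, ∀ θ₁ ∈ Θ, ∀ θ₂ ∈ Θ, ∀ u, (d θ₁).quad u ≤ K * (d θ₂).quad u
  d_le_b : ∀ θ ∈ Θ, ∀ u, (d θ).quad (ι u) ≤ (b θ).quad u

namespace Setting

variable {n : ℕ} {H 𝓗 : Type*} [NormedAddCommGroup H] [InnerProductSpace ℂ H]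
  [NormedAddCommGroup 𝓗] [InnerProductSpace ℂ 𝓗] (S : Setting n H 𝓗)

/-- The norm `‖u‖_θ = (a_θ[u] + b_θ[u])^{1/2}`. -/
def nrm (θ : Param n) (u : H) : ℝ := (S.a θ + S.b θ).nrm u

/-- `V_θ = {v | a_θ[v] = 0}`. -/
def V (θ : Param n) : Submodule ℂ H := (S.a θ).nullSpace

/-- `W_θ`, the orthogonal complement of `V_θ` with respect to `(·,·)_θ`. -/
def W (θ : Param n) : Submodule ℂ H where
  carrier := {w | ∀ v ∈ S.V θ, (S.a θ + S.b θ).toForm w v = 0}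
  add_mem' := by
    intro u w hu hw v hv
    simp [hu v hv, hw v hv]
  zero_mem' := by intro v _; simp
  smul_mem' := by
    intro c w hw v hv
    simp [hw v hv]

/-- The operator `𝓛_{ε,θ}` generated in `(𝓗, d_θ)` by the form `ε⁻² a_θ + b_θ` with form
domain `H`. -/
def op (ε : ℝ) (θ : Param n) : 𝓗 →ₗ.[ℂ] 𝓗 :=
  formOperator (((ε : ℂ) ^ 2)⁻¹ • (S.a θ).toForm + (S.b θ).toForm) S.ι.toLinearMap (S.d θ).toForm

/-- The gap condition (H1). -/
def GapCondition : Prop :=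
  ∀ θ ∈ S.Θ, ∃ ν > 0, ∀ w ∈ S.W θ, ν * S.nrm θ w ^ 2 ≤ (S.a θ).quad w

open Classical in
/-- `V^⋆_θ`, which is `V_θ` for `θ ≠ 0` and `V_⋆` for `θ = 0`. -/
def Vst (Vstar : Submodule ℂ H) (θ : Param n) : Submodule ℂ H :=
  if θ = 0 then Vstar else S.V θ

/-- The removable singularity condition (H2). -/
def RemovableSingularity (Vstar : Submodule ℂ H) : Prop :=
  IsClosed (Vstar : Set H) ∧
  ∃ L ≥ 0, ∀ θ₁ ∈ S.Θ, ∀ θ₂ ∈ S.Θ, ∀ v₁ ∈ S.Vst Vstar θ₁,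
    (⨅ v₂ : S.Vst Vstar θ₂, S.nrm θ₂ (v₁ - v₂)) ≤ L * ‖θ₁ - θ₂‖ * S.nrm θ₁ v₁

/-- `V_⋆ ∔ Z`, for `Z` a subspace of `V_0`. -/
def sumSpace (Vstar : Submodule ℂ H) (Z : Submodule ℂ (S.V 0)) : Submodule ℂ H :=
  Vstar ⊔ Z.map (S.V 0).subtype

/-- `Z` is a closed subspace of `V_0` with `V_0 = V_⋆ ∔ Z`, the direct sum being transversal. -/
def IsDefectSpace (Vstar : Submodule ℂ H) (Z : Submodule ℂ (S.V 0)) : Prop :=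
  IsClosed (Z : Set (S.V 0)) ∧
  S.V 0 = S.sumSpace Vstar Z ∧ Disjoint Vstar (Z.map (S.V 0).subtype) ∧
  ∃ K, 0 ≤ K ∧ K < 1 ∧ ∀ v ∈ Vstar, ∀ z ∈ Z,
    ‖(S.a 0 + S.b 0).toForm v z‖ ≤ K * S.nrm 0 v * S.nrm 0 z

/-- The quadratic bound (H3) for the degeneration of the gap. -/
def QuadraticGap : Prop :=
  ∃ γ > 0, ∀ θ ∈ S.Θ, ∀ w ∈ S.W θ, γ * ‖θ‖ ^ 2 * S.nrm θ w ^ 2 ≤ (S.a θ).quad w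

/-- The regularity (H4) of `a_θ` at the interior point `θ = 0` of `Θ`, with the sesquilinear maps
`a₁ = a'₀` and `a₂ = a''₀`. -/
def RegularAtZero (a₁ : S.V 0 →ₗ[ℂ] H →ₗ⋆[ℂ] (Fin n → ℂ))
    (a₂ : S.V 0 →ₗ[ℂ] S.V 0 →ₗ⋆[ℂ] Matrix (Fin n) (Fin n) ℂ) : Prop :=
  (0 : Param n) ∈ interior S.Θ ∧
  (∃ K ≥ 0, ∀ v : S.V 0, ∀ u : H, ∀ θ ∈ S.Θ,
    ‖(S.a θ).toForm v u - a₁ v u ⬝ᵥ cvec θ‖ ≤ K * ‖θ‖ ^ 2 * S.nrm 0 v * S.nrm 0 u) ∧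
  (∃ K ≥ 0, ∀ v v' : S.V 0, ∀ θ ∈ S.Θ,
    ‖(S.a θ).toForm v v' - (a₂ v v' *ᵥ cvec θ) ⬝ᵥ cvec θ‖ ≤
      K * ‖θ‖ ^ 3 * S.nrm 0 v * S.nrm 0 v')

/-- The Lipschitz continuity (H5) of `b_θ` at `θ = 0`, with `Θ` connected. -/
def LipschitzB : Prop :=
  IsConnected S.Θ ∧
  ∃ L ≥ 0, ∀ v ∈ S.V 0, ∀ v' ∈ S.V 0, ∀ θ ∈ S.Θ,
    ‖(S.b θ).toForm v v' - (S.b 0).toForm v v'‖ ≤ L * ‖θ‖ * S.nrm 0 v * S.nrm θ v'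

/-- `𝓔_θ` restricts to bijections `V_⋆ → V^⋆_θ` which carry `b_0` to `b_θ` and satisfy
`|b_θ(𝓔_θ v, z) - b_0(v, z)| ≤ K_b |θ| ‖v‖_0 ‖z‖_0`. -/
def IsTransfer (Vstar : Submodule ℂ H) (Z : Submodule ℂ (S.V 0))
    (E : Param n → 𝓗 ≃ₗ[ℂ] 𝓗) : Prop :=
  ∃ K ≥ 0, ∀ θ ∈ S.Θ, ∃ T : Vstar ≃ₗ[ℂ] S.Vst Vstar θ,
    (∀ v : Vstar, S.ι (T v : H) = E θ (S.ι v)) ∧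
    (∀ v v' : Vstar, (S.b θ).toForm (T v) (T v') = (S.b 0).toForm v v') ∧
    (∀ v : Vstar, ∀ z ∈ Z, ‖(S.b θ).toForm (T v) z - (S.b 0).toForm v z‖ ≤
      K * ‖θ‖ * S.nrm 0 v * S.nrm 0 z)

/-- The unitarity and Lipschitz condition (H6) for bijections `𝓔_θ` of `𝓗` that extend transfer
operators `V_⋆ → V^⋆_θ`. -/
def UnitaryTransfer (Vstar : Submodule ℂ H) (Z : Submodule ℂ (S.V 0))
    (E : Param n → 𝓗 ≃ₗ[ℂ] 𝓗) : Prop :=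
  S.IsTransfer Vstar Z E ∧
  (∀ θ ∈ S.Θ, ∀ u u' : 𝓗, (S.d θ).toForm (E θ u) (E θ u') = (S.d 0).toForm u u') ∧
  (∀ u : 𝓗, E 0 u = u) ∧
  ∃ K ≥ 0, ∀ θ₁ ∈ S.Θ, ∀ θ₂ ∈ S.Θ, ∀ u : 𝓗,
    (S.d θ₁).nrm (E θ₁ u - E θ₂ u) ≤ K * ‖θ₁ - θ₂‖ * (S.d 0).nrm u

/-- `N` is the solution operator `N_ξ : V_0 → W_0` of the linearised cell problem
`a_0(N_ξ v, w) = - a'_0(v, w) · ξ` for all `w ∈ W_0`. -/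
def IsCorrector (a₁ : S.V 0 →ₗ[ℂ] H →ₗ⋆[ℂ] (Fin n → ℂ)) (ξ : Param n)
    (N : S.V 0 →ₗ[ℂ] S.W 0) : Prop :=
  ∀ (v : S.V 0) (w : S.W 0), (S.a 0).toForm (N v) w = -(a₁ v w ⬝ᵥ cvec ξ)

/-- The operator `N_ξ`; it exists and is unique under (H1) and (H4). -/
def corrector (a₁ : S.V 0 →ₗ[ℂ] H →ₗ⋆[ℂ] (Fin n → ℂ)) (ξ : Param n) :
    S.V 0 →ₗ[ℂ] S.W 0 :=
  Classical.epsilon (S.IsCorrector a₁ ξ)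

/-- The homogenised form `a^h_ξ(v, v') = a''_0(v, v') ξ · ξ - a_0(N_ξ v, N_ξ v')` on `V_0`. -/
def homForm (a₁ : S.V 0 →ₗ[ℂ] H →ₗ⋆[ℂ] (Fin n → ℂ))
    (a₂ : S.V 0 →ₗ[ℂ] S.V 0 →ₗ⋆[ℂ] Matrix (Fin n) (Fin n) ℂ) (ξ : Param n) :
    SesqForm (S.V 0) :=
  LinearMap.mk₂'ₛₗ (RingHom.id ℂ) (starRingEnd ℂ)
      (fun v v' => (a₂ v v' *ᵥ cvec ξ) ⬝ᵥ cvec ξ)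
      (by intros; simp [Matrix.add_mulVec, add_dotProduct])
      (by intros; simp [Matrix.smul_mulVec, smul_dotProduct])
      (by intros; simp [Matrix.add_mulVec, add_dotProduct])
      (by intros; simp [Matrix.smul_mulVec, smul_dotProduct])
    - (S.a 0).toForm.pullback ((S.W 0).subtype ∘ₗ S.corrector a₁ ξ)

/-- The map `(v, z) ↦ v + z` from `V_⋆ × Z` to `H`. -/
def sumMap (Vstar : Submodule ℂ H) (Z : Submodule ℂ (S.V 0)) : Vstar × Z →ₗ[ℂ] H :=
  Vstar.subtype.coprod ((S.V 0).subtype ∘ₗ Z.subtype)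

/-- The form `𝕊_ξ(v + z, v' + z') = a^h_ξ(z, z') + b_0(v + z, v' + z')` on `V_⋆ ∔ Z`, whose
elements `v + z` are represented by the pairs `(v, z)`. -/
def limitForm (Vstar : Submodule ℂ H) (Z : Submodule ℂ (S.V 0))
    (a₁ : S.V 0 →ₗ[ℂ] H →ₗ⋆[ℂ] (Fin n → ℂ))
    (a₂ : S.V 0 →ₗ[ℂ] S.V 0 →ₗ⋆[ℂ] Matrix (Fin n) (Fin n) ℂ) (ξ : Param n) :
    SesqForm (Vstar × Z) :=
  (S.homForm a₁ a₂ ξ).pullback (Z.subtype ∘ₗ LinearMap.snd ℂ Vstar Z)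
    + (S.b 0).toForm.pullback (S.sumMap Vstar Z)

/-- `𝓗_0`, the closure of `V_⋆ ∔ Z` in `𝓗`. -/
def limitSpace (Vstar : Submodule ℂ H) (Z : Submodule ℂ (S.V 0)) : Submodule ℂ 𝓗 :=
  ((S.sumSpace Vstar Z).map S.ι.toLinearMap).topologicalClosure

/-- The embedding of `V_⋆ ∔ Z` in `𝓗_0`. -/
def limitEmbedding (Vstar : Submodule ℂ H) (Z : Submodule ℂ (S.V 0)) :
    Vstar × Z →ₗ[ℂ] S.limitSpace Vstar Z :=
  (S.ι.toLinearMap ∘ₗ S.sumMap Vstar Z).codRestrict _ fun p =>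
    Submodule.le_topologicalClosure _ (Submodule.mem_map_of_mem
      (Submodule.add_mem_sup p.1.2 (Submodule.mem_map_of_mem p.2.2)))

/-- The operator `𝕃_ξ` generated in `(𝓗_0, d_0)` by the form `𝕊_ξ` with form domain
`V_⋆ ∔ Z`. -/
def limitOp (Vstar : Submodule ℂ H) (Z : Submodule ℂ (S.V 0))
    (a₁ : S.V 0 →ₗ[ℂ] H →ₗ⋆[ℂ] (Fin n → ℂ))
    (a₂ : S.V 0 →ₗ[ℂ] S.V 0 →ₗ⋆[ℂ] Matrix (Fin n) (Fin n) ℂ) (ξ : Param n) :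
    S.limitSpace Vstar Z →ₗ.[ℂ] S.limitSpace Vstar Z :=
  formOperator (S.limitForm Vstar Z a₁ a₂ ξ) (S.limitEmbedding Vstar Z)
    ((S.d 0).toForm.pullback (S.limitSpace Vstar Z).subtype)

end Setting

end

end AbstractHom

/-!
Write `φ = v + z + r` with `v ∈ V^⋆_θ`, `z ∈ Z` and a remainder `r`. By (H1)–(H3) one has
`‖r‖ + |θ| ‖z‖ ≲ a_θ[φ]^{1/2}`, so in the energy norm of `ε⁻² a_θ + b_θ` the remainder costs `ε`,
whereas `v` and `z` are only bounded. If `(v₀, z₀)` solves the limit problem at `ξ = θ / ε`, the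
trial field `u₁ = T_θ v₀ + z₀ + N_θ z₀`, with `T_θ` the restriction of `𝓔_θ` to `V_⋆`, has a
residual of order `ε` against each of the three kinds of test vectors: (H6) treats `v`, the limit
equation together with the second-order expansion in (H4) and with (H5) treats `z`, and the
corrector `N_θ` cancels the terms of order `ε⁻² |θ|` against `r`. Since (H3) passes to the limit and
gives `Re a^h_ξ[z] ≳ |ξ|² ‖z‖²`, the norms of `v₀`, `z₀` and `|ξ|² z₀` are controlled by the datum.
The energy estimate for `u - u₁` and `𝓔_θ = I + O(|θ|)` then give the resolvent estimate, uniformly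
in `ε` and `θ`.

The inverses are compact and symmetric, and `𝓔_θ` is an isometry, so the quadratic forms of
`𝓛_{ε,θ}⁻¹` and of `𝓔_θ 𝕃⁻¹ P 𝓔_θ⁻¹` differ by at most `Cε d_θ`. Counting dimensions of spectral
subspaces, as in the min-max principle, compares the eigenvalues. If `dim (V_⋆ ∔ Z) = N`, the limit
operator has no `p`-th eigenvalue for `p > N`; in the encoding its value is then `sInf ∅ = 0` and
`1 / 0 = 0`, so the same comparison bounds `1 / λ^{(p)}_{ε,θ}`.
-/

namespace AbstractHom

noncomputable section

open Filter Topology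

section Homogeneous

theorem le_of_sq_le_mul {x K : ℝ} (hK : 0 ≤ K) (h : x ^ 2 ≤ K * x) : x ≤ K := by
  by_contra! hlt
  nlinarith

theorem le_add_one_mul_of_sq_le {x y K : ℝ} (hK : 0 ≤ K) (hy : 0 ≤ y) (h : x ^ 2 ≤ K * y ^ 2) :
    x ≤ (K + 1) * y := by
  refine le_of_sq_le_sq (h.trans ?_) (by positivity)
  rw [mul_pow]
  gcongr
  nlinarith

variable {P F : Type*} [NormedAddCommGroup P] [NormedSpace ℝ P]

theorem le_of_homogeneous_of_le_on_sphere {f g : P → ℝ} {k : ℕ} (hk : k ≠ 0)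
    (hf : ∀ (t : ℝ) x, 0 ≤ t → f (t • x) = t ^ k * f x)
    (hg : ∀ (t : ℝ) x, 0 ≤ t → g (t • x) = t ^ k * g x)
    {r : ℝ} (hr : 0 < r) (h : ∀ x, ‖x‖ = r → f x ≤ g x) (x : P) : f x ≤ g x := by
  rcases eq_or_ne x 0 with rfl | hx
  · have hf0 := hf 0 0 le_rfl
    have hg0 := hg 0 0 le_rfl
    simp only [smul_zero, zero_pow hk, zero_mul] at hf0 hg0
    rw [hf0, hg0]
  have hx' : 0 < ‖x‖ := norm_pos_iff.2 hx
  have hsphere : ‖(r / ‖x‖) • x‖ = r := by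
    rw [norm_smul, Real.norm_of_nonneg (by positivity), div_mul_cancel₀ _ hx'.ne']
  have hle := h _ hsphere
  rw [hf _ _ (by positivity), hg _ _ (by positivity)] at hle
  exact le_of_mul_le_mul_left hle (by positivity)

theorem eq_zero_of_homogeneous [NormedAddCommGroup F] [NormedSpace ℝ F] {f : P → F} {k : ℕ}
    (hf : ∀ (t : ℝ) x, 0 ≤ t → f (t • x) = t ^ k • f x) {M r : ℝ} (hr : 0 < r)
    (h : ∀ x, ‖x‖ ≤ r → ‖f x‖ ≤ M * ‖x‖ ^ (k + 1)) (x : P) : f x = 0 := by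
  have hsmall : ∀ᶠ t : ℝ in 𝓝[>] 0, ‖t • x‖ ≤ r := by
    have hcont : Tendsto (fun t : ℝ => ‖t • x‖) (𝓝[>] 0) (𝓝 ‖(0 : ℝ) • x‖) :=
      (Continuous.tendsto (by fun_prop) 0).mono_left nhdsWithin_le_nhds
    exact hcont.eventually (ge_mem_nhds (by simpa using hr))
  have hbound : ∀ᶠ t : ℝ in 𝓝[>] 0, ‖f x‖ ≤ M * ‖x‖ ^ (k + 1) * t := by
    filter_upwards [hsmall, self_mem_nhdsWithin] with t ht htpos
    have htpos' : 0 < t := htpos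
    have htx := h _ ht
    rw [hf t x htpos'.le, norm_smul, norm_smul, norm_pow, Real.norm_of_nonneg htpos'.le] at htx
    refine le_of_mul_le_mul_left (htx.trans_eq ?_) (pow_pos htpos' k)
    ring
  have hlim : Tendsto (fun t : ℝ => M * ‖x‖ ^ (k + 1) * t) (𝓝[>] 0) (𝓝 0) := by
    have hcont : Tendsto (fun t : ℝ => M * ‖x‖ ^ (k + 1) * t) (𝓝 0) (𝓝 (M * ‖x‖ ^ (k + 1) * 0)) :=
      Continuous.tendsto (by fun_prop) 0
    rw [mul_zero] at hcont
    exact hcont.mono_left nhdsWithin_le_nhds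
  exact norm_le_zero_iff.1 (ge_of_tendsto hlim hbound)

end Homogeneous

namespace NonnegForm

section Algebra

variable {X Y : Type*} [AddCommGroup X] [Module ℂ X] [AddCommGroup Y] [Module ℂ Y]
  (s : NonnegForm X)

theorem apply_self (u : X) : s.toForm u u = (s.quad u : ℂ) :=
  Complex.ext rfl (s.im_eq_zero u)

theorem conj_symm (u v : X) : starRingEnd ℂ (s.toForm v u) = s.toForm u v := by
  have hu := s.im_eq_zero u
  have hv := s.im_eq_zero v
  have him := s.im_eq_zero (u + v)
  have hre := s.im_eq_zero (u + Complex.I • v)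
  simp only [map_add, LinearMap.add_apply, Complex.add_im, hu, hv, map_smulₛₗ,
    LinearMap.smul_apply, smul_eq_mul, RingHom.id_apply, Complex.conj_I, Complex.mul_im,
    Complex.mul_re, Complex.I_re, Complex.I_im, Complex.neg_re, Complex.neg_im,
    Complex.add_re] at him hre
  apply Complex.ext
  · rw [Complex.conj_re]
    linarith
  · rw [Complex.conj_im]
    linarith

/-- A non-negative form as a semi-inner product. Mathlib's inner products are conjugate-linear in
the first argument, hence the swap. -/
@[reducible]
def preCore : PreInnerProductSpace.Core ℂ X where
  inner x y := s.toForm y x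
  conj_inner_symm x y := s.conj_symm y x
  re_inner_nonneg := s.re_nonneg
  add_left x y z := by simp
  smul_left x y r := by simp

theorem nrm_nonneg (u : X) : 0 ≤ s.nrm u := Real.sqrt_nonneg _

theorem quad_nonneg (u : X) : 0 ≤ s.quad u := s.re_nonneg u

theorem nrm_sq (u : X) : s.nrm u ^ 2 = s.quad u := Real.sq_sqrt (s.re_nonneg u)

theorem norm_apply_le (u v : X) : ‖s.toForm u v‖ ≤ s.nrm u * s.nrm v := by
  rw [mul_comm]
  exact @InnerProductSpace.Core.norm_inner_le_norm ℂ X _ _ _ s.preCore v u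

theorem nrm_add_le (u v : X) : s.nrm (u + v) ≤ s.nrm u + s.nrm v :=
  @norm_add_le X (@InnerProductSpace.Core.toSeminormedAddCommGroup ℂ X _ _ _
    s.preCore).toSeminormedAddGroup u v

theorem nrm_neg (u : X) : s.nrm (-u) = s.nrm u := by
  simp only [nrm, quad, map_neg, LinearMap.neg_apply, neg_neg]

theorem nrm_sub_le (u v : X) : s.nrm (u - v) ≤ s.nrm u + s.nrm v := by
  rw [sub_eq_add_neg, ← s.nrm_neg v]
  exact s.nrm_add_le _ _

theorem quad_add (u v : X) :
    s.quad (u + v) = s.quad u + s.quad v + 2 * (s.toForm u v).re := by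
  have hswap : (s.toForm v u).re = (s.toForm u v).re := by
    rw [← s.conj_symm u v, Complex.conj_re]
  simp only [quad, map_add, LinearMap.add_apply, Complex.add_re, hswap]
  ring

theorem one_sub_mul_quad_add_quad_le {K : ℝ} (hK : 0 ≤ K) {u v : X}
    (h : ‖s.toForm u v‖ ≤ K * s.nrm u * s.nrm v) :
    (1 - K) * (s.quad u + s.quad v) ≤ s.quad (u + v) := by
  have hcross := (abs_le.1 ((Complex.abs_re_le_norm _).trans h)).1
  rw [quad_add, ← s.nrm_sq, ← s.nrm_sq]
  nlinarith [mul_nonneg hK (sq_nonneg (s.nrm u - s.nrm v))]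

theorem toForm_add (s t : NonnegForm X) : (s + t).toForm = s.toForm + t.toForm := rfl

theorem add_quad (s t : NonnegForm X) (u : X) : (s + t).quad u = s.quad u + t.quad u := by
  simp only [quad, toForm_add, LinearMap.add_apply, Complex.add_re]

/-- The non-negative form `c s`, for `0 ≤ c`. -/
def smul (c : ℝ) (hc : 0 ≤ c) : NonnegForm X where
  toForm := (c : ℂ) • s.toForm
  re_nonneg u := by simpa using mul_nonneg hc (s.re_nonneg u)
  im_eq_zero u := by simp [s.im_eq_zero]

/-- The non-negative form `(y, y') ↦ s(f y, f y')`. -/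
def comap (f : Y →ₗ[ℂ] X) : NonnegForm Y where
  toForm := s.toForm.pullback f
  re_nonneg u := s.re_nonneg (f u)
  im_eq_zero u := s.im_eq_zero (f u)

@[simp] theorem comap_apply (f : Y →ₗ[ℂ] X) (y y' : Y) :
    (s.comap f).toForm y y' = s.toForm (f y) (f y') := rfl

@[simp] theorem comap_quad (f : Y →ₗ[ℂ] X) (y : Y) : (s.comap f).quad y = s.quad (f y) := rfl

end Algebra

section EquivNorm

variable {X : Type*} [NormedAddCommGroup X] [NormedSpace ℂ X] {s : NonnegForm X}

theorem isEquivNorm_of_sq_bounds {c C : ℝ} (hc : 0 < c) (hlower : ∀ u, c * ‖u‖ ^ 2 ≤ s.quad u)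
    (hupper : ∀ u, s.quad u ≤ C * ‖u‖ ^ 2) : s.IsEquivNorm := by
  refine ⟨√c, Real.sqrt_pos.2 hc, √(max C 1), Real.sqrt_pos.2 (by positivity), fun u => ⟨?_, ?_⟩⟩
  · refine Real.le_sqrt_of_sq_le ?_
    rw [mul_pow, Real.sq_sqrt hc.le]
    exact hlower u
  · refine Real.sqrt_le_iff.2 ⟨by positivity, ?_⟩
    rw [mul_pow, Real.sq_sqrt (by positivity)]
    exact (hupper u).trans (by gcongr; exact le_max_left _ _)

namespace IsEquivNorm

theorem eq_zero_of_apply_self (hs : s.IsEquivNorm) {u : X} (hu : s.toForm u u = 0) : u = 0 := by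
  obtain ⟨c, hc, _, _, h⟩ := hs
  have hle := (h u).1
  rw [show s.nrm u = 0 by simp [nrm, quad, hu]] at hle
  exact norm_le_zero_iff.1 (nonpos_of_mul_nonpos_right hle hc)

theorem eq_zero_of_quad_eq_zero (hs : s.IsEquivNorm) {u : X} (hu : s.quad u = 0) : u = 0 :=
  hs.eq_zero_of_apply_self (by rw [s.apply_self, hu, Complex.ofReal_zero])

theorem eq_of_forall_apply_eq (hs : s.IsEquivNorm) {u v : X}
    (h : ∀ x, s.toForm u x = s.toForm v x) : u = v := by
  refine sub_eq_zero.1 (hs.eq_zero_of_apply_self ?_)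
  rw [map_sub s.toForm, LinearMap.sub_apply, h, sub_self]

theorem exists_nrm_le (hs : s.IsEquivNorm) : ∃ C : ℝ, ∀ u, s.nrm u ≤ C * ‖u‖ :=
  let ⟨_, _, C, _, h⟩ := hs
  ⟨C, fun u => (h u).2⟩

theorem exists_norm_apply_le (hs : s.IsEquivNorm) :
    ∃ C : ℝ, ∀ u v, ‖s.toForm u v‖ ≤ C * ‖u‖ * ‖v‖ := by
  obtain ⟨_, _, C, _, h⟩ := hs
  refine ⟨C ^ 2, fun u v => (s.norm_apply_le u v).trans ?_⟩
  calc s.nrm u * s.nrm v ≤ (C * ‖u‖) * (C * ‖v‖) :=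
        mul_le_mul (h u).2 (h v).2 (s.nrm_nonneg v) (by positivity)
    _ = _ := by ring

theorem comap_subtype (hs : s.IsEquivNorm) (U : Submodule ℂ X) :
    (s.comap U.subtype).IsEquivNorm := by
  obtain ⟨c, hc, C, hC, h⟩ := hs
  exact ⟨c, hc, C, hC, fun u => h u⟩

end IsEquivNorm

/-- The space `X` with the inner product given by `s`; a copy of `X`, so that it can carry this
norm next to the original one. -/
def FormSpace (s : NonnegForm X) (_ : s.IsEquivNorm) : Type _ := X

variable (hs : s.IsEquivNorm)

instance : AddCommGroup (FormSpace s hs) := inferInstanceAs (AddCommGroup X)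
instance : Module ℂ (FormSpace s hs) := inferInstanceAs (Module ℂ X)

/-- The inner product of `FormSpace s hs`, with the arguments swapped as in `preCore`. -/
@[reducible]
def formCore : InnerProductSpace.Core ℂ (FormSpace s hs) where
  inner x y := s.toForm y x
  conj_inner_symm x y := s.conj_symm y x
  re_inner_nonneg := s.re_nonneg
  add_left x y z := map_add (s.toForm z) x y
  smul_left x y r := LinearMap.map_smulₛₗ (s.toForm y) r x
  definite _ hx := hs.eq_zero_of_apply_self hx

instance : NormedAddCommGroup (FormSpace s hs) := (formCore hs).toNormedAddCommGroup
instance : InnerProductSpace ℂ (FormSpace s hs) := InnerProductSpace.ofCore (formCore hs).toCore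

/-- The identity, as a continuous linear equivalence from `X` to `FormSpace s hs`. -/
def toFormSpace : X ≃L[ℂ] FormSpace s hs :=
  LinearEquiv.toContinuousLinearEquivOfBounds
    ({ toFun x := x
       invFun x := x
       map_add' _ _ := rfl
       map_smul' _ _ := rfl } : X ≃ₗ[ℂ] FormSpace s hs)
    hs.choose_spec.2.choose hs.choose⁻¹
    (fun x => (hs.choose_spec.2.choose_spec.2 x).2)
    (fun x => (le_inv_mul_iff₀ hs.choose_spec.1).2 (hs.choose_spec.2.choose_spec.2 x).1)

theorem inner_toFormSpace (x y : X) :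
    inner ℂ (toFormSpace hs x) (toFormSpace hs y) = s.toForm y x := rfl

instance [CompleteSpace X] : CompleteSpace (FormSpace s hs) :=
  (completeSpace_congr (e := (toFormSpace hs).toEquiv)
    (toFormSpace hs).isUniformEmbedding).1 inferInstance

namespace IsEquivNorm

include hs

theorem continuous_apply {T : Type*} [TopologicalSpace T] {f g : T → X} (hf : Continuous f)
    (hg : Continuous g) : Continuous fun t => s.toForm (f t) (g t) := by
  simp only [← inner_toFormSpace hs]
  fun_prop

theorem eq_zero_of_forall_denseRange {T : Type*} {j : T → X} (hj : DenseRange j) {g : X}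
    (h : ∀ t, s.toForm g (j t) = 0) : g = 0 :=
  hs.eq_zero_of_apply_self (hj.induction_on (p := fun u => s.toForm g u = 0) g
    (isClosed_eq (hs.continuous_apply continuous_const continuous_id) continuous_const) h)

variable [CompleteSpace X]

theorem exists_forall_apply_eq (ℓ : X →ₗ⋆[ℂ] ℂ) {C : ℝ} (hℓ : ∀ x, ‖ℓ x‖ ≤ C * ‖x‖) :
    ∃ x, ∀ y, s.toForm x y = ℓ y := by
  let conjℓ : X →L[ℂ] ℂ := LinearMap.mkContinuous
    { toFun x := starRingEnd ℂ (ℓ x)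
      map_add' _ _ := by simp
      map_smul' _ _ := by simp } C fun x => by simpa using hℓ x
  let z := (InnerProductSpace.toDual ℂ (FormSpace s hs)).symm
    (conjℓ.comp ((toFormSpace hs).symm : FormSpace s hs →L[ℂ] X))
  refine ⟨(toFormSpace hs).symm z, fun y => ?_⟩
  have hriesz : inner ℂ z (toFormSpace hs y) = starRingEnd ℂ (ℓ y) := by
    simp only [z, InnerProductSpace.toDual_symm_apply, ContinuousLinearMap.comp_apply,
      ContinuousLinearEquiv.coe_coe, ContinuousLinearEquiv.symm_apply_apply]
    rfl
  rw [← s.conj_symm, ← inner_toFormSpace hs, ContinuousLinearEquiv.apply_symm_apply, hriesz,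
    Complex.conj_conj]

theorem exists_linearMap_forall_apply_eq {M : Type*} [AddCommGroup M] [Module ℂ M]
    (B : M →ₗ[ℂ] X →ₗ⋆[ℂ] ℂ) (hB : ∀ m, ∃ C : ℝ, ∀ x, ‖B m x‖ ≤ C * ‖x‖) :
    ∃ N : M →ₗ[ℂ] X, ∀ m x, s.toForm (N m) x = B m x := by
  choose C hC using hB
  choose N hN using fun m => hs.exists_forall_apply_eq (B m) (hC m)
  refine ⟨{ toFun := N
            map_add' m m' := hs.eq_of_forall_apply_eq fun z => ?_
            map_smul' c m := hs.eq_of_forall_apply_eq fun z => ?_ }, hN⟩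
  · simp only [hN, map_add, LinearMap.add_apply]
  · simp only [hN, map_smul, LinearMap.smul_apply, RingHom.id_apply]

end IsEquivNorm

end EquivNorm

end NonnegForm

section OrthProj

variable {X : Type*} [AddCommGroup X] [Module ℂ X] {s : NonnegForm X} {U : Submodule ℂ X}
  {P : X →ₗ[ℂ] U}

theorem IsOrthProj.apply_left (hP : IsOrthProj s.toForm U P) (g : X) (q : U) :
    s.toForm (P g) q = s.toForm g q := by
  have h := hP g q q.2
  rw [map_sub, LinearMap.sub_apply, sub_eq_zero] at h
  exact h.symm

theorem IsOrthProj.apply_right (hP : IsOrthProj s.toForm U P) (g : X) (q : U) :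
    s.toForm q (P g) = s.toForm q g := by
  rw [← s.conj_symm, hP.apply_left, s.conj_symm]

theorem IsOrthProj.quad_le (hP : IsOrthProj s.toForm U P) (g : X) :
    s.quad (P g) ≤ s.quad g := by
  have hsq : s.nrm (P g) ^ 2 ≤ s.nrm g * s.nrm (P g) := by
    rw [s.nrm_sq, NonnegForm.quad, hP.apply_left]
    exact (Complex.re_le_norm _).trans (s.norm_apply_le _ _)
  rw [← s.nrm_sq, ← s.nrm_sq g]
  exact pow_le_pow_left₀ (s.nrm_nonneg _) (le_of_sq_le_mul (s.nrm_nonneg _) hsq) 2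

end OrthProj

namespace NonnegForm.IsEquivNorm

variable {X : Type*} [NormedAddCommGroup X] [NormedSpace ℂ X] {s : NonnegForm X}
  (hs : s.IsEquivNorm) {U : Submodule ℂ X}
include hs

theorem orthProj_apply_coe {P : X →ₗ[ℂ] U} (hP : IsOrthProj s.toForm U P) (q : U) : P q = q :=
  (hs.comap_subtype U).eq_of_forall_apply_eq fun x => hP.apply_left q x

theorem exists_isOrthProj [CompleteSpace X] (hU : IsClosed (U : Set X)) :
    ∃ P : X →ₗ[ℂ] U, IsOrthProj s.toForm U P := by
  have : CompleteSpace U := hU.completeSpace_coe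
  obtain ⟨C, hC⟩ := hs.exists_norm_apply_le
  obtain ⟨P, hP⟩ := (hs.comap_subtype U).exists_linearMap_forall_apply_eq
    (LinearMap.mk₂'ₛₗ (RingHom.id ℂ) (starRingEnd ℂ) (fun (g : X) (x : U) => s.toForm g x)
      (by intros; simp) (by intros; simp) (by intros; simp) (by intros; simp))
    (fun g => ⟨C * ‖g‖, fun x => hC g x⟩)
  refine ⟨P, fun g q hq => ?_⟩
  have hPg : s.toForm (P g) q = s.toForm g q := hP g ⟨q, hq⟩
  rw [map_sub, LinearMap.sub_apply, hPg, sub_self]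

end NonnegForm.IsEquivNorm

/-! ### Eigenvalues of operators with compact inverse -/

section FormOperator

variable {X Y : Type*} [AddCommGroup X] [Module ℂ X] [AddCommGroup Y] [Module ℂ Y]

theorem graph_formOperator {s : SesqForm X} {j : X →ₗ[ℂ] Y} {d : SesqForm Y}
    (hj : Function.Injective j) (hd : ∀ g, (∀ x, d g (j x) = 0) → g = 0) :
    (formOperator s j d).graph = formGraph s j d := by
  refine Submodule.toLinearPMap_graph_eq _ ?_
  rintro ⟨u, g⟩ ⟨x, hx, hx'⟩ (rfl : u = 0)
  obtain rfl : x = 0 := hj (hx.trans (map_zero j).symm)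
  refine hd g fun x' => ?_
  rw [← hx' x', map_zero, LinearMap.zero_apply]

theorem isInverse_iff_mem_graph {T : Y →ₗ.[ℂ] Y} {R : Y →ₗ[ℂ] Y} :
    IsInverse T R ↔ ∀ g u, R g = u ↔ (u, g) ∈ T.graph := by
  refine forall₂_congr fun g u => iff_congr Iff.rfl ?_
  rw [LinearPMap.mem_graph_iff]
  exact ⟨fun ⟨h, hg⟩ => ⟨⟨u, h⟩, rfl, hg⟩, by rintro ⟨y, rfl, hg⟩; exact ⟨y.2, hg⟩⟩

theorem isInverse_formOperator {s : SesqForm X} {j : X →ₗ[ℂ] Y} {d : SesqForm Y}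
    (hj : Function.Injective j) (hd : ∀ g, (∀ x, d g (j x) = 0) → g = 0)
    (hs : ∀ x, (∀ x', s x x' = 0) → x = 0) {N : Y →ₗ[ℂ] X}
    (hN : ∀ g x, s (N g) x = d g (j x)) : IsInverse (formOperator s j d) (j ∘ₗ N) := by
  rw [isInverse_iff_mem_graph, graph_formOperator hj hd]
  refine fun g u => ⟨fun hu => ⟨N g, hu, hN g⟩, ?_⟩
  rintro ⟨x, rfl, hx⟩
  have hNg : N g = x := sub_eq_zero.1 <| hs _ fun x' => by
    rw [map_sub, LinearMap.sub_apply, hN, hx, sub_self]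
  rw [LinearMap.comp_apply, hNg]

end FormOperator

/-- `R` is the everywhere defined inverse of `T`, it is symmetric in `(Y, d)`, and
`d[R g] ≤ d(R g, g)`. The inverse of an operator generated by a form which dominates `d` has these
properties; the last one says that the eigenvalues of `T` are at least `1`. -/
structure IsContractiveInverse {Y : Type*} [AddCommGroup Y] [Module ℂ Y] (d : NonnegForm Y)
    (T : Y →ₗ.[ℂ] Y) (R : Y →ₗ[ℂ] Y) : Prop where
  isInverse : IsInverse T R
  symm : ∀ x y, d.toForm (R x) y = d.toForm x (R y)
  quad_le : ∀ x, d.quad (R x) ≤ (d.toForm (R x) x).re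

section InverseFormOperator

variable {X Y : Type*} [NormedAddCommGroup X] [NormedSpace ℂ X] [NormedAddCommGroup Y]
  [NormedSpace ℂ Y] {s : NonnegForm X} {d : NonnegForm Y} {j : X →ₗ[ℂ] Y}

theorem exists_solutionOperator [CompleteSpace X] (hs : s.IsEquivNorm)
    (hds : ∀ x, d.quad (j x) ≤ s.quad x) :
    ∃ N : Y →ₗ[ℂ] X, ∀ g x, s.toForm (N g) x = d.toForm g (j x) := by
  obtain ⟨C, hC⟩ := hs.exists_nrm_le
  refine hs.exists_linearMap_forall_apply_eq
    (LinearMap.mk₂'ₛₗ (RingHom.id ℂ) (starRingEnd ℂ) (fun g x => d.toForm g (j x))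
      (by intros; simp) (by intros; simp) (by intros; simp) (by intros; simp))
    fun g => ⟨d.nrm g * C, fun x => (d.norm_apply_le g (j x)).trans ?_⟩
  rw [mul_assoc]
  exact mul_le_mul_of_nonneg_left ((Real.sqrt_le_sqrt (hds x)).trans (hC x)) (d.nrm_nonneg g)

variable {N : Y →ₗ[ℂ] X} (hN : ∀ g x, s.toForm (N g) x = d.toForm g (j x))
include hN

theorem isContractiveInverse_formOperator (hs : s.IsEquivNorm) (hd : d.IsEquivNorm)
    (hj : Function.Injective j) (hjd : DenseRange j) (hds : ∀ x, d.quad (j x) ≤ s.quad x) :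
    IsContractiveInverse d (formOperator s.toForm j d.toForm) (j ∘ₗ N) where
  isInverse := isInverse_formOperator hj (fun _ => hd.eq_zero_of_forall_denseRange hjd)
    (fun x hx => hs.eq_zero_of_apply_self (hx x)) hN
  symm x y := by
    rw [LinearMap.comp_apply, LinearMap.comp_apply, ← hN, ← d.conj_symm, ← hN, s.conj_symm]
  quad_le g := by
    refine (hds (N g)).trans_eq ?_
    rw [NonnegForm.quad, hN, ← d.conj_symm, Complex.conj_re, LinearMap.comp_apply]

theorem nrm_solutionOperator_le (hds : ∀ x, d.quad (j x) ≤ s.quad x) (g : Y) :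
    s.nrm (N g) ≤ d.nrm g := by
  refine le_of_sq_le_mul (d.nrm_nonneg g) ?_
  calc s.nrm (N g) ^ 2 = (d.toForm g (j (N g))).re := by rw [s.nrm_sq, NonnegForm.quad, hN]
    _ ≤ d.nrm g * d.nrm (j (N g)) := (Complex.re_le_norm _).trans (d.norm_apply_le _ _)
    _ ≤ d.nrm g * s.nrm (N g) :=
        mul_le_mul_of_nonneg_left (Real.sqrt_le_sqrt (hds _)) (d.nrm_nonneg g)

theorem isCompactOperator_comp_solutionOperator (hs : s.IsEquivNorm) (hd : d.IsEquivNorm)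
    (hjc : IsCompactOperator j) (hds : ∀ x, d.quad (j x) ≤ s.quad x) :
    IsCompactOperator (j ∘ₗ N) := by
  obtain ⟨C, hC⟩ := hd.exists_nrm_le
  obtain ⟨c, hc, _, _, hcs⟩ := hs
  refine hjc.comp_clm (N.mkContinuous (c⁻¹ * C) fun g => ?_)
  rw [mul_assoc, le_inv_mul_iff₀ hc]
  exact (hcs (N g)).1.trans ((nrm_solutionOperator_le hN hds g).trans (hC g))

end InverseFormOperator

section SpectralSubspace

/-- The sum of the eigenspaces of `R` for the real eigenvalues in `I`. -/
def spectralSubspace {Y : Type*} [AddCommGroup Y] [Module ℂ Y] (R : Y →ₗ[ℂ] Y) (I : Set ℝ) :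
    Submodule ℂ Y :=
  ⨆ σ : I, Module.End.eigenspace R ((σ : ℝ) : ℂ)

section Symmetric

variable {Y : Type*} [AddCommGroup Y] [Module ℂ Y] {d : NonnegForm Y} {R : Y →ₗ[ℂ] Y}

theorem eigenspace_le_spectralSubspace {I : Set ℝ} {σ : ℝ} (hσ : σ ∈ I) :
    Module.End.eigenspace R (σ : ℂ) ≤ spectralSubspace R I :=
  le_iSup (fun τ : I => Module.End.eigenspace R ((τ : ℝ) : ℂ)) ⟨σ, hσ⟩

theorem spectralSubspace_mono {I J : Set ℝ} (h : I ⊆ J) :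
    spectralSubspace R I ≤ spectralSubspace R J :=
  iSup_le fun σ => eigenspace_le_spectralSubspace (h σ.2)

variable (hR : ∀ x y, d.toForm (R x) y = d.toForm x (R y))
include hR

theorem apply_eq_zero_of_mem_eigenspace {σ τ : ℝ} (hne : σ ≠ τ) {x y : Y}
    (hx : x ∈ Module.End.eigenspace R (σ : ℂ)) (hy : y ∈ Module.End.eigenspace R (τ : ℂ)) :
    d.toForm x y = 0 := by
  have hxy := hR x y
  rw [Module.End.mem_eigenspace_iff.1 hx, Module.End.mem_eigenspace_iff.1 hy, map_smul,
    LinearMap.smul_apply, map_smulₛₗ, Complex.conj_ofReal, smul_eq_mul, smul_eq_mul] at hxy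
  refine (mul_eq_mul_right_iff.1 hxy).resolve_left fun h => hne ?_
  exact Complex.ofReal_injective h

theorem apply_eq_zero_of_mem_spectralSubspace {I J : Set ℝ} (hIJ : Disjoint I J) {x y : Y}
    (hx : x ∈ spectralSubspace R I) (hy : y ∈ spectralSubspace R J) : d.toForm x y = 0 := by
  have hker : ∀ σ ∈ I, ∀ e ∈ Module.End.eigenspace R (σ : ℂ), d.toForm e y = 0 := by
    intro σ hσ e he
    suffices hle : spectralSubspace R J ≤ LinearMap.ker (d.toForm e) from hle hy
    exact iSup_le fun τ f hf => apply_eq_zero_of_mem_eigenspace hR (hIJ.ne_of_mem hσ τ.2) he hf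
  suffices hle : spectralSubspace R I ≤ LinearMap.ker (d.toForm.flip y) from hle hx
  exact iSup_le fun σ e he => hker σ σ.2 e he

theorem exists_finsupp_of_mem_spectralSubspace {I : Set ℝ} {u : Y}
    (hu : u ∈ spectralSubspace R I) :
    ∃ f : I →₀ Y, (d.toForm (R u) u).re = ∑ σ ∈ f.support, (σ : ℝ) * d.quad (f σ) ∧
      d.quad u = ∑ σ ∈ f.support, d.quad (f σ) := by
  obtain ⟨f, hf, rfl⟩ := (Submodule.mem_iSup_iff_exists_finsupp _ _).1 hu
  have hRf : ∀ σ, R (f σ) = ((σ : ℝ) : ℂ) • f σ := fun σ => Module.End.mem_eigenspace_iff.1 (hf σ)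
  have horth : ∀ σ τ, τ ≠ σ → d.toForm (f τ) (f σ) = 0 := fun σ τ hne =>
    apply_eq_zero_of_mem_eigenspace hR (fun h => hne (Subtype.ext h)) (hf τ) (hf σ)
  refine ⟨f, ?_, ?_⟩
  all_goals
    simp only [NonnegForm.quad, Finsupp.sum, map_sum, LinearMap.sum_apply, Complex.re_sum]
    refine Finset.sum_congr rfl fun σ hσ => ?_
    rw [Finset.sum_eq_single_of_mem σ hσ fun τ _ hne => by simp [hRf, horth σ τ hne]]
  simp [hRf]

theorem mul_quad_le_of_mem_spectralSubspace {I : Set ℝ} {s : ℝ} (hI : ∀ σ ∈ I, s ≤ σ) {u : Y}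
    (hu : u ∈ spectralSubspace R I) : s * d.quad u ≤ (d.toForm (R u) u).re := by
  obtain ⟨f, hform, hquad⟩ := exists_finsupp_of_mem_spectralSubspace hR hu
  rw [hform, hquad, Finset.mul_sum]
  exact Finset.sum_le_sum fun σ _ => mul_le_mul_of_nonneg_right (hI σ σ.2) (d.quad_nonneg _)

theorem le_mul_quad_of_mem_spectralSubspace {I : Set ℝ} {s : ℝ} (hI : ∀ σ ∈ I, σ ≤ s) {u : Y}
    (hu : u ∈ spectralSubspace R I) : (d.toForm (R u) u).re ≤ s * d.quad u := by
  obtain ⟨f, hform, hquad⟩ := exists_finsupp_of_mem_spectralSubspace hR hu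
  rw [hform, hquad, Finset.mul_sum]
  exact Finset.sum_le_sum fun σ _ => mul_le_mul_of_nonneg_right (hI σ σ.2) (d.quad_nonneg _)

end Symmetric

variable {Y : Type*} [NormedAddCommGroup Y] [NormedSpace ℂ Y] [CompleteSpace Y] {d : NonnegForm Y}
  {R : Y →ₗ[ℂ] Y} (hd : d.IsEquivNorm) (hc : IsCompactOperator R)
  (hR : ∀ x y, d.toForm (R x) y = d.toForm x (R y))
include hd hc hR

open NonnegForm in
theorem eq_zero_of_forall_mem_eigenspace {u : Y}
    (hu : ∀ σ : ℝ, ∀ e ∈ Module.End.eigenspace R (σ : ℂ), d.toForm u e = 0) : u = 0 := by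
  let e := toFormSpace hd
  let R' : FormSpace d hd →L[ℂ] FormSpace d hd :=
    (e : Y →L[ℂ] FormSpace d hd) ∘L ⟨R, hc.continuous⟩ ∘L (e.symm : FormSpace d hd →L[ℂ] Y)
  have hc' : IsCompactOperator R' :=
    (IsCompactOperator.comp_clm (f := R) hc (e.symm : FormSpace d hd →L[ℂ] Y)).clm_comp
      (e : Y →L[ℂ] FormSpace d hd)
  have hR' : (R' : FormSpace d hd →ₗ[ℂ] FormSpace d hd).IsSymmetric :=
    fun x y => (hR (e.symm y) (e.symm x)).symm
  have horth :
      e u ∈ (⨆ μ, Module.End.eigenspace (R' : FormSpace d hd →ₗ[ℂ] FormSpace d hd) μ)ᗮ := by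
    rw [← Submodule.iInf_orthogonal, Submodule.mem_iInf]
    refine fun μ => (Submodule.mem_orthogonal _ _).2 fun x hx => ?_
    rcases eq_or_ne x 0 with rfl | hx0
    · exact inner_zero_left _
    have hμ : ((μ.re : ℝ) : ℂ) = μ := Complex.conj_eq_iff_re.1
      (hR'.conj_eigenvalue_eq_self (Module.End.hasEigenvalue_of_hasEigenvector ⟨hx, hx0⟩))
    refine hu μ.re (e.symm x) ?_
    rw [hμ]
    exact hx
  rw [R'.orthogonalComplement_iSup_eigenspaces_eq_bot hc' hR', Submodule.mem_bot] at horth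
  exact e.map_eq_zero_iff.1 horth

theorem mem_closure_spectralSubspace_Iio {s : ℝ} {u : Y}
    (hu : ∀ e ∈ spectralSubspace R (Set.Ici s), d.toForm u e = 0) :
    u ∈ (spectralSubspace R (Set.Iio s)).topologicalClosure := by
  set K := spectralSubspace R (Set.Iio s)
  obtain ⟨P, hP⟩ := hd.exists_isOrthProj K.isClosed_topologicalClosure
  have hclosure : ∀ p ∈ K.topologicalClosure, ∀ e ∈ spectralSubspace R (Set.Ici s),
      d.toForm p e = 0 := fun p hp e he =>
    closure_minimal (s := (K : Set Y))
      (fun x hx => apply_eq_zero_of_mem_spectralSubspace hR (Set.Iio_disjoint_Ici le_rfl) hx he)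
      (isClosed_eq (hd.continuous_apply continuous_id continuous_const) continuous_const) hp
  have hsub : u - P u = 0 := by
    refine eq_zero_of_forall_mem_eigenspace hd hc hR fun σ e he => ?_
    rcases lt_or_ge σ s with hσ | hσ
    · exact hP u e (K.le_topologicalClosure (eigenspace_le_spectralSubspace (I := Set.Iio s) hσ he))
    · have he' := eigenspace_le_spectralSubspace (I := Set.Ici s) hσ he
      rw [map_sub, LinearMap.sub_apply, hu e he', hclosure _ (P u).2 e he', sub_self]
  rw [sub_eq_zero.1 hsub]
  exact (P u).2

theorem le_mul_quad_of_forall_apply_eq_zero {s : ℝ} {u : Y}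
    (hu : ∀ e ∈ spectralSubspace R (Set.Ici s), d.toForm u e = 0) :
    (d.toForm (R u) u).re ≤ s * d.quad u := by
  have hclosed : IsClosed {x | (d.toForm (R x) x).re ≤ s * (d.toForm x x).re} :=
    isClosed_le (Complex.continuous_re.comp (hd.continuous_apply hc.continuous continuous_id))
      ((Complex.continuous_re.comp (hd.continuous_apply continuous_id continuous_id)).const_mul s)
  exact closure_minimal (s := (spectralSubspace R (Set.Iio s) : Set Y))
    (fun x hx => le_mul_quad_of_mem_spectralSubspace hR (fun σ hσ => le_of_lt hσ) hx) hclosed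
    (mem_closure_spectralSubspace_Iio hd hc hR hu)

end SpectralSubspace

theorem rank_le_finrank_of_separatingLeft {U W : Type*} [AddCommGroup U] [Module ℂ U]
    [AddCommGroup W] [Module ℂ W] [FiniteDimensional ℂ W] {B : U →ₗ[ℂ] W →ₗ⋆[ℂ] ℂ}
    (hB : B.SeparatingLeft) : Module.rank ℂ U ≤ Module.finrank ℂ W := by
  let b := Module.finBasis ℂ W
  let f : U →ₗ[ℂ] Fin (Module.finrank ℂ W) → ℂ := LinearMap.pi fun i => B.flip (b i)
  have hf : Function.Injective f := (injective_iff_map_eq_zero f).2 fun u hu =>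
    hB u fun w => LinearMap.congr_fun (b.ext (f₂ := 0) fun i => congrFun hu i) w
  simpa using LinearMap.lift_rank_le_of_injective f hf

theorem natCast_le_rank_spectralSubspace_of_form_le {Y Y' : Type*} [NormedAddCommGroup Y]
    [NormedSpace ℂ Y] [NormedAddCommGroup Y'] [NormedSpace ℂ Y'] [CompleteSpace Y']
    {d : NonnegForm Y} (hd : d.IsEquivNorm) {R : Y →ₗ[ℂ] Y}
    (hR : ∀ x y, d.toForm (R x) y = d.toForm x (R y)) {d' : NonnegForm Y'} (hd' : d'.IsEquivNorm)
    {R' : Y' →ₗ[ℂ] Y'} (hR' : ∀ x y, d'.toForm (R' x) y = d'.toForm x (R' y))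
    (hc' : IsCompactOperator R') {Φ : Y →ₗ[ℂ] Y'} (hΦ : ∀ y, d'.quad (Φ y) ≤ d.quad y) {δ : ℝ}
    (hRR : ∀ y, (d.toForm (R y) y).re - δ * d.quad y ≤ (d'.toForm (R' (Φ y)) (Φ y)).re)
    {σ τ : ℝ} (hσ : 0 ≤ σ) (hστ : σ + δ < τ) {k : ℕ}
    (hk : (k : Cardinal) ≤ Module.rank ℂ (spectralSubspace R (Set.Ici τ))) :
    (k : Cardinal) ≤ Module.rank ℂ (spectralSubspace R' (Set.Ici σ)) := by
  set U := spectralSubspace R (Set.Ici τ)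
  set U' := spectralSubspace R' (Set.Ici σ)
  by_contra! hlt
  have : FiniteDimensional ℂ U' :=
    Module.rank_lt_aleph0_iff.1 (hlt.trans Cardinal.natCast_lt_aleph0)
  let B : U →ₗ[ℂ] U' →ₗ⋆[ℂ] ℂ :=
    LinearMap.mk₂'ₛₗ (RingHom.id ℂ) (starRingEnd ℂ) (fun u e => d'.toForm (Φ u) e)
      (by intros; simp) (by intros; simp) (by intros; simp) (by intros; simp)
  have hB : B.SeparatingLeft := by
    intro u hu
    have hupper := le_mul_quad_of_forall_apply_eq_zero hd' hc' hR' (s := σ) (u := Φ u)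
      fun e he => hu ⟨e, he⟩
    have hlower := mul_quad_le_of_mem_spectralSubspace hR (fun τ' hτ' => hτ') u.2
    have hcompare := mul_le_mul_of_nonneg_left (hΦ u) hσ
    have hzero : d.quad (u : Y) = 0 := by
      nlinarith [hRR u, d.quad_nonneg (u : Y)]
    exact Subtype.ext (hd.eq_zero_of_quad_eq_zero hzero)
  have hle := hk.trans (rank_le_finrank_of_separatingLeft hB)
  rw [← Module.finrank_eq_rank] at hlt
  exact (Nat.cast_le.1 hle).not_gt (Nat.cast_lt.1 hlt)

section Eigenvalue

section Module

variable {Y : Type*} [AddCommGroup Y] [Module ℂ Y] {T : Y →ₗ.[ℂ] Y} {R : Y →ₗ[ℂ] Y}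

theorem eigenvalue_eq_zero_of_rank_lt {k : ℕ} (hk : Module.rank ℂ Y < k) :
    eigenvalue T k = 0 := by
  rw [eigenvalue, Set.eq_empty_of_forall_notMem (s := {t : ℝ | _}) fun t ht =>
    (ht.trans (Submodule.rank_le _)).not_gt hk, Real.sInf_empty]

theorem IsInverse.mem_eigenspace_iff (hR : IsInverse T R) {μ : ℂ} {u : Y} :
    u ∈ eigenspace T μ ↔ R (μ • u) = u := by
  rw [hR]
  simp only [eigenspace, Submodule.mem_map, LinearMap.mem_ker, LinearMap.sub_apply,
    LinearMap.smul_apply, sub_eq_zero]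
  exact ⟨by rintro ⟨y, hy, rfl⟩; exact ⟨y.2, hy⟩, fun ⟨h, hTu⟩ => ⟨⟨u, h⟩, hTu, rfl⟩⟩

theorem IsInverse.eigenspace_eq (hR : IsInverse T R) {μ : ℝ} (hμ : μ ≠ 0) :
    eigenspace T (μ : ℂ) = Module.End.eigenspace R ((μ⁻¹ : ℝ) : ℂ) := by
  ext u
  rw [hR.mem_eigenspace_iff, Module.End.mem_eigenspace_iff, map_smul, Complex.ofReal_inv,
    eq_inv_smul_iff₀ (Complex.ofReal_ne_zero.2 hμ)]

end Module

namespace IsContractiveInverse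

variable {Y : Type*} [NormedAddCommGroup Y] [NormedSpace ℂ Y] {d : NonnegForm Y}
  {T : Y →ₗ.[ℂ] Y} {R : Y →ₗ[ℂ] Y} (hR : IsContractiveInverse d T R) (hd : d.IsEquivNorm)
include hR hd

theorem eigenspace_eq_bot {μ : ℝ} (hμ : μ < 1) : eigenspace T (μ : ℂ) = ⊥ := by
  refine (Submodule.eq_bot_iff _).2 fun u hu => hd.eq_zero_of_quad_eq_zero ?_
  rw [hR.isInverse.mem_eigenspace_iff] at hu
  have hle := hR.quad_le ((μ : ℂ) • u)
  rw [hu, map_smulₛₗ, Complex.conj_ofReal, d.apply_self, smul_eq_mul, ← Complex.ofReal_mul,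
    Complex.ofReal_re] at hle
  nlinarith [d.quad_nonneg u]

theorem iSup_eigenspace_eq {t : ℝ} (ht : 0 < t) :
    ⨆ μ : Set.Iic t, eigenspace T ((μ : ℝ) : ℂ) = spectralSubspace R (Set.Ici t⁻¹) := by
  refine le_antisymm (iSup_le fun μ => ?_) (iSup_le fun σ => ?_)
  · rcases lt_or_ge (μ : ℝ) 1 with hμ | hμ
    · exact (hR.eigenspace_eq_bot hd hμ).trans_le bot_le
    · have hμ0 : 0 < (μ : ℝ) := one_pos.trans_le hμ
      rw [hR.isInverse.eigenspace_eq hμ0.ne']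
      exact eigenspace_le_spectralSubspace (I := Set.Ici t⁻¹) (inv_anti₀ hμ0 μ.2)
  · have hσ : 0 < (σ : ℝ) := (inv_pos.2 ht).trans_le σ.2
    rw [← inv_inv (σ : ℝ), ← hR.isInverse.eigenspace_eq (inv_pos.2 hσ).ne']
    exact le_iSup (fun μ : Set.Iic t => eigenspace T ((μ : ℝ) : ℂ))
      ⟨(σ : ℝ)⁻¹, inv_le_of_inv_le₀ ht σ.2⟩

theorem one_le_of_natCast_le_rank {k : ℕ} (hk : 1 ≤ k) {t : ℝ}
    (ht : (k : Cardinal) ≤ Module.rank ℂ ↥(⨆ μ : Set.Iic t, eigenspace T ((μ : ℝ) : ℂ))) :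
    1 ≤ t := by
  by_contra! hlt
  have hbot : ⨆ μ : Set.Iic t, eigenspace T ((μ : ℝ) : ℂ) = ⊥ :=
    iSup_eq_bot.2 fun μ => hR.eigenspace_eq_bot hd (lt_of_le_of_lt μ.2 hlt)
  rw [hbot, rank_bot] at ht
  exact hk.not_gt (Nat.lt_succ_of_le (by exact_mod_cast ht))

theorem one_div_eigenvalue_nonneg {k : ℕ} (hk : 1 ≤ k) : 0 ≤ 1 / eigenvalue T k :=
  one_div_nonneg.2 <| Real.sInf_nonneg fun _ ht =>
    zero_le_one.trans (hR.one_le_of_natCast_le_rank hd hk ht)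

theorem le_one_div_eigenvalue {k : ℕ} (hk : 1 ≤ k) {σ : ℝ} (hσ : 0 < σ)
    (h : (k : Cardinal) ≤ Module.rank ℂ (spectralSubspace R (Set.Ici σ))) :
    σ ≤ 1 / eigenvalue T k := by
  have hone := fun t => hR.one_le_of_natCast_le_rank hd hk (t := t)
  rw [← inv_inv σ, ← hR.iSup_eigenspace_eq hd (inv_pos.2 hσ)] at h
  have hle : eigenvalue T k ≤ σ⁻¹ := csInf_le ⟨1, fun t => hone t⟩ h
  have hpos : 0 < eigenvalue T k := one_pos.trans_le (le_csInf ⟨_, h⟩ fun t => hone t)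
  rwa [one_div, le_inv_comm₀ hσ hpos]

theorem natCast_le_rank_spectralSubspace {k : ℕ} (hk : 1 ≤ k) {σ : ℝ} (hσ : 0 < σ)
    (h : σ < 1 / eigenvalue T k) :
    (k : Cardinal) ≤ Module.rank ℂ (spectralSubspace R (Set.Ici σ)) := by
  have hpos : 0 < eigenvalue T k := one_div_pos.1 (hσ.trans h)
  rw [one_div, lt_inv_comm₀ hσ hpos] at h
  obtain ⟨t, ht, htσ⟩ := exists_lt_of_csInf_lt
    (Set.nonempty_iff_ne_empty.2 fun hempty =>
      hpos.ne' (by rw [eigenvalue, hempty, Real.sInf_empty])) h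
  have ht0 : 0 < t := one_pos.trans_le (hR.one_le_of_natCast_le_rank hd hk ht)
  rw [Set.mem_ofPred_eq, hR.iSup_eigenspace_eq hd ht0] at ht
  exact ht.trans (Submodule.rank_mono (spectralSubspace_mono
    (Set.Ici_subset_Ici.2 ((le_inv_comm₀ hσ ht0).2 htσ.le))))

theorem one_div_eigenvalue_sub_le {Y' : Type*} [NormedAddCommGroup Y'] [NormedSpace ℂ Y']
    [CompleteSpace Y'] {d' : NonnegForm Y'} (hd' : d'.IsEquivNorm) {T' : Y' →ₗ.[ℂ] Y'}
    {R' : Y' →ₗ[ℂ] Y'} (hR' : IsContractiveInverse d' T' R') (hc' : IsCompactOperator R')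
    {Φ : Y →ₗ[ℂ] Y'} (hΦ : ∀ y, d'.quad (Φ y) ≤ d.quad y) {δ : ℝ} (hδ : 0 ≤ δ)
    (hRR : ∀ y, (d.toForm (R y) y).re - δ * d.quad y ≤ (d'.toForm (R' (Φ y)) (Φ y)).re)
    {k : ℕ} (hk : 1 ≤ k) : 1 / eigenvalue T k - 1 / eigenvalue T' k ≤ δ := by
  by_contra! hlt
  obtain ⟨σ, hσ', hσ⟩ := exists_between (lt_sub_comm.1 hlt)
  obtain ⟨τ, hστ, hτ⟩ := exists_between (lt_sub_iff_add_lt.1 hσ)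
  have hσ0 : 0 < σ := (hR'.one_div_eigenvalue_nonneg hd' hk).trans_lt hσ'
  have hrank := hR.natCast_le_rank_spectralSubspace hd hk (by linarith) hτ
  exact hσ'.not_ge <| hR'.le_one_div_eigenvalue hd' hk hσ0 <|
    natCast_le_rank_spectralSubspace_of_form_le hd hR.symm hd' hR'.symm hc' hΦ hRR hσ0.le hστ hrank

end IsContractiveInverse

theorem abs_one_div_eigenvalue_sub_le {Y Y₀ : Type*} [NormedAddCommGroup Y] [NormedSpace ℂ Y]
    [CompleteSpace Y] [NormedAddCommGroup Y₀] [NormedSpace ℂ Y₀] {U : Submodule ℂ Y₀}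
    [CompleteSpace U] {d : NonnegForm Y} (hd : d.IsEquivNorm) {T : Y →ₗ.[ℂ] Y} {R : Y →ₗ[ℂ] Y}
    (hR : IsContractiveInverse d T R) (hc : IsCompactOperator R) {d₀ : NonnegForm Y₀}
    (hd₀ : d₀.IsEquivNorm) {T₀ : U →ₗ.[ℂ] U} {R₀ : U →ₗ[ℂ] U}
    (hR₀ : IsContractiveInverse (d₀.comap U.subtype) T₀ R₀) (hc₀ : IsCompactOperator R₀)
    {P : Y₀ →ₗ[ℂ] U} (hP : IsOrthProj d₀.toForm U P) {E : Y₀ ≃ₗ[ℂ] Y}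
    (hE : ∀ u u', d.toForm (E u) (E u') = d₀.toForm u u') {δ : ℝ} (hδ : 0 ≤ δ)
    (hest : ∀ g, d.nrm (R g - E (R₀ (P (E.symm g)))) ≤ δ * d.nrm g) {k : ℕ} (hk : 1 ≤ k) :
    |1 / eigenvalue T k - 1 / eigenvalue T₀ k| ≤ δ := by
  have hquad : ∀ u, d.quad (E u) = d₀.quad u := fun u => congrArg Complex.re (hE u u)
  have hform : ∀ u, |(d.toForm (R (E u)) (E u)).re - (d₀.toForm (R₀ (P u)) (P u)).re| ≤
      δ * d₀.quad u := fun u => by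
    rw [hP.apply_right, ← hE, ← Complex.sub_re, ← LinearMap.sub_apply, ← map_sub]
    calc _ ≤ _ := (Complex.abs_re_le_norm _).trans (d.norm_apply_le _ _)
      _ ≤ δ * d.nrm (E u) * d.nrm (E u) := mul_le_mul_of_nonneg_right
          (by simpa only [LinearEquiv.symm_apply_apply] using hest (E u)) (d.nrm_nonneg _)
      _ = δ * d₀.quad u := by rw [mul_assoc, ← sq, d.nrm_sq, hquad]
  refine abs_sub_le_iff.2 ⟨?_, ?_⟩
  · refine hR.one_div_eigenvalue_sub_le hd (hd₀.comap_subtype U) hR₀ hc₀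
      (Φ := P ∘ₗ E.symm.toLinearMap) (fun y => ?_) hδ (fun y => ?_) hk
    · obtain ⟨u, rfl⟩ := E.surjective y
      simpa [hquad] using hP.quad_le u
    · obtain ⟨u, rfl⟩ := E.surjective y
      have hu := (abs_le.1 (hform u)).2
      simp only [LinearMap.comp_apply, LinearEquiv.coe_coe, LinearEquiv.symm_apply_apply,
        NonnegForm.comap_apply, Submodule.subtype_apply, hquad]
      linarith
  · refine hR₀.one_div_eigenvalue_sub_le (hd₀.comap_subtype U) hd hR hc
      (Φ := E.toLinearMap ∘ₗ U.subtype) (fun q => (hquad q).le) hδ (fun q => ?_) hk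
    have hq := (abs_le.1 (hform q)).1
    rw [hd₀.orthProj_apply_coe hP] at hq
    simp only [LinearMap.comp_apply, LinearEquiv.coe_coe, NonnegForm.comap_apply,
      NonnegForm.comap_quad, Submodule.subtype_apply]
    linarith

end Eigenvalue

/-! ### The hypotheses in the norm of `H` -/

namespace Setting

section Basic

variable {n : ℕ} {H 𝓗 : Type*} [NormedAddCommGroup H] [InnerProductSpace ℂ H]
  [NormedAddCommGroup 𝓗] [InnerProductSpace ℂ 𝓗] (S : Setting n H 𝓗) {θ : Param n}

theorem nrm_sq_eq (θ : Param n) (u : H) : S.nrm θ u ^ 2 = (S.a θ).quad u + (S.b θ).quad u := by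
  rw [nrm, NonnegForm.nrm_sq, NonnegForm.add_quad]

theorem nrm_nonneg (θ : Param n) (u : H) : 0 ≤ S.nrm θ u := NonnegForm.nrm_nonneg _ _

theorem a_nrm_le (θ : Param n) (u : H) : (S.a θ).nrm u ≤ S.nrm θ u :=
  Real.sqrt_le_sqrt (by rw [NonnegForm.add_quad]; linarith [(S.b θ).quad_nonneg u])

theorem b_nrm_le (θ : Param n) (u : H) : (S.b θ).nrm u ≤ S.nrm θ u :=
  Real.sqrt_le_sqrt (by rw [NonnegForm.add_quad]; linarith [(S.a θ).quad_nonneg u])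

theorem a_apply_left {v : H} (hv : v ∈ S.V θ) (u : H) : (S.a θ).toForm v u = 0 :=
  ((S.a θ).apply_eq_zero hv u).1

theorem a_apply_right {v : H} (hv : v ∈ S.V θ) (u : H) : (S.a θ).toForm u v = 0 :=
  ((S.a θ).apply_eq_zero hv u).2

theorem nrm_sq_of_mem_V {v : H} (hv : v ∈ S.V θ) : S.nrm θ v ^ 2 = (S.b θ).quad v := by
  rw [nrm_sq_eq, NonnegForm.quad, S.a_apply_left hv, Complex.zero_re, zero_add]

theorem Vst_zero (Vstar : Submodule ℂ H) : S.Vst Vstar 0 = Vstar := if_pos rfl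

theorem Vst_of_ne_zero (Vstar : Submodule ℂ H) (hθ : θ ≠ 0) : S.Vst Vstar θ = S.V θ := if_neg hθ

theorem Vst_le_V {Vstar : Submodule ℂ H} (h : Vstar ≤ S.V 0) (θ : Param n) :
    S.Vst Vstar θ ≤ S.V θ := by
  rcases eq_or_ne θ 0 with rfl | hθ
  · rwa [Vst_zero]
  · rw [S.Vst_of_ne_zero _ hθ]

end Basic

section Bounds

variable {n : ℕ} {H 𝓗 : Type*} [NormedAddCommGroup H] [InnerProductSpace ℂ H]
  [NormedAddCommGroup 𝓗] [InnerProductSpace ℂ 𝓗] (S : Setting n H 𝓗)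

/-- The norms `‖·‖_θ`, `θ ∈ Θ`, are uniformly equivalent to the norm of `H`, with constant `B`. -/
structure NormBounds (B : ℝ) : Prop where
  one_le : 1 ≤ B
  zero_mem : (0 : Param n) ∈ S.Θ
  norm_le : ∀ θ ∈ S.Θ, ∀ u, ‖u‖ ≤ B * S.nrm θ u
  nrm_le : ∀ θ ∈ S.Θ, ∀ u, S.nrm θ u ≤ B * ‖u‖

theorem exists_normBounds (h0 : (0 : Param n) ∈ S.Θ) : ∃ B, S.NormBounds B := by
  obtain ⟨c, hc, C, -, h⟩ := S.isEquivNorm_add 0 h0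
  obtain ⟨K, hK, hunif⟩ := S.uniform_equiv
  have hnorm (B : ℝ) (hB : K / c ≤ B) (θ) (hθ : θ ∈ S.Θ) (u : H) : ‖u‖ ≤ B * S.nrm θ u :=
    calc ‖u‖ ≤ K / c * S.nrm θ u := by
          rw [div_mul_eq_mul_div, le_div_iff₀ hc, mul_comm]
          exact (h u).1.trans (hunif 0 h0 θ hθ u)
      _ ≤ _ := mul_le_mul_of_nonneg_right hB (S.nrm_nonneg _ _)
  have hnrm (B : ℝ) (hB : K * C ≤ B) (θ) (hθ : θ ∈ S.Θ) (u : H) : S.nrm θ u ≤ B * ‖u‖ :=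
    calc S.nrm θ u ≤ K * (S.nrm 0 u) := hunif θ hθ 0 h0 u
      _ ≤ K * (C * ‖u‖) := by gcongr; exact (h u).2
      _ = K * C * ‖u‖ := by ring
      _ ≤ _ := by gcongr
  exact ⟨max 1 (max (K / c) (K * C)), le_max_left _ _, h0,
    hnorm _ ((le_max_left _ _).trans (le_max_right _ _)),
    hnrm _ ((le_max_right _ _).trans (le_max_right _ _))⟩

namespace NormBounds

variable {S} {B : ℝ} (hB : S.NormBounds B)
include hB

theorem pos : 0 < B := one_pos.trans_le hB.one_le

theorem le_mul_norm_mul_norm {θ θ' : Param n} (hθ : θ ∈ S.Θ) (hθ' : θ' ∈ S.Θ) {x t K C : ℝ}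
    (hK : 0 ≤ K) (hC : K * B ^ 2 ≤ C) (ht : 0 ≤ t) {u v : H}
    (h : x ≤ K * t * S.nrm θ u * S.nrm θ' v) : x ≤ C * t * ‖u‖ * ‖v‖ := by
  have hB0 := hB.pos
  calc x ≤ K * t * S.nrm θ u * S.nrm θ' v := h
    _ ≤ K * t * (B * ‖u‖) * (B * ‖v‖) := by
        gcongr
        · exact S.nrm_nonneg _ _
        · exact hB.nrm_le θ hθ u
        · exact hB.nrm_le θ' hθ' v
    _ = K * B ^ 2 * t * ‖u‖ * ‖v‖ := by ring
    _ ≤ _ := by gcongr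

theorem mul_norm_sq_le {θ : Param n} (hθ : θ ∈ S.Θ) {u : H} {ν t q C : ℝ} (hν : 0 < ν)
    (ht : 0 ≤ t) (hC : B ^ 2 / ν ≤ C) (hq : 0 ≤ q) (h : ν * t * S.nrm θ u ^ 2 ≤ q) :
    t * ‖u‖ ^ 2 ≤ C * q :=
  calc t * ‖u‖ ^ 2 ≤ t * (B * S.nrm θ u) ^ 2 := by gcongr; exact hB.norm_le θ hθ u
    _ = B ^ 2 / ν * (ν * t * S.nrm θ u ^ 2) := by field_simp
    _ ≤ B ^ 2 / ν * q := by gcongr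
    _ ≤ C * q := by gcongr

theorem eventually_norm_apply_le {s : Param n → NonnegForm H}
    (hs : ∀ θ u, (s θ).nrm u ≤ S.nrm θ u) :
    ∀ᶠ C : ℝ in atTop, ∀ θ ∈ S.Θ, ∀ u v, ‖(s θ).toForm u v‖ ≤ C * ‖u‖ * ‖v‖ := by
  filter_upwards [eventually_ge_atTop (1 * B ^ 2)] with C hC θ hθ u v
  have h : ‖(s θ).toForm u v‖ ≤ 1 * 1 * S.nrm θ u * S.nrm θ v := by
    rw [one_mul, one_mul]
    exact ((s θ).norm_apply_le u v).trans (mul_le_mul (hs θ u) (hs θ v)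
      (NonnegForm.nrm_nonneg _ _) (S.nrm_nonneg _ _))
  simpa using hB.le_mul_norm_mul_norm hθ hθ zero_le_one hC zero_le_one h

theorem eventually_a_sub_le :
    ∀ᶠ C : ℝ in atTop, ∀ θ ∈ S.Θ, ∀ u v,
      ‖(S.a θ).toForm u v - (S.a 0).toForm u v‖ ≤ C * ‖θ‖ * ‖u‖ * ‖v‖ := by
  obtain ⟨L, hL, h⟩ := S.lipschitz_a
  filter_upwards [eventually_ge_atTop (L * B ^ 2)] with C hC θ hθ u v
  exact hB.le_mul_norm_mul_norm hθ hθ hL.le hC (norm_nonneg θ)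
    (by simpa only [sub_zero, nrm] using h θ hθ 0 hB.zero_mem u v)

theorem eventually_gap_zero (h1 : S.GapCondition) :
    ∀ᶠ C : ℝ in atTop, ∀ w ∈ S.W 0, ‖w‖ ^ 2 ≤ C * (S.a 0).quad w := by
  obtain ⟨ν, hν, h⟩ := h1 0 hB.zero_mem
  filter_upwards [eventually_ge_atTop (B ^ 2 / ν)] with C hC w hw
  simpa using hB.mul_norm_sq_le hB.zero_mem hν zero_le_one hC ((S.a 0).quad_nonneg w)
    (by simpa using h w hw)

theorem eventually_gap (h3 : S.QuadraticGap) :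
    ∀ᶠ C : ℝ in atTop, ∀ θ ∈ S.Θ, ∀ w ∈ S.W θ, ‖θ‖ ^ 2 * ‖w‖ ^ 2 ≤ C * (S.a θ).quad w := by
  obtain ⟨γ, hγ, h⟩ := h3
  filter_upwards [eventually_ge_atTop (B ^ 2 / γ)] with C hC θ hθ w hw
  exact hB.mul_norm_sq_le hθ hγ (sq_nonneg _) hC ((S.a θ).quad_nonneg w) (h θ hθ w hw)

-- The infimum in (H2) need not be attained; enlarging the constant gives a near-minimiser.
theorem eventually_near {Vstar : Submodule ℂ H} (h2 : S.RemovableSingularity Vstar) :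
    ∀ᶠ C : ℝ in atTop, ∀ θ₁ ∈ S.Θ, ∀ θ₂ ∈ S.Θ, ∀ v₁ ∈ S.Vst Vstar θ₁, ∃ v₂ ∈ S.Vst Vstar θ₂,
      ‖v₁ - v₂‖ ≤ C * ‖θ₁ - θ₂‖ * ‖v₁‖ := by
  obtain ⟨_, L, hL, h⟩ := h2
  have hB0 := hB.pos
  filter_upwards [eventually_ge_atTop (B * ((L + 1) * B))] with C hC θ₁ hθ₁ θ₂ hθ₂ v₁ hv₁
  rcases eq_or_ne θ₁ θ₂ with rfl | hθ
  · exact ⟨v₁, hv₁, by simp⟩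
  rcases eq_or_ne v₁ 0 with rfl | hv
  · exact ⟨0, Submodule.zero_mem _, by simp⟩
  have hslack : 0 < B * ‖θ₁ - θ₂‖ * ‖v₁‖ :=
    mul_pos (mul_pos hB0 (norm_pos_iff.2 (sub_ne_zero.2 hθ))) (norm_pos_iff.2 hv)
  have hinf : (⨅ v₂ : S.Vst Vstar θ₂, S.nrm θ₂ (v₁ - v₂)) < (L + 1) * B * ‖θ₁ - θ₂‖ * ‖v₁‖ :=
    calc _ ≤ L * ‖θ₁ - θ₂‖ * S.nrm θ₁ v₁ := h θ₁ hθ₁ θ₂ hθ₂ v₁ hv₁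
      _ ≤ L * ‖θ₁ - θ₂‖ * (B * ‖v₁‖) := by gcongr; exact hB.nrm_le θ₁ hθ₁ v₁
      _ < L * ‖θ₁ - θ₂‖ * (B * ‖v₁‖) + B * ‖θ₁ - θ₂‖ * ‖v₁‖ := lt_add_of_pos_right _ hslack
      _ = _ := by ring
  obtain ⟨v₂, hv₂⟩ := exists_lt_of_ciInf_lt hinf
  refine ⟨v₂, v₂.2, ?_⟩
  calc ‖v₁ - v₂‖ ≤ B * S.nrm θ₂ (v₁ - v₂) := hB.norm_le θ₂ hθ₂ _
    _ ≤ B * ((L + 1) * B * ‖θ₁ - θ₂‖ * ‖v₁‖) := by gcongr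
    _ = B * ((L + 1) * B) * ‖θ₁ - θ₂‖ * ‖v₁‖ := by ring
    _ ≤ _ := by gcongr

theorem eventually_direct {Vstar : Submodule ℂ H} {Z : Submodule ℂ (S.V 0)}
    (hZ : S.IsDefectSpace Vstar Z) :
    ∀ᶠ C : ℝ in atTop, ∀ v ∈ Vstar, ∀ z ∈ Z, ‖v‖ ≤ C * ‖v + z‖ ∧ ‖(z : H)‖ ≤ C * ‖v + z‖ := by
  obtain ⟨_, _, _, K, hK0, hK1, hangle⟩ := hZ
  have h1K : 0 < 1 - K := sub_pos.2 hK1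
  filter_upwards [eventually_ge_atTop (B ^ 2 / (1 - K) * B ^ 2 + 1)] with C hC v hv z hz
  have hsum : (1 - K) * (S.nrm 0 v ^ 2 + S.nrm 0 (z : H) ^ 2) ≤ S.nrm 0 (v + z) ^ 2 := by
    simpa only [nrm, NonnegForm.nrm_sq] using
      (S.a 0 + S.b 0).one_sub_mul_quad_add_quad_le hK0 (hangle v hv z hz)
  have hsummand (x : H) (hx : S.nrm 0 x ^ 2 ≤ S.nrm 0 v ^ 2 + S.nrm 0 (z : H) ^ 2) :
      ‖x‖ ≤ C * ‖v + z‖ := by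
    have hsq : ‖x‖ ^ 2 ≤ B ^ 2 / (1 - K) * B ^ 2 * ‖v + z‖ ^ 2 :=
      calc ‖x‖ ^ 2 = 1 * ‖x‖ ^ 2 := (one_mul _).symm
        _ ≤ B ^ 2 / (1 - K) * S.nrm 0 (v + z) ^ 2 :=
            hB.mul_norm_sq_le hB.zero_mem h1K zero_le_one le_rfl (sq_nonneg _)
              (by rw [mul_one]; exact le_trans (by gcongr) hsum)
        _ ≤ B ^ 2 / (1 - K) * (B * ‖v + z‖) ^ 2 := by
            gcongr
            · exact S.nrm_nonneg _ _
            · exact hB.nrm_le 0 hB.zero_mem _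
        _ = _ := by ring
    exact (le_add_one_mul_of_sq_le (by positivity) (norm_nonneg _) hsq).trans (by gcongr)
  exact ⟨hsummand v (le_add_of_nonneg_right (sq_nonneg _)),
    hsummand z (le_add_of_nonneg_left (sq_nonneg _))⟩

section Regularity

variable {a₁ : S.V 0 →ₗ[ℂ] H →ₗ⋆[ℂ] (Fin n → ℂ)}
  {a₂ : S.V 0 →ₗ[ℂ] S.V 0 →ₗ⋆[ℂ] Matrix (Fin n) (Fin n) ℂ}

theorem eventually_a_sub_a₁_le (h4 : S.RegularAtZero a₁ a₂) :
    ∀ᶠ C : ℝ in atTop, ∀ v : S.V 0, ∀ u : H, ∀ θ ∈ S.Θ,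
      ‖(S.a θ).toForm v u - a₁ v u ⬝ᵥ cvec θ‖ ≤ C * ‖θ‖ ^ 2 * ‖v‖ * ‖u‖ := by
  obtain ⟨_, ⟨K, hK, h⟩, _⟩ := h4
  filter_upwards [eventually_ge_atTop (K * B ^ 2)] with C hC v u θ hθ
  exact hB.le_mul_norm_mul_norm hB.zero_mem hB.zero_mem hK hC (by positivity) (h v u θ hθ)

theorem eventually_a_sub_a₂_le (h4 : S.RegularAtZero a₁ a₂) :
    ∀ᶠ C : ℝ in atTop, ∀ v v' : S.V 0, ∀ θ ∈ S.Θ,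
      ‖(S.a θ).toForm v v' - (a₂ v v' *ᵥ cvec θ) ⬝ᵥ cvec θ‖ ≤ C * ‖θ‖ ^ 3 * ‖v‖ * ‖v'‖ := by
  obtain ⟨_, _, ⟨K, hK, h⟩⟩ := h4
  filter_upwards [eventually_ge_atTop (K * B ^ 2)] with C hC v v' θ hθ
  exact hB.le_mul_norm_mul_norm hB.zero_mem hB.zero_mem hK hC (by positivity) (h v v' θ hθ)

end Regularity

theorem eventually_b_sub_le (h5 : ∃ L ≥ 0, ∀ v ∈ S.V 0, ∀ v' ∈ S.V 0, ∀ θ ∈ S.Θ,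
      ‖(S.b θ).toForm v v' - (S.b 0).toForm v v'‖ ≤ L * ‖θ‖ * S.nrm 0 v * S.nrm θ v') :
    ∀ᶠ C : ℝ in atTop, ∀ v ∈ S.V 0, ∀ v' ∈ S.V 0, ∀ θ ∈ S.Θ,
      ‖(S.b θ).toForm v v' - (S.b 0).toForm v v'‖ ≤ C * ‖θ‖ * ‖v‖ * ‖v'‖ := by
  obtain ⟨L, hL, h⟩ := h5
  filter_upwards [eventually_ge_atTop (L * B ^ 2)] with C hC v hv v' hv' θ hθ
  exact hB.le_mul_norm_mul_norm hB.zero_mem hθ hL hC (norm_nonneg θ) (h v hv v' hv' θ hθ)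

theorem eventually_d_le :
    ∀ᶠ C : ℝ in atTop, ∀ θ ∈ S.Θ, ∀ u, (S.d θ).nrm (S.ι u) ≤ C * ‖u‖ := by
  filter_upwards [eventually_ge_atTop B] with C hC θ hθ u
  calc (S.d θ).nrm (S.ι u) ≤ (S.b θ).nrm u := Real.sqrt_le_sqrt (S.d_le_b θ hθ u)
    _ ≤ S.nrm θ u := S.b_nrm_le θ u
    _ ≤ B * ‖u‖ := hB.nrm_le θ hθ u
    _ ≤ _ := by gcongr

end NormBounds

/-- `T` is a transfer operator `V_⋆ → V^⋆_θ` induced by `𝓔_θ` as in (H6), with its estimates in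
the norm of `H` and with constant `C`. -/
structure IsBoundedTransfer {Vstar : Submodule ℂ H} (Z : Submodule ℂ (S.V 0))
    (E : Param n → 𝓗 ≃ₗ[ℂ] 𝓗) (C : ℝ) (θ : Param n) (T : Vstar ≃ₗ[ℂ] S.Vst Vstar θ) : Prop where
  ι_apply : ∀ v : Vstar, S.ι (T v : H) = E θ (S.ι v)
  b_apply : ∀ v v' : Vstar, (S.b θ).toForm (T v) (T v') = (S.b 0).toForm v v'
  b_sub_le : ∀ v : Vstar, ∀ z ∈ Z, ‖(S.b θ).toForm (T v) z - (S.b 0).toForm v z‖ ≤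
    C * ‖θ‖ * ‖v‖ * ‖z‖
  norm_apply_le : ∀ v : Vstar, ‖T v‖ ≤ C * ‖v‖
  norm_le : ∀ v : Vstar, ‖v‖ ≤ C * ‖T v‖

/-- The estimates in (H1)–(H6), expressed in the norm of `H` and with a common constant `C`. -/
structure Bounds (Vstar : Submodule ℂ H) (Z : Submodule ℂ (S.V 0))
    (a₁ : S.V 0 →ₗ[ℂ] H →ₗ⋆[ℂ] (Fin n → ℂ))
    (a₂ : S.V 0 →ₗ[ℂ] S.V 0 →ₗ⋆[ℂ] Matrix (Fin n) (Fin n) ℂ)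
    (E : Param n → 𝓗 ≃ₗ[ℂ] 𝓗) (C : ℝ) : Prop extends S.NormBounds C where
  zero_mem_interior : (0 : Param n) ∈ interior S.Θ
  norm_param_le : ∀ θ ∈ S.Θ, ‖θ‖ ≤ C
  a_le : ∀ θ ∈ S.Θ, ∀ u v, ‖(S.a θ).toForm u v‖ ≤ C * ‖u‖ * ‖v‖
  b_le : ∀ θ ∈ S.Θ, ∀ u v, ‖(S.b θ).toForm u v‖ ≤ C * ‖u‖ * ‖v‖
  a_sub_le : ∀ θ ∈ S.Θ, ∀ u v,
    ‖(S.a θ).toForm u v - (S.a 0).toForm u v‖ ≤ C * ‖θ‖ * ‖u‖ * ‖v‖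
  gap_zero : ∀ w ∈ S.W 0, ‖w‖ ^ 2 ≤ C * (S.a 0).quad w
  gap : ∀ θ ∈ S.Θ, ∀ w ∈ S.W θ, ‖θ‖ ^ 2 * ‖w‖ ^ 2 ≤ C * (S.a θ).quad w
  isClosed_Vstar : IsClosed (Vstar : Set H)
  near : ∀ θ₁ ∈ S.Θ, ∀ θ₂ ∈ S.Θ, ∀ v₁ ∈ S.Vst Vstar θ₁, ∃ v₂ ∈ S.Vst Vstar θ₂,
    ‖v₁ - v₂‖ ≤ C * ‖θ₁ - θ₂‖ * ‖v₁‖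
  isClosed_Z : IsClosed (Z : Set (S.V 0))
  V_zero_eq : S.V 0 = S.sumSpace Vstar Z
  direct : ∀ v ∈ Vstar, ∀ z ∈ Z, ‖v‖ ≤ C * ‖v + z‖ ∧ ‖(z : H)‖ ≤ C * ‖v + z‖
  a_sub_a₁_le : ∀ v : S.V 0, ∀ u : H, ∀ θ ∈ S.Θ,
    ‖(S.a θ).toForm v u - a₁ v u ⬝ᵥ cvec θ‖ ≤ C * ‖θ‖ ^ 2 * ‖v‖ * ‖u‖
  a_sub_a₂_le : ∀ v v' : S.V 0, ∀ θ ∈ S.Θ,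
    ‖(S.a θ).toForm v v' - (a₂ v v' *ᵥ cvec θ) ⬝ᵥ cvec θ‖ ≤ C * ‖θ‖ ^ 3 * ‖v‖ * ‖v'‖
  b_sub_le : ∀ v ∈ S.V 0, ∀ v' ∈ S.V 0, ∀ θ ∈ S.Θ,
    ‖(S.b θ).toForm v v' - (S.b 0).toForm v v'‖ ≤ C * ‖θ‖ * ‖v‖ * ‖v'‖
  transfer : ∀ θ ∈ S.Θ, ∃ T : Vstar ≃ₗ[ℂ] S.Vst Vstar θ, S.IsBoundedTransfer Z E C θ T
  d_le : ∀ θ ∈ S.Θ, ∀ u, (S.d θ).nrm (S.ι u) ≤ C * ‖u‖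
  d_E : ∀ θ ∈ S.Θ, ∀ u u' : 𝓗, (S.d θ).toForm (E θ u) (E θ u') = (S.d 0).toForm u u'
  E_sub_le : ∀ θ ∈ S.Θ, ∀ u : 𝓗, (S.d θ).nrm (E θ u - u) ≤ C * ‖θ‖ * (S.d 0).nrm u

variable {S} {Vstar : Submodule ℂ H} {Z : Submodule ℂ (S.V 0)}
  {a₁ : S.V 0 →ₗ[ℂ] H →ₗ⋆[ℂ] (Fin n → ℂ)}
  {a₂ : S.V 0 →ₗ[ℂ] S.V 0 →ₗ⋆[ℂ] Matrix (Fin n) (Fin n) ℂ}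
  {E : Param n → 𝓗 ≃ₗ[ℂ] 𝓗}

theorem nrm_transfer {θ : Param n} (hV : Vstar ≤ S.V 0) {T : Vstar ≃ₗ[ℂ] S.Vst Vstar θ}
    (hT : ∀ v v' : Vstar, (S.b θ).toForm (T v) (T v') = (S.b 0).toForm v v') (v : Vstar) :
    S.nrm θ (T v) = S.nrm 0 v := by
  rw [← sq_eq_sq₀ (S.nrm_nonneg _ _) (S.nrm_nonneg _ _),
    S.nrm_sq_of_mem_V (S.Vst_le_V hV θ (T v).2), S.nrm_sq_of_mem_V (hV v.2),
    NonnegForm.quad, NonnegForm.quad, hT]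

theorem NormBounds.eventually_transfer {B : ℝ} (hB : S.NormBounds B) (hV : Vstar ≤ S.V 0)
    (h6 : S.IsTransfer Vstar Z E) :
    ∀ᶠ C : ℝ in atTop, ∀ θ ∈ S.Θ, ∃ T : Vstar ≃ₗ[ℂ] S.Vst Vstar θ,
      S.IsBoundedTransfer Z E C θ T := by
  obtain ⟨K, hK, h⟩ := h6
  have hB0 := hB.pos
  have h0 := hB.zero_mem
  filter_upwards [eventually_ge_atTop (K * B ^ 2), eventually_ge_atTop (B ^ 2)] with C hKC hBC θ hθ
  obtain ⟨T, hι, hb, hbz⟩ := h θ hθ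
  have hnrm := nrm_transfer hV hb
  refine ⟨T, hι, hb, fun v z hz =>
    hB.le_mul_norm_mul_norm h0 h0 hK hKC (norm_nonneg θ) (hbz v z hz), fun v => ?_, fun v => ?_⟩
  · calc ‖(T v : H)‖ ≤ B * S.nrm θ (T v) := hB.norm_le θ hθ _
      _ = B * S.nrm 0 v := by rw [hnrm]
      _ ≤ B * (B * ‖(v : H)‖) := by gcongr; exact hB.nrm_le 0 h0 _
      _ = B ^ 2 * ‖(v : H)‖ := by ring
      _ ≤ _ := mul_le_mul_of_nonneg_right hBC (norm_nonneg _)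
  · calc ‖(v : H)‖ ≤ B * S.nrm 0 v := hB.norm_le 0 h0 _
      _ = B * S.nrm θ (T v) := by rw [hnrm]
      _ ≤ B * (B * ‖(T v : H)‖) := by gcongr; exact hB.nrm_le θ hθ _
      _ = B ^ 2 * ‖(T v : H)‖ := by ring
      _ ≤ _ := mul_le_mul_of_nonneg_right hBC (norm_nonneg _)

theorem NormBounds.eventually_E_sub_le {B : ℝ} (hB : S.NormBounds B)
    (h6 : S.UnitaryTransfer Vstar Z E) :
    ∀ᶠ C : ℝ in atTop, ∀ θ ∈ S.Θ, ∀ u : 𝓗,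
      (S.d θ).nrm (E θ u - u) ≤ C * ‖θ‖ * (S.d 0).nrm u := by
  obtain ⟨_, _, hE0, K, _, h⟩ := h6
  filter_upwards [eventually_ge_atTop K] with C hC θ hθ u
  have hlip := h θ hθ 0 hB.zero_mem u
  rw [hE0, sub_zero] at hlip
  have := (S.d 0).nrm_nonneg u
  exact hlip.trans (by gcongr)

theorem exists_bounds (h1 : S.GapCondition) (h2 : S.RemovableSingularity Vstar)
    (hZ : S.IsDefectSpace Vstar Z) (h3 : S.QuadraticGap) (h4 : S.RegularAtZero a₁ a₂)
    (h5 : ∃ L ≥ 0, ∀ v ∈ S.V 0, ∀ v' ∈ S.V 0, ∀ θ ∈ S.Θ,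
      ‖(S.b θ).toForm v v' - (S.b 0).toForm v v'‖ ≤ L * ‖θ‖ * S.nrm 0 v * S.nrm θ v')
    (h6 : S.UnitaryTransfer Vstar Z E) : ∃ C, S.Bounds Vstar Z a₁ a₂ E C := by
  have h0 : (0 : Param n) ∈ S.Θ := interior_subset h4.1
  have hV : Vstar ≤ S.V 0 := hZ.2.1 ▸ le_sup_left
  obtain ⟨B, hB⟩ := S.exists_normBounds h0
  obtain ⟨ρ, hρ⟩ := S.isCompact_Θ.isBounded.exists_norm_le
  refine Eventually.exists (f := atTop) ?_
  filter_upwards [eventually_ge_atTop B, eventually_ge_atTop ρ,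
    hB.eventually_norm_apply_le S.a_nrm_le, hB.eventually_norm_apply_le S.b_nrm_le,
    hB.eventually_a_sub_le, hB.eventually_gap_zero h1, hB.eventually_gap h3,
    hB.eventually_near h2, hB.eventually_direct hZ, hB.eventually_a_sub_a₁_le h4,
    hB.eventually_a_sub_a₂_le h4, hB.eventually_b_sub_le h5, hB.eventually_transfer hV h6.1,
    hB.eventually_d_le, hB.eventually_E_sub_le h6] with
    C hBC hρC ha hb hsub hgap₀ hgap hnear hdirect ha₁ ha₂ hbsub htransfer hd hE
  exact
  { one_le := hB.one_le.trans hBC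
    zero_mem := h0
    norm_le := fun θ hθ u =>
      (hB.norm_le θ hθ u).trans (mul_le_mul_of_nonneg_right hBC (S.nrm_nonneg θ u))
    nrm_le := fun θ hθ u =>
      (hB.nrm_le θ hθ u).trans (mul_le_mul_of_nonneg_right hBC (norm_nonneg u))
    zero_mem_interior := h4.1
    norm_param_le := fun θ hθ => (hρ θ hθ).trans hρC
    a_le := ha
    b_le := hb
    a_sub_le := hsub
    gap_zero := hgap₀
    gap := hgap
    isClosed_Vstar := h2.1
    near := hnear
    isClosed_Z := hZ.1
    V_zero_eq := hZ.2.1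
    direct := hdirect
    a_sub_a₁_le := ha₁
    a_sub_a₂_le := ha₂
    b_sub_le := hbsub
    transfer := htransfer
    d_le := hd
    d_E := h6.2.1
    E_sub_le := hE }

end Bounds

end Setting

/-! ### The corrector and the homogenized form -/

theorem cvec_smul {n : ℕ} (t : ℝ) (θ : Param n) : cvec (t • θ) = (t : ℂ) • cvec θ := by
  ext i
  simp [cvec]

theorem dotProduct_cvec_smul {n : ℕ} (x : Fin n → ℂ) (t : ℝ) (θ : Param n) :
    x ⬝ᵥ cvec (t • θ) = t • (x ⬝ᵥ cvec θ) := by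
  rw [cvec_smul, dotProduct_smul, Complex.coe_smul]

theorem mulVec_cvec_smul_dotProduct {n : ℕ} (M : Matrix (Fin n) (Fin n) ℂ) (t : ℝ) (θ : Param n) :
    (M *ᵥ cvec (t • θ)) ⬝ᵥ cvec (t • θ) = t ^ 2 • ((M *ᵥ cvec θ) ⬝ᵥ cvec θ) := by
  rw [dotProduct_cvec_smul, cvec_smul, Matrix.mulVec_smul, smul_dotProduct, Complex.coe_smul,
    smul_smul, sq]

theorem eventually_mul_norm_le {P : Type*} [SeminormedAddGroup P] (K : ℝ) {δ : ℝ} (hδ : 0 < δ) :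
    ∀ᶠ x : P in 𝓝 0, K * ‖x‖ ≤ δ := by
  have hcont : Tendsto (fun x : P => K * ‖x‖) (𝓝 0) (𝓝 (K * ‖(0 : P)‖)) :=
    Continuous.tendsto (by fun_prop) 0
  exact hcont.eventually_le_const (by simpa using hδ)

theorem NonnegForm.quad_add_of_mem_nullSpace {X : Type*} [AddCommGroup X] [Module ℂ X]
    (s : NonnegForm X) {v : X} (hv : v ∈ s.nullSpace) (w : X) : s.quad (v + w) = s.quad w := by
  have hquad : s.quad v = 0 := by
    rw [NonnegForm.quad, (s.apply_eq_zero hv v).1, Complex.zero_re]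
  rw [quad_add, hquad, (s.apply_eq_zero hv w).1]
  simp

theorem NonnegForm.isClosed_nullSpace {X : Type*} [NormedAddCommGroup X] [NormedSpace ℂ X]
    {s : NonnegForm X} {C : ℝ} (hs : ∀ u v, ‖s.toForm u v‖ ≤ C * ‖u‖ * ‖v‖) :
    IsClosed (s.nullSpace : Set X) := by
  have hnull : (s.nullSpace : Set X) = ⋂ v, {u | s.toForm.mkContinuous₂ C hs v u = 0} := by
    ext u
    simp only [Set.mem_iInter]
    exact ⟨fun hu v => (s.apply_eq_zero hu v).2, fun hu => hu u⟩
  rw [hnull]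
  exact isClosed_iInter fun v => isClosed_eq (ContinuousLinearMap.continuous _) continuous_const

namespace Setting

variable {n : ℕ} {H 𝓗 : Type*} [NormedAddCommGroup H] [InnerProductSpace ℂ H]
  [NormedAddCommGroup 𝓗] [InnerProductSpace ℂ 𝓗] {S : Setting n H 𝓗}
  {Vstar : Submodule ℂ H} {Z : Submodule ℂ (S.V 0)}
  {a₁ : S.V 0 →ₗ[ℂ] H →ₗ⋆[ℂ] (Fin n → ℂ)}
  {a₂ : S.V 0 →ₗ[ℂ] S.V 0 →ₗ⋆[ℂ] Matrix (Fin n) (Fin n) ℂ}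
  {E : Param n → 𝓗 ≃ₗ[ℂ] 𝓗} {C : ℝ}

theorem isClosed_W {θ : Param n} (hθ : θ ∈ S.Θ) : IsClosed (S.W θ : Set H) := by
  have hW : (S.W θ : Set H) = ⋂ v : S.V θ, {w | (S.a θ + S.b θ).toForm w v = 0} := by
    ext w
    simp [W]
  rw [hW]
  exact isClosed_iInter fun v => isClosed_eq
    ((S.isEquivNorm_add θ hθ).continuous_apply continuous_id continuous_const) continuous_const

theorem homForm_apply (ξ : Param n) (v v' : S.V 0) : S.homForm a₁ a₂ ξ v v' =
    (a₂ v v' *ᵥ cvec ξ) ⬝ᵥ cvec ξ -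
      (S.a 0).toForm (S.corrector a₁ ξ v) (S.corrector a₁ ξ v') := rfl

namespace Bounds

variable (hC : S.Bounds Vstar Z a₁ a₂ E C)
include hC

theorem pos : 0 < C := hC.toNormBounds.pos

theorem Vstar_le : Vstar ≤ S.V 0 := hC.V_zero_eq ▸ le_sup_left

theorem exists_add_eq {v : H} (hv : v ∈ S.V 0) : ∃ v₀ ∈ Vstar, ∃ z ∈ Z, v₀ + (z : H) = v := by
  rw [hC.V_zero_eq, sumSpace, Submodule.mem_sup] at hv
  obtain ⟨v₀, hv₀, _, ⟨z, hz, rfl⟩, hsum⟩ := hv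
  exact ⟨v₀, hv₀, z, hz, hsum⟩

theorem eventually_mem : ∀ᶠ θ in 𝓝 (0 : Param n), θ ∈ S.Θ :=
  mem_interior_iff_mem_nhds.1 hC.zero_mem_interior

theorem exists_radius : ∃ r > 0, ∀ θ : Param n, ‖θ‖ ≤ r → θ ∈ S.Θ := by
  simpa [Metric.nhds_basis_closedBall.eventually_iff] using hC.eventually_mem

theorem norm_apply_le_of_mem_V {θ : Param n} (hθ : θ ∈ S.Θ) {v : H} (hv : v ∈ S.V 0) (u : H) :
    ‖(S.a θ).toForm v u‖ ≤ C * ‖θ‖ * ‖v‖ * ‖u‖ := by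
  simpa [S.a_apply_left hv] using hC.a_sub_le θ hθ v u

theorem exists_V_add_W [CompleteSpace H] {θ : Param n} (hθ : θ ∈ S.Θ) (φ : H) :
    ∃ v ∈ S.V θ, ∃ w ∈ S.W θ, v + w = φ ∧ ‖v‖ ≤ C ^ 2 * ‖φ‖ ∧
      (S.a θ).quad w = (S.a θ).quad φ := by
  have hCp := hC.pos
  obtain ⟨P, hP⟩ := (S.isEquivNorm_add θ hθ).exists_isOrthProj
    (NonnegForm.isClosed_nullSpace (hC.a_le θ hθ))
  have hmem : (P φ : H) ∈ S.V θ := (P φ).2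
  refine ⟨P φ, hmem, φ - P φ, fun v hv => hP φ v hv, add_sub_cancel _ _, ?_, ?_⟩
  · calc ‖(P φ : H)‖ ≤ C * S.nrm θ (P φ) := hC.norm_le θ hθ _
      _ ≤ C * (C * ‖φ‖) := by
        gcongr
        exact (Real.sqrt_le_sqrt (hP.quad_le φ)).trans (hC.nrm_le θ hθ φ)
      _ = _ := by ring
  · rw [← (S.a θ).quad_add_of_mem_nullSpace hmem, add_sub_cancel]

theorem exists_a₁_bound : ∃ D ≥ 0, ∀ (ξ : Param n) (v : S.V 0) (u : H),
    ‖a₁ v u ⬝ᵥ cvec ξ‖ ≤ D * ‖ξ‖ * ‖v‖ * ‖u‖ := by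
  obtain ⟨r, hr, hball⟩ := hC.exists_radius
  have hCp := hC.pos
  refine ⟨C * (1 + r), by positivity, fun ξ v u => ?_⟩
  refine le_of_homogeneous_of_le_on_sphere one_ne_zero (f := fun ξ => ‖a₁ v u ⬝ᵥ cvec ξ‖)
    (g := fun ξ => C * (1 + r) * ‖ξ‖ * ‖v‖ * ‖u‖) (fun t ξ ht => ?_) (fun t ξ ht => ?_) hr
    (fun θ hθr => ?_) ξ
  · simp only [dotProduct_cvec_smul, norm_smul, Real.norm_of_nonneg ht, pow_one]
  · simp only [norm_smul, Real.norm_of_nonneg ht]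
    ring
  · have hθ := hball θ hθr.le
    calc ‖a₁ v u ⬝ᵥ cvec θ‖ ≤ ‖(S.a θ).toForm v u‖ + ‖(S.a θ).toForm v u - a₁ v u ⬝ᵥ cvec θ‖ :=
          norm_le_norm_add_norm_sub _ _
      _ ≤ C * ‖θ‖ * ‖v‖ * ‖u‖ + C * ‖θ‖ ^ 2 * ‖v‖ * ‖u‖ :=
          add_le_add (hC.norm_apply_le_of_mem_V hθ v.2 u) (hC.a_sub_a₁_le v u θ hθ)
      _ = C * (1 + r) * ‖θ‖ * ‖v‖ * ‖u‖ := by rw [hθr]; ring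

theorem exists_a₂_bound : ∃ D ≥ 0, ∀ (ξ : Param n) (v v' : S.V 0),
    ‖(a₂ v v' *ᵥ cvec ξ) ⬝ᵥ cvec ξ‖ ≤ D * ‖ξ‖ ^ 2 * ‖v‖ * ‖v'‖ := by
  obtain ⟨r, hr, hball⟩ := hC.exists_radius
  have hCp := hC.pos
  refine ⟨C * (1 / r + r), by positivity, fun ξ v v' => ?_⟩
  refine le_of_homogeneous_of_le_on_sphere two_ne_zero
    (f := fun ξ => ‖(a₂ v v' *ᵥ cvec ξ) ⬝ᵥ cvec ξ‖)
    (g := fun ξ => C * (1 / r + r) * ‖ξ‖ ^ 2 * ‖v‖ * ‖v'‖)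
    (fun t ξ ht => ?_) (fun t ξ ht => ?_) hr (fun θ hθr => ?_) ξ
  · simp only [mulVec_cvec_smul_dotProduct, norm_smul, norm_pow, Real.norm_of_nonneg ht]
  · simp only [norm_smul, Real.norm_of_nonneg ht]
    ring
  · have hθ := hball θ hθr.le
    calc ‖(a₂ v v' *ᵥ cvec θ) ⬝ᵥ cvec θ‖ ≤ ‖(S.a θ).toForm v v'‖ +
            ‖(S.a θ).toForm v v' - (a₂ v v' *ᵥ cvec θ) ⬝ᵥ cvec θ‖ := norm_le_norm_add_norm_sub _ _
      _ ≤ C * ‖θ‖ * ‖v‖ * ‖v'‖ + C * ‖θ‖ ^ 3 * ‖v‖ * ‖v'‖ :=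
          add_le_add (hC.norm_apply_le_of_mem_V hθ v.2 v') (hC.a_sub_a₂_le v v' θ hθ)
      _ = C * (1 / r + r) * ‖θ‖ ^ 2 * ‖v‖ * ‖v'‖ := by rw [hθr]; field_simp

theorem exists_a_bound_on_V : ∃ D ≥ 0, ∀ θ ∈ S.Θ, ∀ v v' : S.V 0,
    ‖(S.a θ).toForm v v'‖ ≤ D * ‖θ‖ ^ 2 * ‖v‖ * ‖v'‖ := by
  obtain ⟨D, hD, ha₂⟩ := hC.exists_a₂_bound
  have hCp := hC.pos
  refine ⟨D + C * C, by positivity, fun θ hθ v v' => ?_⟩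
  have hcubic : C * ‖θ‖ ^ 3 * ‖v‖ * ‖v'‖ ≤ C * (C * ‖θ‖ ^ 2) * ‖v‖ * ‖v'‖ := by
    rw [pow_succ' ‖θ‖ 2]
    gcongr
    exact hC.norm_param_le θ hθ
  calc ‖(S.a θ).toForm v v'‖ ≤ ‖(a₂ v v' *ᵥ cvec θ) ⬝ᵥ cvec θ‖ +
          ‖(S.a θ).toForm v v' - (a₂ v v' *ᵥ cvec θ) ⬝ᵥ cvec θ‖ := norm_le_norm_add_norm_sub' _ _
    _ ≤ D * ‖θ‖ ^ 2 * ‖v‖ * ‖v'‖ + C * (C * ‖θ‖ ^ 2) * ‖v‖ * ‖v'‖ :=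
        add_le_add (ha₂ θ v v') ((hC.a_sub_a₂_le v v' θ hθ).trans hcubic)
    _ = _ := by ring

-- On `V_0 × V_0` the form `a_θ` is quadratic in `θ`, so its linear part vanishes there.
theorem a₁_eq_zero (ξ : Param n) (v v' : S.V 0) : a₁ v v' ⬝ᵥ cvec ξ = 0 := by
  obtain ⟨r, hr, hball⟩ := hC.exists_radius
  obtain ⟨D, -, ha⟩ := hC.exists_a_bound_on_V
  refine eq_zero_of_homogeneous (f := fun ξ => a₁ v v' ⬝ᵥ cvec ξ) (k := 1)
    (M := (D + C) * ‖v‖ * ‖v'‖) (fun t ξ _ => by simp only [dotProduct_cvec_smul, pow_one]) hr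
    (fun θ hθr => ?_) ξ
  have hθ := hball θ hθr
  calc ‖a₁ v v' ⬝ᵥ cvec θ‖ ≤ ‖(S.a θ).toForm v v'‖ + ‖(S.a θ).toForm v v' - a₁ v v' ⬝ᵥ cvec θ‖ :=
        norm_le_norm_add_norm_sub _ _
    _ ≤ D * ‖θ‖ ^ 2 * ‖v‖ * ‖v'‖ + C * ‖θ‖ ^ 2 * ‖v‖ * ‖v'‖ :=
        add_le_add (ha θ hθ v v') (hC.a_sub_a₁_le v v' θ hθ)
    _ = _ := by ring

theorem isEquivNorm_a_W : ((S.a 0).comap (S.W 0).subtype).IsEquivNorm := by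
  have hCp := hC.pos
  refine NonnegForm.isEquivNorm_of_sq_bounds (c := C⁻¹) (C := C) (inv_pos.2 hCp) (fun w => ?_)
    fun w => ?_
  · rw [inv_mul_le_iff₀ hCp]
    exact hC.gap_zero w w.2
  · calc (S.a 0).quad w ≤ ‖(S.a 0).toForm w w‖ := Complex.re_le_norm _
      _ ≤ C * ‖w‖ * ‖w‖ := hC.a_le 0 hC.zero_mem w w
      _ = C * ‖w‖ ^ 2 := by ring

section Corrector

variable [CompleteSpace H]

theorem isCorrector (ξ : Param n) : S.IsCorrector a₁ ξ (S.corrector a₁ ξ) := by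
  refine Classical.epsilon_spec (p := S.IsCorrector a₁ ξ) ?_
  have : CompleteSpace (S.W 0) := (isClosed_W hC.zero_mem).completeSpace_coe
  obtain ⟨D, -, ha₁⟩ := hC.exists_a₁_bound
  exact hC.isEquivNorm_a_W.exists_linearMap_forall_apply_eq
    (LinearMap.mk₂'ₛₗ (RingHom.id ℂ) (starRingEnd ℂ)
      (fun (v : S.V 0) (w : S.W 0) => -(a₁ v w ⬝ᵥ cvec ξ))
      (by intros; simp [add_dotProduct]; ring) (by intros; simp [smul_dotProduct])
      (by intros; simp [add_dotProduct]; ring) (by intros; simp [smul_dotProduct]))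
    fun v => ⟨D * ‖ξ‖ * ‖v‖, fun w => by simpa using ha₁ ξ v w⟩

theorem a_zero_corrector_apply (ξ : Param n) (v : S.V 0) (φ : H) :
    (S.a 0).toForm (S.corrector a₁ ξ v) φ = -(a₁ v φ ⬝ᵥ cvec ξ) := by
  obtain ⟨v', hv', w, hw, rfl, -⟩ := hC.exists_V_add_W hC.zero_mem φ
  rw [map_add, S.a_apply_right hv', zero_add, map_add, add_dotProduct,
    hC.a₁_eq_zero ξ v ⟨v', hv'⟩, zero_add]
  exact hC.isCorrector ξ v ⟨w, hw⟩

theorem exists_corrector_bound : ∃ D ≥ 0, ∀ (ξ : Param n) (v : S.V 0),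
    ‖(S.corrector a₁ ξ v : H)‖ ≤ D * ‖ξ‖ * ‖v‖ := by
  obtain ⟨D, hD, ha₁⟩ := hC.exists_a₁_bound
  have hCp := hC.pos
  refine ⟨C * D, by positivity, fun ξ v => le_of_sq_le_mul (by positivity) ?_⟩
  set w := S.corrector a₁ ξ v
  calc ‖(w : H)‖ ^ 2 ≤ C * (S.a 0).quad w := hC.gap_zero w w.2
    _ ≤ C * ‖(S.a 0).toForm w w‖ := by gcongr; exact Complex.re_le_norm _
    _ = C * ‖a₁ v w ⬝ᵥ cvec ξ‖ := by rw [hC.isCorrector ξ v w, norm_neg]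
    _ ≤ C * (D * ‖ξ‖ * ‖v‖ * ‖(w : H)‖) := by gcongr; exact ha₁ ξ v w
    _ = _ := by ring

theorem corrector_smul (t : ℝ) (ξ : Param n) (v : S.V 0) :
    S.corrector a₁ (t • ξ) v = (t : ℂ) • S.corrector a₁ ξ v := by
  refine hC.isEquivNorm_a_W.eq_of_forall_apply_eq fun w => ?_
  have htξ : ((S.a 0).comap (S.W 0).subtype).toForm (S.corrector a₁ (t • ξ) v) w =
      -(a₁ v w ⬝ᵥ cvec (t • ξ)) := hC.isCorrector (t • ξ) v w
  have hξ : ((S.a 0).comap (S.W 0).subtype).toForm (S.corrector a₁ ξ v) w =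
      -(a₁ v w ⬝ᵥ cvec ξ) := hC.isCorrector ξ v w
  rw [htξ, map_smul, LinearMap.smul_apply, hξ, dotProduct_cvec_smul, smul_neg, Complex.coe_smul]

theorem homForm_smul (t : ℝ) (ξ : Param n) (v v' : S.V 0) :
    S.homForm a₁ a₂ (t • ξ) v v' = t ^ 2 • S.homForm a₁ a₂ ξ v v' := by
  simp only [homForm_apply, hC.corrector_smul, mulVec_cvec_smul_dotProduct, smul_sub,
    Submodule.coe_smul, map_smulₛₗ, LinearMap.smul_apply, Complex.conj_ofReal, smul_eq_mul,
    Complex.real_smul, RingHom.id_apply]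
  push_cast
  ring

theorem exists_homForm_bound : ∃ D ≥ 0, ∀ (ξ : Param n) (v v' : S.V 0),
    ‖S.homForm a₁ a₂ ξ v v'‖ ≤ D * ‖ξ‖ ^ 2 * ‖v‖ * ‖v'‖ := by
  obtain ⟨D, hD, ha₂⟩ := hC.exists_a₂_bound
  obtain ⟨D', hD', hN⟩ := hC.exists_corrector_bound
  have hCp := hC.pos
  refine ⟨D + C * D' * D', by positivity, fun ξ v v' => ?_⟩
  calc ‖S.homForm a₁ a₂ ξ v v'‖ ≤ ‖(a₂ v v' *ᵥ cvec ξ) ⬝ᵥ cvec ξ‖ +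
        ‖(S.a 0).toForm (S.corrector a₁ ξ v) (S.corrector a₁ ξ v')‖ := norm_sub_le _ _
    _ ≤ D * ‖ξ‖ ^ 2 * ‖v‖ * ‖v'‖ + C * (D' * ‖ξ‖ * ‖v‖) * (D' * ‖ξ‖ * ‖v'‖) := by
        refine add_le_add (ha₂ ξ v v') ((hC.a_le 0 hC.zero_mem _ _).trans ?_)
        gcongr
        · exact hN ξ v
        · exact hN ξ v'
    _ = _ := by ring

theorem homForm_self_im (ξ : Param n) (v : S.V 0) : (S.homForm a₁ a₂ ξ v v).im = 0 := by
  obtain ⟨r, hr, hball⟩ := hC.exists_radius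
  refine eq_zero_of_homogeneous (f := fun ξ => (S.homForm a₁ a₂ ξ v v).im) (k := 2)
    (M := C * ‖v‖ * ‖v‖) (fun t ξ _ => by simp only [hC.homForm_smul, Complex.smul_im]) hr
    (fun θ hθr => ?_) ξ
  have him : (S.homForm a₁ a₂ θ v v).im =
      -((S.a θ).toForm v v - (a₂ v v *ᵥ cvec θ) ⬝ᵥ cvec θ).im := by
    simp [homForm_apply, (S.a _).im_eq_zero]
  calc ‖(S.homForm a₁ a₂ θ v v).im‖ ≤ ‖(S.a θ).toForm v v - (a₂ v v *ᵥ cvec θ) ⬝ᵥ cvec θ‖ := by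
        rw [him, norm_neg]
        exact Complex.abs_im_le_norm _
    _ ≤ C * ‖θ‖ ^ 3 * ‖v‖ * ‖v‖ := hC.a_sub_a₂_le v v θ (hball θ hθr)
    _ = _ := by ring

theorem exists_a_corrected_bound : ∃ D ≥ 0, ∀ θ ∈ S.Θ, ∀ (z : S.V 0) (φ : H),
    ‖(S.a θ).toForm (z + S.corrector a₁ θ z) φ‖ ≤ D * ‖θ‖ ^ 2 * ‖z‖ * ‖φ‖ := by
  obtain ⟨D, hD, hN⟩ := hC.exists_corrector_bound
  have hCp := hC.pos
  refine ⟨C + C * D, by positivity, fun θ hθ z φ => ?_⟩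
  set N := S.corrector a₁ θ z
  have hsplit : (S.a θ).toForm (z + N) φ = ((S.a θ).toForm z φ - a₁ z φ ⬝ᵥ cvec θ) +
      ((S.a θ).toForm N φ - (S.a 0).toForm N φ) := by
    rw [hC.a_zero_corrector_apply, map_add, LinearMap.add_apply]
    ring
  calc ‖(S.a θ).toForm (z + N) φ‖ ≤ C * ‖θ‖ ^ 2 * ‖z‖ * ‖φ‖ + C * ‖θ‖ * ‖(N : H)‖ * ‖φ‖ := by
        rw [hsplit]
        exact norm_add_le_of_le (hC.a_sub_a₁_le z φ θ hθ) (hC.a_sub_le θ hθ N φ)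
    _ ≤ C * ‖θ‖ ^ 2 * ‖z‖ * ‖φ‖ + C * ‖θ‖ * (D * ‖θ‖ * ‖z‖) * ‖φ‖ := by
        gcongr
        exact hN θ z
    _ = _ := by ring

theorem exists_a_sub_homForm_bound : ∃ D ≥ 0, ∀ θ ∈ S.Θ, ∀ (z z' : S.V 0),
    ‖(S.a θ).toForm (z + S.corrector a₁ θ z) z' - S.homForm a₁ a₂ θ z z'‖ ≤
      D * ‖θ‖ ^ 3 * ‖z‖ * ‖z'‖ := by
  obtain ⟨D, hD, hN⟩ := hC.exists_corrector_bound
  have hCp := hC.pos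
  refine ⟨C + C * D, by positivity, fun θ hθ z z' => ?_⟩
  set N := S.corrector a₁ θ z
  have hcorr : (S.a θ).toForm N z' + (S.a 0).toForm N (S.corrector a₁ θ z') =
      starRingEnd ℂ ((S.a θ).toForm z' N - a₁ z' N ⬝ᵥ cvec θ) := by
    rw [← neg_neg (a₁ z' N ⬝ᵥ cvec θ), ← hC.a_zero_corrector_apply, sub_neg_eq_add, map_add,
      NonnegForm.conj_symm, NonnegForm.conj_symm]
  have hsplit : (S.a θ).toForm (z + N) z' - S.homForm a₁ a₂ θ z z' =
      ((S.a θ).toForm z z' - (a₂ z z' *ᵥ cvec θ) ⬝ᵥ cvec θ) +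
        starRingEnd ℂ ((S.a θ).toForm z' N - a₁ z' N ⬝ᵥ cvec θ) := by
    rw [← hcorr, homForm_apply, map_add, LinearMap.add_apply]
    ring
  calc _ ≤ C * ‖θ‖ ^ 3 * ‖z‖ * ‖z'‖ + C * ‖θ‖ ^ 2 * ‖z'‖ * ‖(N : H)‖ := by
        rw [hsplit]
        refine norm_add_le_of_le (hC.a_sub_a₂_le z z' θ hθ) ?_
        rw [RCLike.norm_conj]
        exact hC.a_sub_a₁_le z' N θ hθ
    _ ≤ C * ‖θ‖ ^ 3 * ‖z‖ * ‖z'‖ + C * ‖θ‖ ^ 2 * ‖z'‖ * (D * ‖θ‖ * ‖z‖) := by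
        gcongr
        exact hN θ z
    _ = _ := by ring

omit [CompleteSpace H] in
theorem norm_le_mul_norm_sub_of_mem_V {θ : Param n} (hθ : θ ∈ S.Θ) (hne : θ ≠ 0)
    (hsmall : C ^ 2 * ‖θ‖ ≤ 1 / 2) {v : H} (hv : v ∈ S.V θ) {z : S.V 0} (hz : z ∈ Z) :
    ‖z‖ ≤ (2 * C + 1) * ‖(z : H) - v‖ := by
  have hCp := hC.pos
  obtain ⟨v₀, hv₀, hnear⟩ := hC.near θ hθ 0 hC.zero_mem v (by rwa [S.Vst_of_ne_zero _ hne])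
  rw [Vst_zero] at hv₀
  rw [sub_zero] at hnear
  have hdirect : ‖z‖ ≤ C * (‖(z : H) - v‖ + ‖v - v₀‖) :=
    calc ‖z‖ ≤ C * ‖-v₀ + z‖ := (hC.direct (-v₀) (Vstar.neg_mem hv₀) z hz).2
      _ = C * ‖((z : H) - v) + (v - v₀)‖ := by congr 2; abel
      _ ≤ _ := by gcongr; exact norm_add_le _ _
  have hv_le : ‖v‖ ≤ ‖z‖ + ‖(z : H) - v‖ := norm_le_norm_add_norm_sub _ _
  have hdist : C * ‖v - v₀‖ ≤ 1 / 2 * (‖z‖ + ‖(z : H) - v‖) :=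
    calc C * ‖v - v₀‖ ≤ C * (C * ‖θ‖ * ‖v‖) := by gcongr
      _ = C ^ 2 * ‖θ‖ * ‖v‖ := by ring
      _ ≤ _ := by gcongr
  linarith

theorem exists_corrected_coercive : ∃ c > 0, ∀ᶠ θ in 𝓝 (0 : Param n), ∀ z ∈ Z,
    c * ‖θ‖ ^ 2 * ‖z‖ ^ 2 ≤ (S.a θ).quad (z + S.corrector a₁ θ z) := by
  obtain ⟨D, _, hN⟩ := hC.exists_corrector_bound
  have hCp := hC.pos
  refine ⟨1 / (C * (2 * (2 * C + 1)) ^ 2), by positivity, ?_⟩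
  filter_upwards [hC.eventually_mem, eventually_mul_norm_le (C ^ 2) one_half_pos,
    eventually_mul_norm_le ((2 * C + 1) * D) one_half_pos] with θ hθ hsmall hsmall' z hz
  rcases eq_or_ne θ 0 with rfl | hne
  · simpa using (S.a 0).quad_nonneg _
  set N := S.corrector a₁ θ z
  obtain ⟨v, hv, w, hw, hvw, -, haw⟩ := hC.exists_V_add_W hθ (z + N)
  have hzv : (z : H) - v = w - N := by rw [sub_eq_sub_iff_add_eq_add, ← hvw, add_comm]
  have hz_le : ‖z‖ ≤ 2 * (2 * C + 1) * ‖w‖ := by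
    have hN' : (2 * C + 1) * ‖(N : H)‖ ≤ 1 / 2 * ‖z‖ :=
      calc (2 * C + 1) * ‖(N : H)‖ ≤ (2 * C + 1) * (D * ‖θ‖ * ‖z‖) := by gcongr; exact hN θ z
        _ = (2 * C + 1) * D * ‖θ‖ * ‖z‖ := by ring
        _ ≤ _ := by gcongr
    have : ‖z‖ ≤ (2 * C + 1) * (‖w‖ + ‖(N : H)‖) :=
      calc ‖z‖ ≤ (2 * C + 1) * ‖(z : H) - v‖ :=
            hC.norm_le_mul_norm_sub_of_mem_V hθ hne hsmall hv hz
        _ ≤ _ := by rw [hzv]; gcongr; exact norm_sub_le _ _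
    linarith
  rw [← haw, one_div, mul_assoc, inv_mul_le_iff₀ (by positivity)]
  calc ‖θ‖ ^ 2 * ‖z‖ ^ 2 ≤ ‖θ‖ ^ 2 * (2 * (2 * C + 1) * ‖w‖) ^ 2 := by gcongr
    _ = (2 * (2 * C + 1)) ^ 2 * (‖θ‖ ^ 2 * ‖w‖ ^ 2) := by ring
    _ ≤ (2 * (2 * C + 1)) ^ 2 * (C * (S.a θ).quad w) :=
        mul_le_mul_of_nonneg_left (hC.gap θ hθ w hw) (by positivity)
    _ = _ := by ring

theorem exists_quad_corrected_le : ∃ D ≥ 0, ∀ θ ∈ S.Θ, ∀ z : S.V 0,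
    (S.a θ).quad (z + S.corrector a₁ θ z) ≤
      (S.homForm a₁ a₂ θ z z).re + D * ‖θ‖ * (‖θ‖ ^ 2 * ‖z‖ ^ 2) := by
  obtain ⟨D, hD, hN⟩ := hC.exists_corrector_bound
  obtain ⟨D₁, hD₁, ha⟩ := hC.exists_a_corrected_bound
  obtain ⟨D₂, hD₂, hhom⟩ := hC.exists_a_sub_homForm_bound
  refine ⟨D₁ * D + D₂, by positivity, fun θ hθ z => ?_⟩
  set N := S.corrector a₁ θ z
  have hN' : ‖(S.a θ).toForm (z + N) N‖ ≤ D₁ * ‖θ‖ ^ 2 * ‖z‖ * (D * ‖θ‖ * ‖z‖) :=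
    (ha θ hθ z N).trans (by gcongr; exact hN θ z)
  have hre := (Complex.re_le_norm _).trans (norm_add_le_of_le hN' (hhom θ hθ z z))
  have hquad : (S.a θ).quad (z + N) =
      ((S.a θ).toForm (z + N) N).re + ((S.a θ).toForm (z + N) z).re := by
    rw [NonnegForm.quad, map_add ((S.a θ).toForm (z + N)), Complex.add_re, add_comm]
  rw [Complex.add_re, Complex.sub_re] at hre
  linarith

theorem exists_homForm_coercive : ∃ c > 0, ∀ (ξ : Param n), ∀ z ∈ Z,
    c * ‖ξ‖ ^ 2 * ‖z‖ ^ 2 ≤ (S.homForm a₁ a₂ ξ z z).re := by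
  obtain ⟨c, hc, hcoer⟩ := hC.exists_corrected_coercive
  obtain ⟨D, _, hquad⟩ := hC.exists_quad_corrected_le
  have hnear : ∀ᶠ θ in 𝓝 (0 : Param n), ∀ z ∈ Z,
      c / 2 * ‖θ‖ ^ 2 * ‖z‖ ^ 2 ≤ (S.homForm a₁ a₂ θ z z).re := by
    filter_upwards [hC.eventually_mem, hcoer, eventually_mul_norm_le D (half_pos hc)]
      with θ hθ hθc hsmall z hz
    have hmul : D * ‖θ‖ * (‖θ‖ ^ 2 * ‖z‖ ^ 2) ≤ c / 2 * (‖θ‖ ^ 2 * ‖z‖ ^ 2) := by gcongr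
    linarith [hθc z hz, hquad θ hθ z]
  obtain ⟨r, hr, hball⟩ := Metric.nhds_basis_closedBall.eventually_iff.1 hnear
  refine ⟨c / 2, half_pos hc, fun ξ z hz => ?_⟩
  refine le_of_homogeneous_of_le_on_sphere two_ne_zero (f := fun ξ => c / 2 * ‖ξ‖ ^ 2 * ‖z‖ ^ 2)
    (g := fun ξ => (S.homForm a₁ a₂ ξ z z).re) (fun t ξ ht => ?_) (fun t ξ _ => ?_) hr
    (fun θ hθr => hball (by simpa using hθr.le) z hz) ξ
  · simp only [norm_smul, Real.norm_of_nonneg ht]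
    ring
  · simp only [hC.homForm_smul, Complex.smul_re, smul_eq_mul]

end Corrector

section Decomposition

theorem norm_le_of_add_of_mem_W {θ : Param n} (hθ : θ ∈ S.Θ) {ψ w : H} (hψ : ψ ∈ S.V 0)
    (hw : w ∈ S.W 0) :
    ‖w‖ ≤ C ^ 2 * ((S.a θ).nrm (ψ + w) + ‖θ‖ * ‖ψ + w‖) := by
  have hCp := hC.pos
  have hq := (S.a θ).nrm_nonneg (ψ + w)
  have hform : ‖(S.a θ).toForm (ψ + w) w‖ ≤ (S.a θ).nrm (ψ + w) * (C * ‖w‖) :=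
    ((S.a θ).norm_apply_le _ _).trans
      (by gcongr; exact (S.a_nrm_le θ w).trans (hC.nrm_le θ hθ w))
  have hquad : (S.a 0).quad w = ((S.a 0).toForm (ψ + w) w).re := by
    rw [NonnegForm.quad, map_add, LinearMap.add_apply, S.a_apply_left hψ, zero_add]
  refine le_of_sq_le_mul (by positivity) ?_
  calc ‖w‖ ^ 2 ≤ C * (S.a 0).quad w := hC.gap_zero w hw
    _ ≤ C * ‖(S.a 0).toForm (ψ + w) w‖ := by rw [hquad]; gcongr; exact Complex.re_le_norm _
    _ ≤ C * (‖(S.a θ).toForm (ψ + w) w‖ +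
          ‖(S.a θ).toForm (ψ + w) w - (S.a 0).toForm (ψ + w) w‖) := by
        gcongr
        exact norm_le_norm_add_norm_sub _ _
    _ ≤ C * ((S.a θ).nrm (ψ + w) * (C * ‖w‖) + C * ‖θ‖ * ‖ψ + w‖ * ‖w‖) := by
        gcongr
        exact hC.a_sub_le θ hθ _ _
    _ = _ := by ring

variable [CompleteSpace H]

theorem exists_approx_decomposition : ∃ D ≥ 0, ∀ θ ∈ S.Θ, ∀ φ : H,
    ∃ v ∈ S.Vst Vstar θ, ∃ z ∈ Z, ∃ r : H, v + z + r = φ ∧ ‖v‖ ≤ D * ‖φ‖ ∧ ‖z‖ ≤ D * ‖φ‖ ∧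
      ‖r‖ ≤ D * ((S.a θ).nrm φ + ‖θ‖ * ‖φ‖) := by
  have hCp := hC.pos
  refine ⟨C ^ 2 + C ^ 3 + C ^ 4 + C ^ 5, by positivity, fun θ hθ φ => ?_⟩
  obtain ⟨ψ, hψ, w, hw, hφ, hψ_le, -⟩ := hC.exists_V_add_W hC.zero_mem φ
  obtain ⟨v₀, hv₀, z, hz, rfl⟩ := hC.exists_add_eq hψ
  obtain ⟨v, hv, hnear⟩ := hC.near 0 hC.zero_mem θ hθ v₀ (by rwa [Vst_zero])
  rw [zero_sub, norm_neg] at hnear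
  have hw_le := hC.norm_le_of_add_of_mem_W hθ hψ hw
  rw [hφ] at hw_le
  have hq := (S.a θ).nrm_nonneg φ
  have hv₀_le : ‖v₀‖ ≤ C ^ 3 * ‖φ‖ :=
    calc ‖v₀‖ ≤ C * ‖v₀ + z‖ := (hC.direct v₀ hv₀ z hz).1
      _ ≤ C * (C ^ 2 * ‖φ‖) := by gcongr
      _ = _ := by ring
  have hdist : ‖v₀ - v‖ ≤ C ^ 4 * (‖θ‖ * ‖φ‖) :=
    calc ‖v₀ - v‖ ≤ C * ‖θ‖ * ‖v₀‖ := hnear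
      _ ≤ C * ‖θ‖ * (C ^ 3 * ‖φ‖) := by gcongr
      _ = _ := by ring
  refine ⟨v, hv, z, hz, w + (v₀ - v), by rw [← hφ]; abel, ?_, ?_, ?_⟩
  · calc ‖v‖ ≤ ‖v₀‖ + ‖v₀ - v‖ := norm_le_norm_add_norm_sub _ _
      _ ≤ C ^ 3 * ‖φ‖ + C ^ 4 * (C * ‖φ‖) := by
          refine add_le_add hv₀_le (hdist.trans ?_)
          gcongr
          exact hC.norm_param_le θ hθ
      _ = (C ^ 3 + C ^ 5) * ‖φ‖ := by ring
      _ ≤ _ := mul_le_mul_of_nonneg_right (by linarith [pow_pos hCp 2, pow_pos hCp 4])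
          (norm_nonneg φ)
  · calc ‖z‖ ≤ C * ‖v₀ + z‖ := (hC.direct v₀ hv₀ z hz).2
      _ ≤ C * (C ^ 2 * ‖φ‖) := by gcongr
      _ = C ^ 3 * ‖φ‖ := by ring
      _ ≤ _ := mul_le_mul_of_nonneg_right
          (by linarith [pow_pos hCp 2, pow_pos hCp 4, pow_pos hCp 5]) (norm_nonneg φ)
  · calc ‖w + (v₀ - v)‖ ≤ C ^ 2 * ((S.a θ).nrm φ + ‖θ‖ * ‖φ‖) + C ^ 4 * (‖θ‖ * ‖φ‖) :=
          norm_add_le_of_le hw_le hdist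
      _ ≤ C ^ 2 * ((S.a θ).nrm φ + ‖θ‖ * ‖φ‖) + C ^ 4 * ((S.a θ).nrm φ + ‖θ‖ * ‖φ‖) := by
          gcongr
          exact le_add_of_nonneg_left hq
      _ = (C ^ 2 + C ^ 4) * ((S.a θ).nrm φ + ‖θ‖ * ‖φ‖) := by ring
      _ ≤ _ := mul_le_mul_of_nonneg_right (by linarith [pow_pos hCp 3, pow_pos hCp 5])
          (by positivity)

/-- Splitting off the `V_θ`-component of `φ` first leaves a remainder `w` with
`|θ| ‖w‖ ≲ a_θ[φ]^{1/2}`, which absorbs the term `|θ| ‖φ‖` of `exists_approx_decomposition`. -/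
theorem exists_decomposition : ∃ D ≥ 0, ∀ θ ∈ S.Θ, ∀ φ : H,
    ∃ v ∈ S.Vst Vstar θ, ∃ z ∈ Z, ∃ r : H, v + z + r = φ ∧ ‖v‖ ≤ D * ‖φ‖ ∧ ‖z‖ ≤ D * ‖φ‖ ∧
      ‖θ‖ * ‖z‖ ≤ D * (S.a θ).nrm φ ∧ ‖r‖ ≤ D * (S.a θ).nrm φ := by
  obtain ⟨D, hD, happrox⟩ := hC.exists_approx_decomposition
  have hCp := hC.pos
  refine ⟨C ^ 2 + D * (C ^ 2 + 1) + D * (C + 2), by positivity, fun θ hθ φ => ?_⟩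
  have hq := (S.a θ).nrm_nonneg φ
  have hDC := mul_nonneg hD hCp.le
  have hDC' := mul_nonneg hD (sq_nonneg C)
  rcases eq_or_ne θ 0 with rfl | hne
  · obtain ⟨v, hv, z, hz, r, hφ, hv_le, hz_le, hr_le⟩ := happrox 0 hθ φ
    rw [norm_zero, zero_mul, add_zero] at hr_le
    have hD_le : D ≤ C ^ 2 + D * (C ^ 2 + 1) + D * (C + 2) := by linarith [sq_nonneg C]
    refine ⟨v, hv, z, hz, r, hφ, hv_le.trans (by gcongr), hz_le.trans (by gcongr), ?_,
      hr_le.trans (by gcongr)⟩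
    rw [norm_zero, zero_mul]
    positivity
  obtain ⟨v₁, hv₁, w, hw, rfl, hv₁_le, hwq⟩ := hC.exists_V_add_W hθ φ
  obtain ⟨v₂, hv₂, z, hz, r, hw_eq, hv₂_le, hz_le, hr_le⟩ := happrox θ hθ w
  have hw_nrm : (S.a θ).nrm w = (S.a θ).nrm (v₁ + w) := congrArg Real.sqrt hwq
  have hw_le : ‖w‖ ≤ (C ^ 2 + 1) * ‖v₁ + w‖ := by
    have hsub := norm_sub_le (v₁ + w) v₁
    rw [add_sub_cancel_left] at hsub
    linarith
  have hθw : ‖θ‖ * ‖w‖ ≤ (C + 1) * (S.a θ).nrm (v₁ + w) := by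
    refine le_add_one_mul_of_sq_le hCp.le hq ?_
    rw [mul_pow, ← hw_nrm, NonnegForm.nrm_sq]
    exact hC.gap θ hθ w hw
  have hDw : D * ‖w‖ ≤ D * (C ^ 2 + 1) * ‖v₁ + w‖ := by rw [mul_assoc]; gcongr
  refine ⟨v₁ + v₂, add_mem (by rwa [S.Vst_of_ne_zero _ hne]) hv₂, z, hz, r,
    by rw [← hw_eq]; abel, ?_, ?_, ?_, ?_⟩
  · calc ‖v₁ + v₂‖ ≤ C ^ 2 * ‖v₁ + w‖ + D * (C ^ 2 + 1) * ‖v₁ + w‖ :=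
          norm_add_le_of_le hv₁_le (hv₂_le.trans hDw)
      _ = (C ^ 2 + D * (C ^ 2 + 1)) * ‖v₁ + w‖ := by ring
      _ ≤ _ := mul_le_mul_of_nonneg_right (by linarith) (norm_nonneg _)
  · exact (hz_le.trans hDw).trans (mul_le_mul_of_nonneg_right (by linarith [sq_nonneg C])
      (norm_nonneg _))
  · calc ‖θ‖ * ‖z‖ ≤ ‖θ‖ * (D * ‖w‖) := by gcongr
      _ = D * (‖θ‖ * ‖w‖) := by ring
      _ ≤ D * ((C + 1) * (S.a θ).nrm (v₁ + w)) := by gcongr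
      _ = D * (C + 1) * (S.a θ).nrm (v₁ + w) := by ring
      _ ≤ _ := mul_le_mul_of_nonneg_right (by linarith [sq_nonneg C]) hq
  · calc ‖r‖ ≤ D * ((S.a θ).nrm (v₁ + w) + ‖θ‖ * ‖w‖) := by rwa [← hw_nrm]
      _ ≤ D * ((S.a θ).nrm (v₁ + w) + (C + 1) * (S.a θ).nrm (v₁ + w)) := by gcongr
      _ = D * (C + 2) * (S.a θ).nrm (v₁ + w) := by ring
      _ ≤ _ := mul_le_mul_of_nonneg_right (by linarith [sq_nonneg C]) hq

end Decomposition

end Bounds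

/-! ### The residual of the trial field -/

section OpForm

variable (S)

/-- The form `ε⁻² a_θ + b_θ` that generates `𝓛_{ε,θ}`, as a non-negative form. -/
def opForm (ε : ℝ) (θ : Param n) : NonnegForm H :=
  (S.a θ).smul (ε ^ 2)⁻¹ (by positivity) + S.b θ

theorem opForm_toForm (ε : ℝ) (θ : Param n) :
    (S.opForm ε θ).toForm = ((ε : ℂ) ^ 2)⁻¹ • (S.a θ).toForm + (S.b θ).toForm := by
  rw [opForm, NonnegForm.toForm_add, NonnegForm.smul]
  push_cast
  rfl

theorem opForm_apply (ε : ℝ) (θ : Param n) (u v : H) :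
    (S.opForm ε θ).toForm u v = ((ε : ℂ) ^ 2)⁻¹ * (S.a θ).toForm u v + (S.b θ).toForm u v := by
  rw [opForm_toForm]
  rfl

theorem opForm_quad (ε : ℝ) (θ : Param n) (u : H) :
    (S.opForm ε θ).quad u = (ε ^ 2)⁻¹ * (S.a θ).quad u + (S.b θ).quad u := by
  rw [NonnegForm.quad, opForm_apply, NonnegForm.quad, NonnegForm.quad, Complex.add_re,
    ← Complex.ofReal_pow, ← Complex.ofReal_inv, Complex.re_ofReal_mul]

variable {ε : ℝ} (hε : 0 < ε)
include hε

theorem a_nrm_le_opForm (θ : Param n) (u : H) : (S.a θ).nrm u ≤ ε * (S.opForm ε θ).nrm u := by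
  refine Real.sqrt_le_iff.2 ⟨mul_nonneg hε.le (NonnegForm.nrm_nonneg _ _), ?_⟩
  rw [mul_pow, NonnegForm.nrm_sq, opForm_quad, mul_add, mul_inv_cancel_left₀ (by positivity)]
  exact le_add_of_nonneg_right (mul_nonneg (sq_nonneg ε) ((S.b θ).quad_nonneg u))

theorem nrm_le_opForm (hε1 : ε < 1) (θ : Param n) (u : H) : S.nrm θ u ≤ (S.opForm ε θ).nrm u := by
  refine Real.sqrt_le_sqrt ?_
  rw [opForm_quad, NonnegForm.add_quad]
  gcongr
  exact le_mul_of_one_le_left ((S.a θ).quad_nonneg u)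
    ((one_le_inv₀ (by positivity)).2 (pow_le_one₀ hε.le hε1.le))

end OpForm

theorem limitForm_apply (ξ : Param n) (p q : Vstar × Z) :
    S.limitForm Vstar Z a₁ a₂ ξ p q = S.homForm a₁ a₂ ξ p.2 q.2 +
      (S.b 0).toForm (S.sumMap Vstar Z p) (S.sumMap Vstar Z q) := rfl

theorem sumMap_apply (p : Vstar × Z) : S.sumMap Vstar Z p = (p.1 : H) + (p.2 : S.V 0) := rfl

variable (S) in
/-- The trial field `T v + z + N_θ z`, with `T` the restriction of `𝓔_θ` to `V_⋆`, which
approximates the solution of the problem for `𝓛_{ε,θ}` when `(v, z)` solves the limit problem. -/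
def trialField (a₁ : S.V 0 →ₗ[ℂ] H →ₗ⋆[ℂ] (Fin n → ℂ)) {θ : Param n}
    (T : Vstar ≃ₗ[ℂ] S.Vst Vstar θ) (v : Vstar) (z : S.V 0) : H :=
  T v + (z + S.corrector a₁ θ z)

variable (S) in
/-- The residual of `u` in the equation `𝓛_{ε,θ} u = g`, as an antilinear functional of the test
vector. -/
def residual (ε : ℝ) (θ : Param n) (g : 𝓗) (u : H) : H →ₗ⋆[ℂ] ℂ :=
  (S.opForm ε θ).toForm u - ((S.d θ).toForm g).comp S.ι.toLinearMap

theorem residual_apply (ε : ℝ) (θ : Param n) (g : 𝓗) (u φ : H) :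
    S.residual ε θ g u φ = (S.opForm ε θ).toForm u φ - (S.d θ).toForm g (S.ι φ) := rfl

variable (S) in
/-- `(v, z)` solves the limit problem at `ξ = ε⁻¹ θ` with datum `𝓔_θ⁻¹ g`, tested separately against
`V_⋆` and `Z`, and `P` bounds the quantities on which the error of `trialField` depends. -/
structure IsLimitSolution (a₁ : S.V 0 →ₗ[ℂ] H →ₗ⋆[ℂ] (Fin n → ℂ))
    (a₂ : S.V 0 →ₗ[ℂ] S.V 0 →ₗ⋆[ℂ] Matrix (Fin n) (Fin n) ℂ) (Z : Submodule ℂ (S.V 0))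
    (E : Param n → 𝓗 ≃ₗ[ℂ] 𝓗) (ε : ℝ) (θ : Param n) (g : 𝓗) (P : ℝ) (v : Vstar)
    (z : S.V 0) : Prop where
  snd_mem : z ∈ Z
  apply_Vstar : ∀ v' : Vstar,
    (S.b 0).toForm (v + z) v' = (S.d θ).toForm g (E θ (S.ι v'))
  apply_Z : ∀ z' ∈ Z, ((ε : ℂ) ^ 2)⁻¹ * S.homForm a₁ a₂ θ z z' + (S.b 0).toForm (v + z) z' =
    (S.d θ).toForm g (E θ (S.ι z'))
  nrm_datum_le : (S.d θ).nrm g ≤ P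
  norm_fst_le : ‖v‖ ≤ P
  norm_snd_le : ‖z‖ ≤ P
  sq_mul_norm_snd_le : (ε ^ 2)⁻¹ * ‖θ‖ ^ 2 * ‖z‖ ≤ P
  mul_norm_snd_le : ‖θ‖ * ‖z‖ ≤ ε * P

theorem IsLimitSolution.nonneg {ε : ℝ} {θ : Param n} {g : 𝓗} {P : ℝ} {v : Vstar} {z : S.V 0}
    (h : S.IsLimitSolution a₁ a₂ Z E ε θ g P v z) : 0 ≤ P :=
  (norm_nonneg v).trans h.norm_fst_le

theorem norm_inv_sq_mul (ε : ℝ) (c : ℂ) : ‖((ε : ℂ) ^ 2)⁻¹ * c‖ = (ε ^ 2)⁻¹ * ‖c‖ := by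
  rw [norm_mul, norm_inv, norm_pow, Complex.norm_real, Real.norm_eq_abs, sq_abs]

namespace Bounds

section Residual

variable (hC : S.Bounds Vstar Z a₁ a₂ E C)
include hC

theorem nrm_d_E {θ : Param n} (hθ : θ ∈ S.Θ) (u : 𝓗) : (S.d θ).nrm (E θ u) = (S.d 0).nrm u := by
  rw [NonnegForm.nrm, NonnegForm.nrm, NonnegForm.quad, NonnegForm.quad, hC.d_E θ hθ]

theorem nrm_d_E_symm {θ : Param n} (hθ : θ ∈ S.Θ) (g : 𝓗) :
    (S.d 0).nrm ((E θ).symm g) = (S.d θ).nrm g := by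
  rw [← hC.nrm_d_E hθ, LinearEquiv.apply_symm_apply]

theorem d_E_symm {θ : Param n} (hθ : θ ∈ S.Θ) (g u : 𝓗) :
    (S.d 0).toForm ((E θ).symm g) u = (S.d θ).toForm g (E θ u) := by
  rw [← hC.d_E θ hθ, LinearEquiv.apply_symm_apply]

theorem nrm_E_ι_sub_le {θ : Param n} (hθ : θ ∈ S.Θ) (u : H) :
    (S.d θ).nrm (E θ (S.ι u) - S.ι u) ≤ C ^ 2 * (‖θ‖ * ‖u‖) := by
  have hCp := hC.pos
  calc _ ≤ C * ‖θ‖ * (S.d 0).nrm (S.ι u) := hC.E_sub_le θ hθ _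
    _ ≤ C * ‖θ‖ * (C * ‖u‖) := by gcongr; exact hC.d_le 0 hC.zero_mem u
    _ = _ := by ring

variable {ε : ℝ} {θ : Param n} {T : Vstar ≃ₗ[ℂ] S.Vst Vstar θ} {g : 𝓗} {P : ℝ} {v : Vstar}
  {z : S.V 0}

theorem residual_trialField_apply_transfer (hT : S.IsBoundedTransfer Z E C θ T)
    (hsol : S.IsLimitSolution a₁ a₂ Z E ε θ g P v z) (v' : Vstar) :
    S.residual ε θ g (S.trialField a₁ T v z) (T v') =
      starRingEnd ℂ ((S.b θ).toForm (T v') z - (S.b 0).toForm v' z) +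
        (S.b θ).toForm (S.corrector a₁ θ z) (T v') := by
  rw [residual_apply, trialField, hT.ι_apply, ← hsol.apply_Vstar, opForm_apply,
    S.a_apply_right (S.Vst_le_V hC.Vstar_le θ (T v').2), map_sub, NonnegForm.conj_symm,
    NonnegForm.conj_symm]
  simp only [map_add, LinearMap.add_apply, hT.b_apply]
  ring

theorem residual_trialField_apply_Z (hsol : S.IsLimitSolution a₁ a₂ Z E ε θ g P v z)
    {z' : S.V 0} (hz' : z' ∈ Z) :
    S.residual ε θ g (S.trialField a₁ T v z) z' =
      ((ε : ℂ) ^ 2)⁻¹ * ((S.a θ).toForm (z + S.corrector a₁ θ z) z' - S.homForm a₁ a₂ θ z z') +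
      ((S.b θ).toForm (T v) z' - (S.b 0).toForm v z') +
      ((S.b θ).toForm z z' - (S.b 0).toForm z z') +
      (S.b θ).toForm (S.corrector a₁ θ z) z' +
      (S.d θ).toForm g (E θ (S.ι z') - S.ι z') := by
  rw [residual_apply, trialField, opForm_apply, map_sub, ← hsol.apply_Z z' hz']
  simp only [map_add, LinearMap.add_apply,
    S.a_apply_left (S.Vst_le_V hC.Vstar_le θ (T v).2)]
  ring

theorem residual_trialField_apply (φ : H) :
    S.residual ε θ g (S.trialField a₁ T v z) φ =
      ((ε : ℂ) ^ 2)⁻¹ * (S.a θ).toForm (z + S.corrector a₁ θ z) φ +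
        (S.b θ).toForm (S.trialField a₁ T v z) φ - (S.d θ).toForm g (S.ι φ) := by
  rw [residual_apply, opForm_apply, trialField, map_add (S.a θ).toForm (T v : H),
    LinearMap.add_apply, S.a_apply_left (S.Vst_le_V hC.Vstar_le θ (T v).2), zero_add]

variable [CompleteSpace H]

theorem exists_norm_corrector_le : ∃ D ≥ 0, ∀ {ε : ℝ} {θ : Param n} {g : 𝓗} {P : ℝ} {v : Vstar}
    {z : S.V 0}, S.IsLimitSolution a₁ a₂ Z E ε θ g P v z →
    ‖(S.corrector a₁ θ z : H)‖ ≤ D * (ε * P) := by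
  obtain ⟨D, hD, hN⟩ := hC.exists_corrector_bound
  refine ⟨D, hD, fun {ε θ g P v z} hsol => ?_⟩
  calc _ ≤ D * ‖θ‖ * ‖z‖ := hN θ z
    _ = D * (‖θ‖ * ‖z‖) := mul_assoc _ _ _
    _ ≤ D * (ε * P) := mul_le_mul_of_nonneg_left hsol.mul_norm_snd_le hD

theorem exists_residual_Vst_bound : ∃ D ≥ 0, ∀ ε > 0, ∀ θ ∈ S.Θ,
    ∀ {T : Vstar ≃ₗ[ℂ] S.Vst Vstar θ}, S.IsBoundedTransfer Z E C θ T →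
    ∀ {g : 𝓗} {P : ℝ} {v : Vstar} {z : S.V 0}, S.IsLimitSolution a₁ a₂ Z E ε θ g P v z →
    ∀ v' ∈ S.Vst Vstar θ,
      ‖S.residual ε θ g (S.trialField a₁ T v z) v'‖ ≤ D * ε * P * ‖v'‖ := by
  obtain ⟨D, hD, hN⟩ := hC.exists_norm_corrector_le
  have hCp := hC.pos
  refine ⟨C * C + C * D, by positivity, fun ε hε θ hθ T hT g P v z hsol w hw => ?_⟩
  obtain ⟨v', hv'⟩ := T.surjective ⟨w, hw⟩
  obtain rfl : (T v' : H) = w := congrArg Subtype.val hv'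
  have hP := hsol.nonneg
  have hθz := hsol.mul_norm_snd_le
  rw [hC.residual_trialField_apply_transfer hT hsol]
  calc _ ≤ C * ‖θ‖ * ‖v'‖ * ‖z‖ + C * ‖(S.corrector a₁ θ z : H)‖ * ‖T v'‖ := by
        refine norm_add_le_of_le ?_ (hC.b_le θ hθ _ _)
        rw [RCLike.norm_conj]
        exact hT.b_sub_le v' z hsol.snd_mem
    _ = C * (‖θ‖ * ‖z‖) * ‖v'‖ + C * ‖(S.corrector a₁ θ z : H)‖ * ‖T v'‖ := by ring
    _ ≤ C * (ε * P) * (C * ‖T v'‖) + C * (D * (ε * P)) * ‖T v'‖ := by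
        gcongr C * ?_ * ?_ + C * ?_ * _
        · exact hT.norm_le v'
        · exact hN hsol
    _ = (C * C + C * D) * ε * P * ‖(T v' : H)‖ := by rw [Submodule.coe_norm]; ring

theorem exists_residual_Z_bound : ∃ D ≥ 0, ∀ ε > 0, ∀ θ ∈ S.Θ,
    ∀ {T : Vstar ≃ₗ[ℂ] S.Vst Vstar θ}, S.IsBoundedTransfer Z E C θ T →
    ∀ {g : 𝓗} {P : ℝ} {v : Vstar} {z : S.V 0}, S.IsLimitSolution a₁ a₂ Z E ε θ g P v z →
    ∀ z' ∈ Z,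
      ‖S.residual ε θ g (S.trialField a₁ T v z) z'‖ ≤ D * P * ((ε + ‖θ‖) * ‖z'‖) := by
  obtain ⟨D₁, hD₁, hN⟩ := hC.exists_norm_corrector_le
  obtain ⟨D₂, hD₂, hhom⟩ := hC.exists_a_sub_homForm_bound
  have hCp := hC.pos
  refine ⟨D₂ + 2 * C + C * D₁ + C ^ 2, by positivity,
    fun ε hε θ hθ T hT g P v z hsol z' hz' => ?_⟩
  have hP := hsol.nonneg
  have hscaled : ‖((ε : ℂ) ^ 2)⁻¹ *
      ((S.a θ).toForm (z + S.corrector a₁ θ z) z' - S.homForm a₁ a₂ θ z z')‖ ≤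
        D₂ * P * (‖θ‖ * ‖z'‖) := by
    rw [norm_inv_sq_mul]
    calc _ ≤ (ε ^ 2)⁻¹ * (D₂ * ‖θ‖ ^ 3 * ‖z‖ * ‖z'‖) := by gcongr; exact hhom θ hθ z z'
      _ = D₂ * ((ε ^ 2)⁻¹ * ‖θ‖ ^ 2 * ‖z‖) * (‖θ‖ * ‖z'‖) := by ring
      _ ≤ _ := by gcongr; exact hsol.sq_mul_norm_snd_le
  have hdatum : ‖(S.d θ).toForm g (E θ (S.ι z') - S.ι z')‖ ≤ P * (C ^ 2 * (‖θ‖ * ‖z'‖)) :=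
    ((S.d θ).norm_apply_le _ _).trans
      (mul_le_mul hsol.nrm_datum_le (hC.nrm_E_ι_sub_le hθ z') (NonnegForm.nrm_nonneg _ _) hP)
  rw [hC.residual_trialField_apply_Z hsol hz']
  calc _ ≤ D₂ * P * (‖θ‖ * ‖z'‖) + C * ‖θ‖ * ‖v‖ * ‖z'‖ + C * ‖θ‖ * ‖z‖ * ‖z'‖ +
        C * ‖(S.corrector a₁ θ z : H)‖ * ‖z'‖ + P * (C ^ 2 * (‖θ‖ * ‖z'‖)) :=
        norm_add_le_of_le (norm_add_le_of_le (norm_add_le_of_le (norm_add_le_of_le hscaled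
          (hT.b_sub_le v z' hz')) (hC.b_sub_le z z.2 z' z'.2 θ hθ)) (hC.b_le θ hθ _ _)) hdatum
    _ ≤ D₂ * P * (‖θ‖ * ‖z'‖) + C * ‖θ‖ * P * ‖z'‖ + C * ‖θ‖ * P * ‖z'‖ +
        C * (D₁ * (ε * P)) * ‖z'‖ + P * (C ^ 2 * (‖θ‖ * ‖z'‖)) := by
        gcongr
        · exact hsol.norm_fst_le
        · exact hsol.norm_snd_le
        · exact hN hsol
    _ = (D₂ + 2 * C + C ^ 2) * P * (‖θ‖ * ‖z'‖) + C * D₁ * P * (ε * ‖z'‖) := by ring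
    _ ≤ (D₂ + 2 * C + C * D₁ + C ^ 2) * P * (‖θ‖ * ‖z'‖) +
        (D₂ + 2 * C + C * D₁ + C ^ 2) * P * (ε * ‖z'‖) := by
        have hCD₁ := mul_nonneg hCp.le hD₁
        have hC2 := sq_nonneg C
        exact add_le_add
          (mul_le_mul_of_nonneg_right (mul_le_mul_of_nonneg_right (by linarith) hP) (by positivity))
          (mul_le_mul_of_nonneg_right (mul_le_mul_of_nonneg_right (by linarith) hP) (by positivity))
    _ = _ := by ring

theorem exists_residual_norm_bound : ∃ D ≥ 0, ∀ ε > 0, ε < 1 → ∀ θ ∈ S.Θ,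
    ∀ {T : Vstar ≃ₗ[ℂ] S.Vst Vstar θ}, S.IsBoundedTransfer Z E C θ T →
    ∀ {g : 𝓗} {P : ℝ} {v : Vstar} {z : S.V 0}, S.IsLimitSolution a₁ a₂ Z E ε θ g P v z →
    ∀ r, ‖S.residual ε θ g (S.trialField a₁ T v z) r‖ ≤ D * P * ‖r‖ := by
  obtain ⟨D₁, hD₁, hN⟩ := hC.exists_norm_corrector_le
  obtain ⟨D₂, hD₂, ha⟩ := hC.exists_a_corrected_bound
  have hCp := hC.pos
  refine ⟨D₂ + C * (C + (1 + D₁)) + C, by positivity,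
    fun ε hε hε1 θ hθ T hT g P v z hsol r => ?_⟩
  have hP := hsol.nonneg
  have hscaled : ‖((ε : ℂ) ^ 2)⁻¹ * (S.a θ).toForm (z + S.corrector a₁ θ z) r‖ ≤
      D₂ * P * ‖r‖ := by
    rw [norm_inv_sq_mul]
    calc _ ≤ (ε ^ 2)⁻¹ * (D₂ * ‖θ‖ ^ 2 * ‖z‖ * ‖r‖) := by gcongr; exact ha θ hθ z r
      _ = D₂ * ((ε ^ 2)⁻¹ * ‖θ‖ ^ 2 * ‖z‖) * ‖r‖ := by ring
      _ ≤ _ := by gcongr; exact hsol.sq_mul_norm_snd_le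
  have hN_le : ‖(S.corrector a₁ θ z : H)‖ ≤ D₁ * P :=
    (hN hsol).trans (by gcongr; exact mul_le_of_le_one_left hP hε1.le)
  have htrial : ‖S.trialField a₁ T v z‖ ≤ C * P + (P + D₁ * P) :=
    norm_add_le_of_le ((hT.norm_apply_le v).trans (by gcongr; exact hsol.norm_fst_le))
      (norm_add_le_of_le hsol.norm_snd_le hN_le)
  have hdatum : ‖(S.d θ).toForm g (S.ι r)‖ ≤ P * (C * ‖r‖) :=
    ((S.d θ).norm_apply_le _ _).trans
      (mul_le_mul hsol.nrm_datum_le (hC.d_le θ hθ r) (NonnegForm.nrm_nonneg _ _) hP)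
  rw [hC.residual_trialField_apply]
  calc _ ≤ D₂ * P * ‖r‖ + C * ‖S.trialField a₁ T v z‖ * ‖r‖ + P * (C * ‖r‖) :=
        norm_sub_le_of_le (norm_add_le_of_le hscaled (hC.b_le θ hθ _ _)) hdatum
    _ ≤ D₂ * P * ‖r‖ + C * (C * P + (P + D₁ * P)) * ‖r‖ + P * (C * ‖r‖) := by gcongr
    _ = _ := by ring

theorem exists_residual_bound : ∃ D ≥ 0, ∀ ε > 0, ε < 1 → ∀ θ ∈ S.Θ,
    ∀ {T : Vstar ≃ₗ[ℂ] S.Vst Vstar θ}, S.IsBoundedTransfer Z E C θ T →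
    ∀ {g : 𝓗} {P : ℝ} {v : Vstar} {z : S.V 0}, S.IsLimitSolution a₁ a₂ Z E ε θ g P v z →
    ∀ φ, ‖S.residual ε θ g (S.trialField a₁ T v z) φ‖ ≤ D * ε * P * (S.opForm ε θ).nrm φ := by
  obtain ⟨D, hD, hdec⟩ := hC.exists_decomposition
  obtain ⟨D₁, hD₁, hVst⟩ := hC.exists_residual_Vst_bound
  obtain ⟨D₂, hD₂, hZ⟩ := hC.exists_residual_Z_bound
  obtain ⟨D₃, hD₃, hrem⟩ := hC.exists_residual_norm_bound
  have hCp := hC.pos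
  refine ⟨D₁ * (D * C) + D₂ * (D * C + D) + D₃ * D, by positivity,
    fun ε hε hε1 θ hθ T hT g P v z hsol φ => ?_⟩
  obtain ⟨v', hv', z', hz', r, rfl, hv'_le, hz'_le, hθz', hr⟩ := hdec θ hθ φ
  set φ := v' + z' + r
  set q := (S.opForm ε θ).nrm φ
  have hP := hsol.nonneg
  have hφ : ‖φ‖ ≤ C * q :=
    (hC.norm_le θ hθ φ).trans (by gcongr; exact S.nrm_le_opForm hε hε1 θ φ)
  have haφ : (S.a θ).nrm φ ≤ ε * q := S.a_nrm_le_opForm hε θ φ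
  calc _ ≤ D₁ * ε * P * ‖v'‖ + D₂ * P * ((ε + ‖θ‖) * ‖z'‖) + D₃ * P * ‖r‖ := by
        rw [map_add, map_add]
        exact norm_add_le_of_le (norm_add_le_of_le (hVst ε hε θ hθ hT hsol v' hv')
          (hZ ε hε θ hθ hT hsol z' hz')) (hrem ε hε hε1 θ hθ hT hsol r)
    _ = D₁ * ε * P * ‖v'‖ + D₂ * P * (ε * ‖z'‖ + ‖θ‖ * ‖z'‖) + D₃ * P * ‖r‖ := by ring
    _ ≤ D₁ * ε * P * (D * (C * q)) + D₂ * P * (ε * (D * (C * q)) + D * (ε * q)) +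
        D₃ * P * (D * (ε * q)) := by
        gcongr D₁ * ε * P * ?_ + D₂ * P * (ε * ?_ + ?_) + D₃ * P * ?_
        · exact hv'_le.trans (mul_le_mul_of_nonneg_left hφ hD)
        · exact hz'_le.trans (mul_le_mul_of_nonneg_left hφ hD)
        · exact hθz'.trans (mul_le_mul_of_nonneg_left haφ hD)
        · exact hr.trans (mul_le_mul_of_nonneg_left haφ hD)
    _ = _ := by ring

end Residual

section SolutionEstimate

variable (hC : S.Bounds Vstar Z a₁ a₂ E C)
include hC

theorem sumMap_mem_V (p : Vstar × Z) : S.sumMap Vstar Z p ∈ S.V 0 :=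
  Submodule.add_mem _ (hC.Vstar_le p.1.2) (p.2 : S.V 0).2

theorem norm_le_b_nrm_of_mem_V {v : H} (hv : v ∈ S.V 0) : ‖v‖ ≤ C * (S.b 0).nrm v := by
  have hnrm : S.nrm 0 v = (S.b 0).nrm v := by
    rw [← sq_eq_sq₀ (S.nrm_nonneg _ _) (NonnegForm.nrm_nonneg _ _), S.nrm_sq_of_mem_V hv,
      NonnegForm.nrm_sq]
  exact hnrm ▸ hC.norm_le 0 hC.zero_mem v

theorem norm_le_mul_norm_sumMap (p : Vstar × Z) : ‖p‖ ≤ C * ‖S.sumMap Vstar Z p‖ :=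
  have hdirect := hC.direct p.1 p.1.2 p.2 p.2.2
  max_le hdirect.1 hdirect.2

theorem d_norm_apply_ι_le (g : 𝓗) (u : H) :
    ‖(S.d 0).toForm g (S.ι u)‖ ≤ (S.d 0).nrm g * (C * ‖u‖) :=
  ((S.d 0).norm_apply_le _ _).trans
    (mul_le_mul_of_nonneg_left (hC.d_le 0 hC.zero_mem _) (NonnegForm.nrm_nonneg _ _))

variable [CompleteSpace H]

theorem homForm_self_re_nonneg (ξ : Param n) {z : S.V 0} (hz : z ∈ Z) :
    0 ≤ (S.homForm a₁ a₂ ξ z z).re := by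
  obtain ⟨c, hc, hcoer⟩ := hC.exists_homForm_coercive
  exact le_trans (by positivity) (hcoer ξ z hz)

theorem b_quad_sumMap_le_re_limitForm (ξ : Param n) (p : Vstar × Z) :
    (S.b 0).quad (S.sumMap Vstar Z p) ≤ (S.limitForm Vstar Z a₁ a₂ ξ p p).re := by
  rw [limitForm_apply, Complex.add_re]
  exact le_add_of_nonneg_left (hC.homForm_self_re_nonneg ξ p.2.2)

theorem norm_sumMap_le_of_limitForm_eq {ξ : Param n} {g : 𝓗} {p : Vstar × Z}
    (hp : ∀ q, S.limitForm Vstar Z a₁ a₂ ξ p q = (S.d 0).toForm g (S.ι (S.sumMap Vstar Z q))) :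
    ‖S.sumMap Vstar Z p‖ ≤ C * (S.d 0).nrm g := by
  set s := S.sumMap Vstar Z p
  have hCp := hC.pos
  have hb : (S.b 0).nrm s ≤ (S.d 0).nrm g := by
    refine le_of_sq_le_mul (NonnegForm.nrm_nonneg _ _) ?_
    calc (S.b 0).nrm s ^ 2 = (S.b 0).quad s := NonnegForm.nrm_sq _ _
      _ ≤ ((S.d 0).toForm g (S.ι s)).re := hp p ▸ hC.b_quad_sumMap_le_re_limitForm ξ p
      _ ≤ (S.d 0).nrm g * (S.d 0).nrm (S.ι s) :=
          (Complex.re_le_norm _).trans ((S.d 0).norm_apply_le _ _)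
      _ ≤ (S.d 0).nrm g * (S.b 0).nrm s := mul_le_mul_of_nonneg_left
          (Real.sqrt_le_sqrt (S.d_le_b 0 hC.zero_mem s)) (NonnegForm.nrm_nonneg _ _)
  calc ‖s‖ ≤ C * (S.b 0).nrm s := hC.norm_le_b_nrm_of_mem_V (hC.sumMap_mem_V p)
    _ ≤ C * (S.d 0).nrm g := mul_le_mul_of_nonneg_left hb hCp.le

theorem exists_sq_mul_norm_snd_le : ∃ D ≥ 0, ∀ {ξ : Param n} {g : 𝓗} {p : Vstar × Z},
    (∀ q, S.limitForm Vstar Z a₁ a₂ ξ p q = (S.d 0).toForm g (S.ι (S.sumMap Vstar Z q))) →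
    ‖ξ‖ ^ 2 * ‖p.2‖ ≤ D * (S.d 0).nrm g := by
  obtain ⟨c, hc, hcoer⟩ := hC.exists_homForm_coercive
  have hCp := hC.pos
  refine ⟨c⁻¹ * (C + C ^ 2), by positivity, fun {ξ g p} hp => ?_⟩
  have hγ : 0 ≤ (S.d 0).nrm g := NonnegForm.nrm_nonneg _ _
  have htest := hp (0, p.2)
  have hsnd : S.sumMap Vstar Z (0, p.2) = (p.2 : S.V 0) := by simp [sumMap_apply]
  rw [limitForm_apply, hsnd] at htest
  have hhom : ‖S.homForm a₁ a₂ ξ p.2 p.2‖ ≤ (C + C ^ 2) * (S.d 0).nrm g * ‖p.2‖ := by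
    rw [eq_sub_of_add_eq htest]
    calc _ ≤ (S.d 0).nrm g * (C * ‖p.2‖) + C * ‖S.sumMap Vstar Z p‖ * ‖p.2‖ :=
          norm_sub_le_of_le (hC.d_norm_apply_ι_le g _) (hC.b_le 0 hC.zero_mem _ _)
      _ ≤ (S.d 0).nrm g * (C * ‖p.2‖) + C * (C * (S.d 0).nrm g) * ‖p.2‖ := by
          gcongr
          exact hC.norm_sumMap_le_of_limitForm_eq hp
      _ = _ := by ring
  obtain hz | hz := (norm_nonneg p.2).eq_or_lt
  · rw [← hz, mul_zero]
    positivity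
  rw [mul_assoc, ← div_eq_inv_mul, le_div_iff₀ hc]
  refine le_of_mul_le_mul_right ?_ hz
  calc ‖ξ‖ ^ 2 * ‖p.2‖ * c * ‖p.2‖ = c * ‖ξ‖ ^ 2 * ‖p.2‖ ^ 2 := by ring
    _ ≤ (S.homForm a₁ a₂ ξ p.2 p.2).re := hcoer ξ p.2 p.2.2
    _ ≤ _ := (Complex.re_le_norm _).trans hhom

theorem exists_isLimitSolution : ∃ D ≥ 0, ∀ ε > 0, ∀ θ ∈ S.Θ, ∀ {g : 𝓗} {p : Vstar × Z},
    (∀ q, S.limitForm Vstar Z a₁ a₂ (ε⁻¹ • θ) p q =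
      (S.d 0).toForm ((E θ).symm g) (S.ι (S.sumMap Vstar Z q))) →
    S.IsLimitSolution a₁ a₂ Z E ε θ g (D * (S.d θ).nrm g) p.1 p.2 := by
  obtain ⟨D, hD, hξz⟩ := hC.exists_sq_mul_norm_snd_le
  have hCp := hC.pos
  refine ⟨1 + C ^ 2 + D, by positivity, fun ε hε θ hθ {g p} hp => ?_⟩
  have hγ : 0 ≤ (S.d θ).nrm g := NonnegForm.nrm_nonneg _ _
  have hs := hC.norm_sumMap_le_of_limitForm_eq hp
  have hz₂ := hξz hp
  rw [hC.nrm_d_E_symm hθ] at hs hz₂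
  have hp_le : ‖p‖ ≤ C ^ 2 * (S.d θ).nrm g :=
    calc ‖p‖ ≤ C * ‖S.sumMap Vstar Z p‖ := hC.norm_le_mul_norm_sumMap p
      _ ≤ C * (C * (S.d θ).nrm g) := mul_le_mul_of_nonneg_left hs hCp.le
      _ = _ := by ring
  have hsnd : ‖p.2‖ ≤ C ^ 2 * (S.d θ).nrm g := (norm_snd_le p).trans hp_le
  have hnorm : ‖ε⁻¹ • θ‖ = ε⁻¹ * ‖θ‖ := by rw [norm_smul, norm_inv, Real.norm_of_nonneg hε.le]
  have htest (q : Vstar × Z) := (hp q).trans (hC.d_E_symm hθ g _)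
  simp only [limitForm_apply, sumMap_apply, hC.homForm_smul] at htest
  have hC2 := sq_nonneg C
  refine ⟨p.2.2, fun v' => ?_, fun z' hz' => ?_, ?_, ?_, ?_, ?_, ?_⟩
  · simpa using htest (v', 0)
  · simpa using htest (0, ⟨z', hz'⟩)
  · exact le_mul_of_one_le_left hγ (by linarith)
  · exact ((norm_fst_le p).trans hp_le).trans (mul_le_mul_of_nonneg_right (by linarith) hγ)
  · exact hsnd.trans (mul_le_mul_of_nonneg_right (by linarith) hγ)
  · rw [← inv_pow, ← mul_pow, ← hnorm]
    exact hz₂.trans (mul_le_mul_of_nonneg_right (by linarith) hγ)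
  · have hle_sq : ‖ε⁻¹ • θ‖ ≤ 1 + ‖ε⁻¹ • θ‖ ^ 2 := by nlinarith [sq_nonneg (‖ε⁻¹ • θ‖ - 1)]
    calc ‖θ‖ * ‖p.2‖ = ε * (‖ε⁻¹ • θ‖ * ‖p.2‖) := by rw [hnorm]; field_simp
      _ ≤ ε * ((1 + ‖ε⁻¹ • θ‖ ^ 2) * ‖p.2‖) := by gcongr
      _ = ε * (‖p.2‖ + ‖ε⁻¹ • θ‖ ^ 2 * ‖p.2‖) := by ring
      _ ≤ ε * (C ^ 2 * (S.d θ).nrm g + D * (S.d θ).nrm g) := by gcongr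
      _ ≤ _ := by gcongr; linarith

theorem exists_nrm_trialField_sub_le : ∃ D ≥ 0, ∀ ε > 0, ε < 1 → ∀ θ ∈ S.Θ,
    ∀ {T : Vstar ≃ₗ[ℂ] S.Vst Vstar θ}, S.IsBoundedTransfer Z E C θ T →
    ∀ {g : 𝓗} {P : ℝ} {v : Vstar} {z : S.V 0}, S.IsLimitSolution a₁ a₂ Z E ε θ g P v z →
    ∀ {u : H}, (∀ φ, (S.opForm ε θ).toForm u φ = (S.d θ).toForm g (S.ι φ)) →
      (S.opForm ε θ).nrm (S.trialField a₁ T v z - u) ≤ D * (ε * P) := by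
  obtain ⟨D, hD, hres⟩ := hC.exists_residual_bound
  refine ⟨D, hD, fun ε hε hε1 θ hθ {T} hT {g P v z} hsol {u} hu => ?_⟩
  have hP := hsol.nonneg
  set e := S.trialField a₁ T v z - u
  refine le_of_sq_le_mul (by positivity) ?_
  calc (S.opForm ε θ).nrm e ^ 2 = ‖(S.opForm ε θ).toForm e e‖ := by
        rw [NonnegForm.nrm_sq, NonnegForm.apply_self, Complex.norm_real,
          Real.norm_of_nonneg ((S.opForm ε θ).quad_nonneg e)]
    _ = ‖S.residual ε θ g (S.trialField a₁ T v z) e‖ := by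
        rw [residual_apply, ← hu, ← LinearMap.sub_apply, ← map_sub]
    _ ≤ D * ε * P * (S.opForm ε θ).nrm e := hres ε hε hε1 θ hθ hT hsol e
    _ = D * (ε * P) * (S.opForm ε θ).nrm e := by ring

theorem exists_solution_estimate : ∃ D ≥ 0, ∀ ε > 0, ε < 1 → ∀ θ ∈ S.Θ,
    ∀ {g : 𝓗} {u : H} {p : Vstar × Z},
    (∀ φ, (S.opForm ε θ).toForm u φ = (S.d θ).toForm g (S.ι φ)) →
    (∀ q, S.limitForm Vstar Z a₁ a₂ (ε⁻¹ • θ) p q =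
      (S.d 0).toForm ((E θ).symm g) (S.ι (S.sumMap Vstar Z q))) →
    (S.d θ).nrm (S.ι u - E θ (S.ι (S.sumMap Vstar Z p))) ≤ D * ε * (S.d θ).nrm g := by
  obtain ⟨D₀, hD₀, hlim⟩ := hC.exists_isLimitSolution
  obtain ⟨D₁, hD₁, hN⟩ := hC.exists_norm_corrector_le
  obtain ⟨D₂, hD₂, htrial⟩ := hC.exists_nrm_trialField_sub_le
  have hCp := hC.pos
  refine ⟨(C * D₁ + D₂ + C ^ 2) * D₀, by positivity, fun ε hε hε1 θ hθ {g u p} hu hp => ?_⟩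
  obtain ⟨T, hT⟩ := hC.transfer θ hθ
  have hsol := hlim ε hε θ hθ hp
  set P := D₀ * (S.d θ).nrm g
  set w := (S.corrector a₁ θ p.2 : H)
  set e := S.trialField a₁ T p.1 p.2 - u with he
  have hsplit : S.ι u - E θ (S.ι (S.sumMap Vstar Z p)) =
      S.ι w - S.ι e - (E θ (S.ι (p.2 : S.V 0)) - S.ι (p.2 : S.V 0)) := by
    rw [he, trialField, sumMap_apply]
    simp only [map_add, map_sub, hT.ι_apply]
    abel
  have hw : (S.d θ).nrm (S.ι w) ≤ C * (D₁ * (ε * P)) :=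
    (hC.d_le θ hθ w).trans (mul_le_mul_of_nonneg_left (hN hsol) hCp.le)
  have hιe : (S.d θ).nrm (S.ι e) ≤ D₂ * (ε * P) :=
    calc (S.d θ).nrm (S.ι e) ≤ (S.b θ).nrm e := Real.sqrt_le_sqrt (S.d_le_b θ hθ e)
      _ ≤ S.nrm θ e := S.b_nrm_le θ e
      _ ≤ (S.opForm ε θ).nrm e := S.nrm_le_opForm hε hε1 θ e
      _ ≤ _ := htrial ε hε hε1 θ hθ hT hsol hu
  have hz : (S.d θ).nrm (E θ (S.ι (p.2 : S.V 0)) - S.ι (p.2 : S.V 0)) ≤ C ^ 2 * (ε * P) :=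
    (hC.nrm_E_ι_sub_le hθ _).trans
      (mul_le_mul_of_nonneg_left hsol.mul_norm_snd_le (sq_nonneg C))
  rw [hsplit]
  calc _ ≤ C * (D₁ * (ε * P)) + D₂ * (ε * P) + C ^ 2 * (ε * P) :=
        (NonnegForm.nrm_sub_le _ _ _).trans
          (add_le_add ((NonnegForm.nrm_sub_le _ _ _).trans (add_le_add hw hιe)) hz)
    _ = _ := by ring

end SolutionEstimate

end Bounds

/-! ### The inverses -/

theorem denseRange_limitEmbedding : DenseRange (S.limitEmbedding Vstar Z) := by
  refine Subtype.dense_iff.2 fun x hx => closure_mono ?_ hx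
  rintro _ ⟨y, hy, rfl⟩
  obtain ⟨v, hv, _, ⟨z, hz, rfl⟩, rfl⟩ := Submodule.mem_sup.1 hy
  exact ⟨S.limitEmbedding Vstar Z (⟨v, hv⟩, ⟨z, hz⟩), ⟨_, rfl⟩, rfl⟩

theorem norm_sumMap_le (p : Vstar × Z) : ‖S.sumMap Vstar Z p‖ ≤ 2 * ‖p‖ := by
  rw [sumMap_apply, two_mul]
  exact norm_add_le_of_le (norm_fst_le p) (norm_snd_le p)

theorem isCompactOperator_limitEmbedding : IsCompactOperator (S.limitEmbedding Vstar Z) :=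
  (S.isCompactOperator_ι.comp_clm
    ((S.sumMap Vstar Z).mkContinuous 2 norm_sumMap_le)).codRestrict _
      (Submodule.isClosed_topologicalClosure _)

theorem rank_limitSpace {N : ℕ} (hN : Module.rank ℂ (S.sumSpace Vstar Z) = N) :
    Module.rank ℂ (S.limitSpace Vstar Z) = N := by
  have : FiniteDimensional ℂ (S.sumSpace Vstar Z) :=
    Module.rank_lt_aleph0_iff.1 (hN ▸ Cardinal.natCast_lt_aleph0)
  have hlimit : S.limitSpace Vstar Z = (S.sumSpace Vstar Z).map S.ι.toLinearMap :=
    (Submodule.closed_of_finiteDimensional _).submodule_topologicalClosure_eq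
  rw [hlimit, ← Module.finrank_eq_rank, ← Module.finrank_eq_of_rank_eq hN]
  exact congrArg _
    (Submodule.equivMapOfInjective S.ι.toLinearMap S.injective_ι _).finrank_eq.symm

theorem op_eq_formOperator (ε : ℝ) (θ : Param n) :
    S.op ε θ = formOperator (S.opForm ε θ).toForm S.ι.toLinearMap (S.d θ).toForm := by
  rw [opForm_toForm, op]

namespace Bounds

theorem isEquivNorm_opForm (hC : S.Bounds Vstar Z a₁ a₂ E C) {ε : ℝ} (hε : 0 < ε) (hε1 : ε < 1)
    {θ : Param n} (hθ : θ ∈ S.Θ) : (S.opForm ε θ).IsEquivNorm := by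
  have hCp := hC.pos
  refine NonnegForm.isEquivNorm_of_sq_bounds (c := (C ^ 2)⁻¹) (C := (ε ^ 2)⁻¹ * C + C)
    (by positivity) (fun u => ?_) (fun u => ?_)
  · rw [inv_mul_le_iff₀ (by positivity), ← NonnegForm.nrm_sq, ← mul_pow]
    gcongr
    exact (hC.norm_le θ hθ u).trans
      (mul_le_mul_of_nonneg_left (S.nrm_le_opForm hε hε1 θ u) hCp.le)
  · rw [opForm_quad]
    calc _ ≤ (ε ^ 2)⁻¹ * (C * ‖u‖ * ‖u‖) + C * ‖u‖ * ‖u‖ := by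
          gcongr
          · exact (Complex.re_le_norm _).trans (hC.a_le θ hθ u u)
          · exact (Complex.re_le_norm _).trans (hC.b_le θ hθ u u)
      _ = _ := by ring

variable [CompleteSpace H]

/-- The form `𝕊_ξ`, as a non-negative form. -/
def limitNonnegForm (hC : S.Bounds Vstar Z a₁ a₂ E C) (ξ : Param n) : NonnegForm (Vstar × Z) where
  toForm := S.limitForm Vstar Z a₁ a₂ ξ
  re_nonneg p := ((S.b 0).quad_nonneg _).trans (hC.b_quad_sumMap_le_re_limitForm ξ p)
  im_eq_zero p := by
    rw [limitForm_apply, Complex.add_im, hC.homForm_self_im, (S.b 0).im_eq_zero, add_zero]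

variable (hC : S.Bounds Vstar Z a₁ a₂ E C)
include hC

theorem isEquivNorm_limitNonnegForm (ξ : Param n) : (hC.limitNonnegForm ξ).IsEquivNorm := by
  obtain ⟨D, hD, hhom⟩ := hC.exists_homForm_bound
  have hCp := hC.pos
  refine NonnegForm.isEquivNorm_of_sq_bounds (c := (C ^ 4)⁻¹) (C := D * ‖ξ‖ ^ 2 + C * 2 * 2)
    (by positivity) (fun p => ?_) (fun p => ?_)
  · refine le_trans ?_ (hC.b_quad_sumMap_le_re_limitForm ξ p)
    rw [inv_mul_le_iff₀ (by positivity), ← NonnegForm.nrm_sq]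
    calc ‖p‖ ^ 2 ≤ (C * (C * (S.b 0).nrm (S.sumMap Vstar Z p))) ^ 2 := by
          gcongr
          exact (hC.norm_le_mul_norm_sumMap p).trans
            (mul_le_mul_of_nonneg_left (hC.norm_le_b_nrm_of_mem_V (hC.sumMap_mem_V p)) hCp.le)
      _ = _ := by ring
  · calc _ ≤ ‖S.limitForm Vstar Z a₁ a₂ ξ p p‖ := Complex.re_le_norm _
      _ ≤ D * ‖ξ‖ ^ 2 * ‖p.2‖ * ‖p.2‖ + C * ‖S.sumMap Vstar Z p‖ * ‖S.sumMap Vstar Z p‖ :=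
          norm_add_le_of_le (hhom ξ p.2 p.2) (hC.b_le 0 hC.zero_mem _ _)
      _ ≤ D * ‖ξ‖ ^ 2 * ‖p‖ * ‖p‖ + C * (2 * ‖p‖) * (2 * ‖p‖) := by
          have hsnd := norm_snd_le p
          have hsum := norm_sumMap_le p
          gcongr
      _ = _ := by ring

omit [CompleteSpace H] in
theorem injective_limitEmbedding : Function.Injective (S.limitEmbedding Vstar Z) := by
  rw [injective_iff_map_eq_zero]
  intro p hp
  have hsum : S.sumMap Vstar Z p = 0 :=
    S.injective_ι ((congrArg Subtype.val hp).trans (map_zero S.ι).symm)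
  have hp_le := hC.norm_le_mul_norm_sumMap p
  rw [hsum, norm_zero, mul_zero] at hp_le
  exact norm_le_zero_iff.1 hp_le

theorem exists_op_inverse {ε : ℝ} (hε : 0 < ε) (hε1 : ε < 1) {θ : Param n} (hθ : θ ∈ S.Θ) :
    ∃ N : 𝓗 →ₗ[ℂ] H, (∀ g φ, (S.opForm ε θ).toForm (N g) φ = (S.d θ).toForm g (S.ι φ)) ∧
      IsContractiveInverse (S.d θ) (S.op ε θ) (S.ι.toLinearMap ∘ₗ N) ∧
      IsCompactOperator (S.ι.toLinearMap ∘ₗ N) := by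
  have hs := hC.isEquivNorm_opForm hε hε1 hθ
  have hd := S.isEquivNorm_d θ hθ
  have hds (u : H) : (S.d θ).quad (S.ι u) ≤ (S.opForm ε θ).quad u := by
    rw [opForm_quad]
    exact (S.d_le_b θ hθ u).trans
      (le_add_of_nonneg_left (mul_nonneg (by positivity) ((S.a θ).quad_nonneg u)))
  obtain ⟨N, hN⟩ := exists_solutionOperator (j := S.ι.toLinearMap) hs hds
  rw [op_eq_formOperator]
  exact ⟨N, hN, isContractiveInverse_formOperator hN hs hd S.injective_ι S.denseRange_ι hds,
    isCompactOperator_comp_solutionOperator hN hs hd S.isCompactOperator_ι hds⟩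

theorem exists_limitOp_inverse (ξ : Param n) :
    ∃ N : S.limitSpace Vstar Z →ₗ[ℂ] Vstar × Z,
      (∀ g q, S.limitForm Vstar Z a₁ a₂ ξ (N g) q =
        (S.d 0).toForm g (S.ι (S.sumMap Vstar Z q))) ∧
      IsContractiveInverse ((S.d 0).comap (S.limitSpace Vstar Z).subtype)
        (S.limitOp Vstar Z a₁ a₂ ξ) (S.limitEmbedding Vstar Z ∘ₗ N) ∧
      IsCompactOperator (S.limitEmbedding Vstar Z ∘ₗ N) := by
  have : CompleteSpace Vstar := hC.isClosed_Vstar.completeSpace_coe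
  have : CompleteSpace (S.V 0) :=
    (NonnegForm.isClosed_nullSpace (hC.a_le 0 hC.zero_mem)).completeSpace_coe
  have : CompleteSpace Z := hC.isClosed_Z.completeSpace_coe
  have hs := hC.isEquivNorm_limitNonnegForm ξ
  have hd := (S.isEquivNorm_d 0 hC.zero_mem).comap_subtype (S.limitSpace Vstar Z)
  have hds (p : Vstar × Z) : ((S.d 0).comap (S.limitSpace Vstar Z).subtype).quad
      (S.limitEmbedding Vstar Z p) ≤ (hC.limitNonnegForm ξ).quad p :=
    (S.d_le_b 0 hC.zero_mem _).trans (hC.b_quad_sumMap_le_re_limitForm ξ p)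
  obtain ⟨N, hN⟩ := exists_solutionOperator hs hds
  exact ⟨N, hN, isContractiveInverse_formOperator hN hs hd hC.injective_limitEmbedding
    denseRange_limitEmbedding hds,
    isCompactOperator_comp_solutionOperator hN hs hd isCompactOperator_limitEmbedding hds⟩

theorem exists_nrm_inverse_sub_le [CompleteSpace 𝓗] : ∃ D ≥ 0, ∀ ε > 0, ε < 1 → ∀ θ ∈ S.Θ,
    ∃ (R : 𝓗 →ₗ[ℂ] 𝓗) (R₀ : S.limitSpace Vstar Z →ₗ[ℂ] S.limitSpace Vstar Z)
      (P : 𝓗 →ₗ[ℂ] S.limitSpace Vstar Z),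
      (IsContractiveInverse (S.d θ) (S.op ε θ) R ∧ IsCompactOperator R) ∧
      (IsContractiveInverse ((S.d 0).comap (S.limitSpace Vstar Z).subtype)
        (S.limitOp Vstar Z a₁ a₂ (ε⁻¹ • θ)) R₀ ∧ IsCompactOperator R₀) ∧
      IsOrthProj (S.d 0).toForm (S.limitSpace Vstar Z) P ∧
      ∀ g, (S.d θ).nrm (R g - E θ (R₀ (P ((E θ).symm g)))) ≤ D * ε * (S.d θ).nrm g := by
  obtain ⟨D, hD, hest⟩ := hC.exists_solution_estimate
  refine ⟨D, hD, fun ε hε hε1 θ hθ => ?_⟩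
  obtain ⟨N, hN, hR⟩ := hC.exists_op_inverse hε hε1 hθ
  obtain ⟨N₀, hN₀, hR₀⟩ := hC.exists_limitOp_inverse (ε⁻¹ • θ)
  obtain ⟨P, hP⟩ := (S.isEquivNorm_d 0 hC.zero_mem).exists_isOrthProj
    (U := S.limitSpace Vstar Z) (Submodule.isClosed_topologicalClosure _)
  refine ⟨_, _, P, hR, hR₀, hP, fun g => hest ε hε hε1 θ hθ (hN g) fun q => ?_⟩
  rw [hN₀]
  exact hP.apply_left _ (S.limitEmbedding Vstar Z q)

end Bounds

end Setting

end

end AbstractHom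

theorem mainTheorem6_general (n : ℕ) (H 𝓗 : Type*)
    [NormedAddCommGroup H] [InnerProductSpace ℂ H] [CompleteSpace H]
    [NormedAddCommGroup 𝓗] [InnerProductSpace ℂ 𝓗] [CompleteSpace 𝓗]
    (S : AbstractHom.Setting n H 𝓗)
    (Vstar : Submodule ℂ H) (Z : Submodule ℂ (S.V 0))
    (a₁ : S.V 0 →ₗ[ℂ] H →ₗ⋆[ℂ] (Fin n → ℂ))
    (a₂ : S.V 0 →ₗ[ℂ] S.V 0 →ₗ⋆[ℂ] Matrix (Fin n) (Fin n) ℂ)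
    (E : AbstractHom.Param n → 𝓗 ≃ₗ[ℂ] 𝓗)
    (h1 : S.GapCondition)
    (h2 : S.RemovableSingularity Vstar)
    (hZ : S.IsDefectSpace Vstar Z)
    (h3 : S.QuadraticGap)
    (h4 : S.RegularAtZero a₁ a₂)
    (h5 : ∃ L ≥ 0, ∀ v ∈ S.V 0, ∀ v' ∈ S.V 0, ∀ θ ∈ S.Θ,
      ‖(S.b θ).toForm v v' - (S.b 0).toForm v v'‖ ≤ L * ‖θ‖ * S.nrm 0 v * S.nrm θ v')
    (h6 : S.UnitaryTransfer Vstar Z E) :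
    ∃ C > 0, ∀ ε : ℝ, 0 < ε → ε < 1 → ∀ θ ∈ S.Θ,
      (∃ (R : 𝓗 →ₗ[ℂ] 𝓗) (R₀ : S.limitSpace Vstar Z →ₗ[ℂ] S.limitSpace Vstar Z)
          (P : 𝓗 →ₗ[ℂ] S.limitSpace Vstar Z),
        AbstractHom.IsInverse (S.op ε θ) R ∧
        AbstractHom.IsInverse (S.limitOp Vstar Z a₁ a₂ (ε⁻¹ • θ)) R₀ ∧
        AbstractHom.IsOrthProj (S.d 0).toForm (S.limitSpace Vstar Z) P ∧
        ∀ g : 𝓗, (S.d θ).nrm (R g - E θ (R₀ (P ((E θ).symm g)))) ≤ C * ε * (S.d θ).nrm g) ∧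
      (¬ FiniteDimensional ℂ (S.sumSpace Vstar Z) → ∀ k : ℕ, 1 ≤ k →
        |1 / AbstractHom.eigenvalue (S.op ε θ) k
          - 1 / AbstractHom.eigenvalue (S.limitOp Vstar Z a₁ a₂ (ε⁻¹ • θ)) k| ≤ C * ε) ∧
      (∀ N : ℕ, Module.rank ℂ (S.sumSpace Vstar Z) = N →
        (∀ k : ℕ, 1 ≤ k → k ≤ N →
          |1 / AbstractHom.eigenvalue (S.op ε θ) k
            - 1 / AbstractHom.eigenvalue (S.limitOp Vstar Z a₁ a₂ (ε⁻¹ • θ)) k| ≤ C * ε) ∧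
        (∀ p : ℕ, N + 1 ≤ p → (p : Cardinal) ≤ Module.rank ℂ 𝓗 →
          |1 / AbstractHom.eigenvalue (S.op ε θ) p| ≤ C * ε)) := by
  obtain ⟨C, hC⟩ := S.exists_bounds h1 h2 hZ h3 h4 h5 h6
  obtain ⟨D, hD, hinverse⟩ := hC.exists_nrm_inverse_sub_le
  refine ⟨D + 1, by positivity, fun ε hε hε1 θ hθ => ?_⟩
  obtain ⟨R, R₀, P, hR, hR₀, hP, hest⟩ := hinverse ε hε hε1 θ hθ
  have : CompleteSpace (S.limitSpace Vstar Z) :=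
    (Submodule.isClosed_topologicalClosure _).completeSpace_coe
  have hest' (g : 𝓗) :
      (S.d θ).nrm (R g - E θ (R₀ (P ((E θ).symm g)))) ≤ (D + 1) * ε * (S.d θ).nrm g :=
    (hest g).trans (mul_le_mul_of_nonneg_right (by nlinarith) ((S.d θ).nrm_nonneg g))
  have heig (k : ℕ) (hk : 1 ≤ k) :=
    AbstractHom.abs_one_div_eigenvalue_sub_le (S.isEquivNorm_d θ hθ) hR.1 hR.2
      (S.isEquivNorm_d 0 hC.zero_mem) hR₀.1 hR₀.2 hP (hC.d_E θ hθ) (by positivity) hest' hk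
  refine ⟨⟨R, R₀, P, hR.1.isInverse, hR₀.1.isInverse, hP, hest'⟩, fun _ => heig,
    fun N hN => ⟨fun k hk _ => heig k hk, fun p hp _ => ?_⟩⟩
  have hzero : AbstractHom.eigenvalue (S.limitOp Vstar Z a₁ a₂ (ε⁻¹ • θ)) p = 0 :=
    AbstractHom.eigenvalue_eq_zero_of_rank_lt
      ((AbstractHom.Setting.rank_limitSpace hN).trans_lt (Nat.cast_lt.2 hp))
  simpa only [hzero, div_zero, sub_zero] using heig p ((Nat.le_add_left 1 N).trans hp)

theorem mainTheorem6 (n : ℕ) (hn : 1 ≤ n) (H 𝓗 : Type*)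
    [NormedAddCommGroup H] [InnerProductSpace ℂ H] [CompleteSpace H]
    [TopologicalSpace.SeparableSpace H]
    [NormedAddCommGroup 𝓗] [InnerProductSpace ℂ 𝓗] [CompleteSpace 𝓗]
    [TopologicalSpace.SeparableSpace 𝓗]
    (S : AbstractHom.Setting n H 𝓗)
    (Vstar : Submodule ℂ H) (Z : Submodule ℂ (S.V 0))
    (a₁ : S.V 0 →ₗ[ℂ] H →ₗ⋆[ℂ] (Fin n → ℂ))
    (a₂ : S.V 0 →ₗ[ℂ] S.V 0 →ₗ⋆[ℂ] Matrix (Fin n) (Fin n) ℂ)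
    (E : AbstractHom.Param n → 𝓗 ≃ₗ[ℂ] 𝓗)
    (h1 : S.GapCondition)
    (h2 : S.RemovableSingularity Vstar)
    (hZ : S.IsDefectSpace Vstar Z)
    (h3 : S.QuadraticGap)
    (h4 : S.RegularAtZero a₁ a₂)
    (h5 : S.LipschitzB)
    (h6 : S.UnitaryTransfer Vstar Z E) :
    ∃ C > 0, ∀ ε : ℝ, 0 < ε → ε < 1 → ∀ θ ∈ S.Θ,
      -- the operator estimate in `(𝓗, d_θ)`
      (∃ (R : 𝓗 →ₗ[ℂ] 𝓗) (R₀ : S.limitSpace Vstar Z →ₗ[ℂ] S.limitSpace Vstar Z)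
          (P : 𝓗 →ₗ[ℂ] S.limitSpace Vstar Z),
        AbstractHom.IsInverse (S.op ε θ) R ∧
        AbstractHom.IsInverse (S.limitOp Vstar Z a₁ a₂ (ε⁻¹ • θ)) R₀ ∧
        AbstractHom.IsOrthProj (S.d 0).toForm (S.limitSpace Vstar Z) P ∧
        ∀ g : 𝓗, (S.d θ).nrm (R g - E θ (R₀ (P ((E θ).symm g)))) ≤ C * ε * (S.d θ).nrm g) ∧
      -- the eigenvalues, if `V_⋆ ∔ Z` is infinite-dimensional
      (¬ FiniteDimensional ℂ (S.sumSpace Vstar Z) → ∀ k : ℕ, 1 ≤ k →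
        |1 / AbstractHom.eigenvalue (S.op ε θ) k
          - 1 / AbstractHom.eigenvalue (S.limitOp Vstar Z a₁ a₂ (ε⁻¹ • θ)) k| ≤ C * ε) ∧
      -- the eigenvalues, if `V_⋆ ∔ Z` has dimension `N`
      (∀ N : ℕ, Module.rank ℂ (S.sumSpace Vstar Z) = N →
        (∀ k : ℕ, 1 ≤ k → k ≤ N →
          |1 / AbstractHom.eigenvalue (S.op ε θ) k
            - 1 / AbstractHom.eigenvalue (S.limitOp Vstar Z a₁ a₂ (ε⁻¹ • θ)) k| ≤ C * ε) ∧
        (∀ p : ℕ, N + 1 ≤ p → (p : Cardinal) ≤ Module.rank ℂ 𝓗 →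
          |1 / AbstractHom.eigenvalue (S.op ε θ) p| ≤ C * ε)) := by
  exact mainTheorem6_general n H 𝓗 S Vstar Z a₁ a₂ E h1 h2 hZ h3 h4 h5.2 h6
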